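/- Let $G$ be a simple undirected graph on $n$ vertices with $m\ge 1$ edges and integer edge weights $c_e\in\{1,\dots,C\}$. The arboricity of $G$ is the minimum number $k$ of forests $F_1,\dots,F_k\subseteq G$ such that every edge $e$ of $G$ belongs to exactly $c_e$ of them. There is a randomized algorithm (one program for a word RAM with words of $O(\log(nC))$ bits, random bits, and two subroutines) which, given $n$, $m$ and the list of the weighted edges of $G$, outputs the arboricity of $G$ in $O(m\log(nC))$ time plus - $O(\log(nC))$ calls to a subroutine that returns an integral maximum $s$-$t$ flow, on directed graphs with $O(m)$ vertices and $O(m)$ edges, and - $O(\log(nC))$ calls to a subroutine that returns a directed global minimum cut (a set $\emptyset\ne S\subsetneq V$ that minimizes the total weight of the edges from $V\setminus S$ to $S$), on directed graphs with $O(n)$ vertices and $O(m)$ edges, where all these directed graphs have nonnegative integer edge weights at most $\operatorname{poly}(n,C)$. All bounds hold with certainty. The subroutines may themselves be randomized: if each call, independently of the earlier ones, is answered wrongly with probability at most $\delta$, then the output is wrong with probability at most $O(\log(nC))\cdot\delta$; in particular the output is always correct if the subroutines never err. -/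

import Mathlib

open scoped ENNReal

/-! ### Arboricity of a weighted graph -/

/-- `G` with integer edge weights `c` can be covered by `k` forests, all of them subgraphs of `G`,
such that every edge `e` lies in exactly `c e` of them. -/
def HasForestCover {V : Type*} (G : SimpleGraph V) (c : Sym2 V → ℕ) (k : ℕ) : Prop :=
  ∃ F : Fin k → SimpleGraph V,
    (∀ i, F i ≤ G ∧ (F i).IsAcyclic) ∧
    ∀ e ∈ G.edgeSet, {i | e ∈ (F i).edgeSet}.ncard = c e

/-- `a` is the arboricity of `(G, c)`: the minimum number of forests in such a cover. -/
def IsArboricity {V : Type*} (G : SimpleGraph V) (c : Sym2 V → ℕ) (a : ℕ) : Prop :=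
  IsLeast {k | HasForestCover G c k} a

/-! ### Directed graphs, maximum flows, global minimum cuts -/

/-- An arc with a nonnegative integer weight (capacity). -/
structure Arc where
  tail : ℕ
  head : ℕ
  cap : ℕ

/-- A weighted directed graph on the vertices `0, …, numV - 1`, given by its list of arcs. -/
structure Net where
  numV : ℕ
  arcs : List Arc

namespace Net

/-- The arcs join distinct existing vertices, and there are no parallel arcs. -/
def IsSimple (N : Net) : Prop :=
  (∀ a ∈ N.arcs, a.tail < N.numV ∧ a.head < N.numV ∧ a.tail ≠ a.head) ∧
  (N.arcs.map fun a => (a.tail, a.head)).Nodup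

/-- At most `v` vertices, at most `e` arcs, all weights at most `B`. -/
def SizeAtMost (N : Net) (v e B : ℕ) : Prop :=
  N.numV ≤ v ∧ N.arcs.length ≤ e ∧ ∀ a ∈ N.arcs, a.cap ≤ B

/-- Total flow on the arcs that leave `v`. -/
def outFlow (N : Net) (f : Fin N.arcs.length → ℕ) (v : ℕ) : ℕ :=
  ∑ i, if (N.arcs.get i).tail = v then f i else 0

/-- Total flow on the arcs that enter `v`. -/
def inFlow (N : Net) (f : Fin N.arcs.length → ℕ) (v : ℕ) : ℕ :=
  ∑ i, if (N.arcs.get i).head = v then f i else 0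

/-- `f` is an (integral) flow from `s` to `t`: capacity and conservation constraints. -/
def IsFlow (N : Net) (s t : ℕ) (f : Fin N.arcs.length → ℕ) : Prop :=
  (∀ i, f i ≤ (N.arcs.get i).cap) ∧
  ∀ v < N.numV, v ≠ s → v ≠ t → N.inFlow f v = N.outFlow f v

/-- The value of a flow with source `s`: the net flow out of `s`. -/
def flowValue (N : Net) (s : ℕ) (f : Fin N.arcs.length → ℕ) : ℤ :=
  (N.outFlow f s : ℤ) - N.inFlow f s

/-- The value of the in-cut of `S`: the total weight of the arcs from outside `S` into `S`. -/
def inCut (N : Net) (S : Finset ℕ) : ℕ :=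
  (N.arcs.map fun a => if a.tail ∉ S ∧ a.head ∈ S then a.cap else 0).sum

/-- `S` is a side of a cut: a set of vertices, neither empty nor everything. -/
def IsCutSide (N : Net) (S : Finset ℕ) : Prop :=
  S.Nonempty ∧ S ⊂ Finset.range N.numV

/-- `S` is a (directed) global minimum cut. -/
def IsMinCut (N : Net) (S : Finset ℕ) : Prop :=
  N.IsCutSide S ∧ ∀ S', N.IsCutSide S' → N.inCut S ≤ N.inCut S'

end Net

/-- An input of the maximum flow problem. -/
structure FlowInstance where
  net : Net
  source : ℕ
  sink : ℕ

namespace FlowInstance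

/-- `f` is a maximum flow of the instance. -/
def IsMaxFlow (I : FlowInstance) (f : Fin I.net.arcs.length → ℕ) : Prop :=
  I.net.IsFlow I.source I.sink f ∧
  ∀ g, I.net.IsFlow I.source I.sink g →
    I.net.flowValue I.source g ≤ I.net.flowValue I.source f

/-- A proper instance of bounded size. -/
def Admissible (I : FlowInstance) (v e B : ℕ) : Prop :=
  I.net.IsSimple ∧ I.source < I.net.numV ∧ I.sink < I.net.numV ∧ I.source ≠ I.sink ∧
  I.net.SizeAtMost v e B

end FlowInstance

/-- A proper instance, of bounded size, of the global minimum cut problem. -/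
def Net.Admissible (N : Net) (v e B : ℕ) : Prop :=
  N.IsSimple ∧ 2 ≤ N.numV ∧ N.SizeAtMost v e B

/-! ### Randomized subroutines -/

/-- A randomized maximum flow subroutine: to each instance it answers with a random assignment of
integers to the arcs. -/
abbrev FlowSub := (I : FlowInstance) → PMF (Fin I.net.arcs.length → ℕ)

/-- A randomized global minimum cut subroutine: it answers with a random set of vertices. -/
abbrev CutSub := Net → PMF (Finset ℕ)

/-- On every admissible instance (of size bounded by `v`, `e`, `B`) the answer is a maximum flow
except with probability at most `δ`; on other instances nothing is promised. -/
def FlowSub.ErrorAtMost (F : FlowSub) (v e B : ℕ) (δ : ℝ≥0∞) : Prop :=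
  ∀ I : FlowInstance, I.Admissible v e B → (F I).toOuterMeasure {f | ¬ I.IsMaxFlow f} ≤ δ

/-- The same for global minimum cuts. -/
def CutSub.ErrorAtMost (M : CutSub) (v e B : ℕ) (δ : ℝ≥0∞) : Prop :=
  ∀ N : Net, N.Admissible v e B → (M N).toOuterMeasure {S | ¬ N.IsMinCut S} ≤ δ

/-! ### The machine: a randomized word RAM with the two subroutines

A program is a structured RAM program over registers (named by numbers, hence finitely many in each
program) and a random access memory, which both hold words of `w` bits. Each elementary operation
takes one step. -/

/-- Word operations. -/
inductive WordOp where
  | add | sub | mul | div | lt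

/-- Addition and multiplication are modulo `2 ^ w`, subtraction is truncated at `0`, division rounds
down, and `lt` yields `1` or `0`. -/
def WordOp.eval (w : ℕ) : WordOp → ℕ → ℕ → ℕ
  | .add, a, b => (a + b) % 2 ^ w
  | .sub, a, b => a - b
  | .mul, a, b => (a * b) % 2 ^ w
  | .div, a, b => a / b
  | .lt, a, b => if a < b then 1 else 0

/-- Programs. All arguments except the literal of `const` are names of registers. -/
inductive Prog where
  /-- `r := k` -/
  | const (r k : ℕ)
  /-- `r := a ∘ b` -/
  | op (o : WordOp) (r a b : ℕ)
  /-- `r := mem[a]` -/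
  | load (r a : ℕ)
  /-- `mem[a] := b` -/
  | store (a b : ℕ)
  /-- `r :=` a fair random bit -/
  | flip (r : ℕ)
  /-- Call the maximum flow subroutine on the graph with `nv` vertices whose `ne` arcs are stored as
  triples (tail, head, weight) from address `p` on, with source `s` and sink `t`; the flow values of
  the arcs are stored from address `q` on. -/
  | maxFlow (nv ne p s t q : ℕ)
  /-- Call the global minimum cut subroutine on the graph given in the same way; the indicator
  vector of the set of vertices is stored from address `q` on. -/
  | minCut (nv ne p q : ℕ)
  | seq (P Q : Prog)
  /-- If `r ≠ 0` then `P` else `Q`. -/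
  | cond (r : ℕ) (P Q : Prog)
  /-- While `r ≠ 0` do `P`. -/
  | loop (r : ℕ) (P : Prog)

/-- A configuration: the programs that remain to be executed, one after the other, the contents of
the registers and of the memory, and the lists of all calls of the subroutines made so far. -/
structure Config where
  todo : List Prog
  reg : ℕ → ℕ
  mem : ℕ → ℕ
  flowCalls : List FlowInstance
  cutCalls : List Net

/-- The directed graph with `nv` vertices whose `ne` arcs are stored from address `p` on. -/
def readNet (mem : ℕ → ℕ) (nv ne p : ℕ) : Net where
  numV := nv
  arcs := (List.range ne).map fun i => ⟨mem (p + 3 * i), mem (p + 3 * i + 1), mem (p + 3 * i + 2)⟩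

/-- Store the words `x 0, …, x (len - 1)` from address `q` on. -/
def writeBlock (mem : ℕ → ℕ) (q len : ℕ) (x : Fin len → ℕ) : ℕ → ℕ :=
  fun a => if h : q ≤ a ∧ a - q < len then x ⟨a - q, h.2⟩ else mem a

/-- Put the word `x` into register `r`. -/
def Config.setReg (σ : Config) (r x : ℕ) : Config :=
  { σ with reg := Function.update σ.reg r x }

/-- Execution of the first elementary action of a program, where `σ` holds the rest of the
configuration and `σ.todo` is what has to be done after the program. Each call of a subroutine draws
a fresh random answer. -/
noncomputable def Prog.step (w : ℕ) (F : FlowSub) (M : CutSub) (σ : Config) : Prog → PMF Config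
  | .const r k => PMF.pure (σ.setReg r (k % 2 ^ w))
  | .op o r a b => PMF.pure (σ.setReg r (o.eval w (σ.reg a) (σ.reg b)))
  | .load r a => PMF.pure (σ.setReg r (σ.mem (σ.reg a)))
  | .store a b => PMF.pure { σ with mem := Function.update σ.mem (σ.reg a) (σ.reg b) }
  | .flip r => (PMF.uniformOfFintype Bool).map fun b => σ.setReg r b.toNat
  | .maxFlow nv ne p s t q =>
      let I : FlowInstance := ⟨readNet σ.mem (σ.reg nv) (σ.reg ne) (σ.reg p), σ.reg s, σ.reg t⟩
      (F I).map fun f =>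
        { σ with
          mem := writeBlock σ.mem (σ.reg q) I.net.arcs.length fun i => f i % 2 ^ w
          flowCalls := I :: σ.flowCalls }
  | .minCut nv ne p q =>
      let N : Net := readNet σ.mem (σ.reg nv) (σ.reg ne) (σ.reg p)
      (M N).map fun S =>
        { σ with
          mem := writeBlock σ.mem (σ.reg q) N.numV fun i => if (i : ℕ) ∈ S then 1 else 0
          cutCalls := N :: σ.cutCalls }
  | .seq P Q => PMF.pure { σ with todo := P :: Q :: σ.todo }
  | .cond r P Q => PMF.pure { σ with todo := (if σ.reg r ≠ 0 then P else Q) :: σ.todo }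
  | .loop r P =>
      PMF.pure (if σ.reg r ≠ 0 then { σ with todo := P :: .loop r P :: σ.todo } else σ)

/-- One step of the machine. A configuration with nothing left to do has halted. -/
noncomputable def Config.step (w : ℕ) (F : FlowSub) (M : CutSub) (σ : Config) : PMF Config :=
  match σ.todo with
  | [] => PMF.pure σ
  | P :: rest => P.step w F M { σ with todo := rest }

/-- The random configuration after `T` steps. -/
noncomputable def Config.run (w : ℕ) (F : FlowSub) (M : CutSub) : ℕ → Config → PMF Config
  | 0, σ => PMF.pure σ
  | T + 1, σ => (σ.step w F M).bind fun σ' => Config.run w F M T σ'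

/-- The machine has halted. -/
def Config.Halted (σ : Config) : Prop := σ.todo = []

/-- The output is read from register `0`. -/
def Config.output (σ : Config) : ℕ := σ.reg 0

/-! ### The input -/

/-- `es` lists every edge of `G` exactly once, in any order and with its ends in any order. -/
def IsEdgeList {V : Type*} (G : SimpleGraph V) (es : List (V × V)) : Prop :=
  (es.map fun p => s(p.1, p.2)).Nodup ∧ ∀ e, e ∈ (es.map fun p => s(p.1, p.2)) ↔ e ∈ G.edgeSet

/-- The input words: the numbers of vertices and edges, then for each edge its ends and weight. -/
def inputWords {n : ℕ} (es : List (Fin n × Fin n)) (c : Sym2 (Fin n) → ℕ) : List ℕ :=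
  n :: es.length :: es.flatMap fun p => [(p.1 : ℕ), (p.2 : ℕ), c s(p.1, p.2)]

/-- The initial configuration: the input is in the memory from address `0` on, all else is `0`. -/
def initConfig (P : Prog) {n : ℕ} (es : List (Fin n × Fin n)) (c : Sym2 (Fin n) → ℕ) : Config where
  todo := [P]
  reg := fun _ => 0
  mem := fun a => (inputWords es c).getD a 0
  flowCalls := []
  cutCalls := []

/-!
A graph with integer weights `c` can be covered by `k` forests if and only if it is sparse: every
nonempty set of `s` vertices spans edges of total weight at most `k * (s - 1)`. This is the
Nash-Williams theorem, `NashWilliams.hasForestCover_iff`. For the hard direction one takes a family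
of `k` forests that covers as much as possible without covering an edge too often. If an edge is
left over, consider the edges that can be left over instead after exchanging edges. Their ends are
connected in each forest, even by edges of the same kind, so a component of the graph of these edges
is spanned by `k` trees and a surplus edge, which violates sparsity.

Sparsity for a given `k` is decided by one maximum flow and one minimum cut, `EdgeData.sparse_iff`.
In the flow network each edge sends its weight to its two ends, and each vertex passes on at most
`k`. By Hall's theorem the flow saturates the source if the graph is sparse, and it then orients the
weight such that every vertex receives at most `k`. In the oriented graph with an additional root,
where a vertex gets from the root what it lacks to `k` and has an arc of weight `k` to the root, the
weight of the arcs that enter a set `S` of vertices is `k * #S - weightIn S`, while a set that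
contains the root has in-cut at least `k`. So the graph is sparse if and only if the flow saturates
the source and the minimum in-cut has value at least `k`.

The program first relabels the vertices of positive degree by `1, …, p`, so that `p ≤ 2 * m` and all
networks have size `O(m)`, and then finds the least `k` for which the graph is sparse by binary
search between `0` and the total weight, which is at most `(n * C) ^ 2`. Hence there are
`O(log (n * C))` rounds of `O(m)` steps.

Running time, number and admissibility of the calls have to hold for all answers of the subroutines,
while the output is correct only if all answers are. Both are treated by an adversarial semantics,
`Config.Reaches`: it quantifies over all answers and carries along the assertion `g` that those
given so far are correct. Statements about support and probability follow in
`Config.Reaches.of_mem_support` and, by the union bound over the calls, in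
`Config.Reaches.error_le`. The program is verified for this semantics with a Hoare logic, `Runs`.
-/

/-! ### An adversarial semantics of the machine -/

/-- `Φ` holds after the first elementary action of a program, whatever a random bit or an answer of
a subroutine may be. The second argument of `Φ` is the assertion that all answers given so far are
correct; it is `g` before the action. -/
def Prog.AllNext (w : ℕ) (σ : Config) (g : Prop) (Φ : Config → Prop → Prop) : Prog → Prop
  | .const r k => Φ (σ.setReg r (k % 2 ^ w)) g
  | .op o r a b => Φ (σ.setReg r (o.eval w (σ.reg a) (σ.reg b))) g
  | .load r a => Φ (σ.setReg r (σ.mem (σ.reg a))) g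
  | .store a b => Φ { σ with mem := Function.update σ.mem (σ.reg a) (σ.reg b) } g
  | .flip r => ∀ b : Bool, Φ (σ.setReg r b.toNat) g
  | .maxFlow nv ne p s t q =>
      let I : FlowInstance := ⟨readNet σ.mem (σ.reg nv) (σ.reg ne) (σ.reg p), σ.reg s, σ.reg t⟩
      ∀ f : Fin I.net.arcs.length → ℕ,
        Φ { σ with
              mem := writeBlock σ.mem (σ.reg q) I.net.arcs.length fun i => f i % 2 ^ w
              flowCalls := I :: σ.flowCalls } (g ∧ I.IsMaxFlow f)
  | .minCut nv ne p q =>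
      let N : Net := readNet σ.mem (σ.reg nv) (σ.reg ne) (σ.reg p)
      ∀ S : Finset ℕ,
        Φ { σ with
              mem := writeBlock σ.mem (σ.reg q) N.numV fun i => if (i : ℕ) ∈ S then 1 else 0
              cutCalls := N :: σ.cutCalls } (g ∧ N.IsMinCut S)
  | .seq P Q => Φ { σ with todo := P :: Q :: σ.todo } g
  | .cond r P Q => Φ { σ with todo := (if σ.reg r ≠ 0 then P else Q) :: σ.todo } g
  | .loop r P =>
      Φ (if σ.reg r ≠ 0 then { σ with todo := P :: .loop r P :: σ.todo } else σ) g

/-- `Φ` holds after one step of the machine, whatever the random answers. -/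
def Config.AllNext (w : ℕ) (σ : Config) (g : Prop) (Φ : Config → Prop → Prop) : Prop :=
  match σ.todo with
  | [] => Φ σ g
  | P :: rest => P.AllNext w { σ with todo := rest } g Φ

/-- Whatever the random answers, the machine reaches within `T` steps a configuration that
satisfies `Q`. -/
def Config.Reaches (w : ℕ) (Q : Config → Prop → Prop) : ℕ → Config → Prop → Prop
  | 0, σ, g => Q σ g
  | T + 1, σ, g => Q σ g ∨ σ.AllNext w g (Config.Reaches w Q T)

namespace Config

lemma AllNext.mono {w : ℕ} {σ : Config} {g : Prop} {Φ Ψ : Config → Prop → Prop}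
    (h : σ.AllNext w g Φ) (hΦ : ∀ σ' g', Φ σ' g' → Ψ σ' g') : σ.AllNext w g Ψ := by
  rcases σ with ⟨_ | ⟨P, rest⟩, reg, mem, fc, cc⟩
  · exact hΦ _ _ h
  · cases P <;> first | exact hΦ _ _ h | exact fun x => hΦ _ _ (h x)

lemma Reaches.of_post {w : ℕ} {Q : Config → Prop → Prop} {T : ℕ} {σ : Config} {g : Prop}
    (h : Q σ g) : Reaches w Q T σ g := by
  cases T
  · exact h
  · exact Or.inl h

lemma Reaches.of_le {w : ℕ} {Q : Config → Prop → Prop} {T U : ℕ} {σ : Config} {g : Prop}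
    (h : Reaches w Q T σ g) (hTU : T ≤ U) : Reaches w Q U σ g := by
  induction T generalizing U σ g with
  | zero => exact Reaches.of_post h
  | succ T ih =>
    obtain ⟨U, rfl⟩ : ∃ U', U = U' + 1 := ⟨U - 1, by omega⟩
    rcases h with h | h
    · exact Or.inl h
    · exact Or.inr (h.mono fun σ' g' h' => ih h' (by omega))

lemma Reaches.bind {w : ℕ} {Q R : Config → Prop → Prop} {T U : ℕ} {σ : Config} {g : Prop}
    (h : Reaches w Q T σ g) (hQ : ∀ σ' g', Q σ' g' → Reaches w R U σ' g') :
    Reaches w R (T + U) σ g := by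
  induction T generalizing σ g with
  | zero => rw [Nat.zero_add]; exact hQ _ _ h
  | succ T ih =>
    rcases h with h | h
    · exact (hQ _ _ h).of_le (by omega)
    · rw [Nat.succ_add]
      exact Or.inr (h.mono fun σ' g' h' => ih h')

lemma Reaches.mono {w : ℕ} {Q R : Config → Prop → Prop} {T U : ℕ} {σ : Config} {g : Prop}
    (h : Reaches w Q T σ g) (hTU : T ≤ U) (hQ : ∀ σ' g', Q σ' g' → R σ' g') :
    Reaches w R U σ g := by
  obtain ⟨k, rfl⟩ := Nat.exists_eq_add_of_le hTU
  exact h.bind fun σ' g' h' => Reaches.of_post (hQ _ _ h')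

lemma Reaches.step {w : ℕ} {Q : Config → Prop → Prop} {T : ℕ} {σ : Config} {g : Prop}
    (h : σ.AllNext w g (Reaches w Q T)) : Reaches w Q (T + 1) σ g :=
  Or.inr h

/-- A property of configurations that cannot become true in a step holds all along if it holds in
the end. -/
lemma Reaches.of_backward {w : ℕ} {Q : Config → Prop → Prop} {R : Config → Prop}
    (hQ : ∀ σ g, Q σ g → R σ)
    (hR : ∀ σ g, AllNext w σ g (fun σ' _ => R σ') → R σ) {T : ℕ} {σ : Config} {g : Prop}
    (h : Reaches w Q T σ g) : R σ := by
  induction T generalizing σ g with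
  | zero => exact hQ _ _ h
  | succ T ih =>
    rcases h with h | h
    · exact hQ _ _ h
    · exact hR σ g (h.mono fun _ _ h' => ih h')

end Config

/-! ### From the adversarial to the randomized semantics -/

/-- If every correct answer leads to a bad event of probability at most `b`, then a single random
answer, wrong with probability at most `δ`, leads to one of probability at most `δ + b`. -/
lemma PMF.toOuterMeasure_bind_le {α β : Type*} (p : PMF α) (f : α → PMF β) (W : Set α) (E : Set β)
    {δ b : ℝ≥0∞} (hW : p.toOuterMeasure W ≤ δ)
    (hb : ∀ a ∉ W, (f a).toOuterMeasure E ≤ b) : (p.bind f).toOuterMeasure E ≤ δ + b := by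
  rw [PMF.toOuterMeasure_bind_apply]
  have h1 : ∀ q : PMF β, q.toOuterMeasure E ≤ 1 := fun q => by
    rw [PMF.toOuterMeasure_apply, ← q.tsum_coe]
    exact ENNReal.tsum_le_tsum fun x => Set.indicator_le_self _ _ _
  calc ∑' a, p a * (f a).toOuterMeasure E ≤ ∑' a, (W.indicator p a + p a * b) := by
        refine ENNReal.tsum_le_tsum fun a => ?_
        by_cases ha : a ∈ W
        · rw [Set.indicator_of_mem ha]
          exact (mul_le_of_le_one_right' (h1 _)).trans le_self_add
        · exact (mul_le_mul_right (hb a ha) _).trans le_add_self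
    _ = p.toOuterMeasure W + b := by
        rw [ENNReal.tsum_add, ENNReal.tsum_mul_right, p.tsum_coe, one_mul,
          PMF.toOuterMeasure_apply]
    _ ≤ δ + b := by gcongr

namespace Config

/-- The number of calls of the subroutines made so far. -/
def calls (σ : Config) : ℕ := σ.flowCalls.length + σ.cutCalls.length

lemma run_of_halted (w : ℕ) (F : FlowSub) (M : CutSub) {σ : Config} (h : σ.Halted) (T : ℕ) :
    run w F M T σ = PMF.pure σ := by
  induction T with
  | zero => rfl
  | succ T ih =>
    have : σ.step w F M = PMF.pure σ := by
      unfold Config.step; rw [show σ.todo = [] from h]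
    rw [run, this, PMF.pure_bind, ih]

/-- The random next configuration satisfies what all possible next configurations satisfy. -/
lemma AllNext.of_mem_support {w : ℕ} {σ : Config} {g : Prop} {Φ : Config → Prop → Prop}
    (F : FlowSub) (M : CutSub) (h : σ.AllNext w g Φ) {σ' : Config}
    (hσ' : σ' ∈ (σ.step w F M).support) : ∃ g', Φ σ' g' := by
  rcases σ with ⟨_ | ⟨P, rest⟩, reg, mem, fc, cc⟩
  · rw [show σ' = _ from (PMF.mem_support_pure_iff _ _).1 hσ']
    exact ⟨_, h⟩
  · cases P
    case flip r =>
      obtain ⟨b, -, rfl⟩ := (PMF.mem_support_map_iff _ _ _).1 hσ'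
      exact ⟨_, h b⟩
    case maxFlow nv ne p s t q =>
      obtain ⟨f, -, rfl⟩ := (PMF.mem_support_map_iff _ _ _).1 hσ'
      exact ⟨_, h f⟩
    case minCut nv ne p q =>
      obtain ⟨S, -, rfl⟩ := (PMF.mem_support_map_iff _ _ _).1 hσ'
      exact ⟨_, h S⟩
    all_goals
      rw [show σ' = _ from (PMF.mem_support_pure_iff _ _).1 hσ']
      exact ⟨_, h⟩

theorem Reaches.of_mem_support {w : ℕ} {Q : Config → Prop → Prop} (F : FlowSub) (M : CutSub)
    (hQ : ∀ σ g, Q σ g → σ.Halted) {T : ℕ} {σ : Config} {g : Prop} (h : Reaches w Q T σ g)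
    {σ' : Config} (hσ' : σ' ∈ (run w F M T σ).support) : ∃ g', Q σ' g' := by
  induction T generalizing σ g with
  | zero => rw [show σ' = σ from (PMF.mem_support_pure_iff _ _).1 hσ']; exact ⟨g, h⟩
  | succ T ih =>
    rcases h with h | h
    · rw [run_of_halted _ _ _ (hQ _ _ h)] at hσ'
      rw [show σ' = σ from (PMF.mem_support_pure_iff _ _).1 hσ']; exact ⟨g, h⟩
    · obtain ⟨τ, hτ, hσ'⟩ := (PMF.mem_support_bind_iff _ _ _).1 hσ'
      obtain ⟨g', h'⟩ := h.of_mem_support F M hτ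
      exact ih h' hσ'

/-- At most `L` calls have been made, all of them of admissible instances. -/
def CallsOK (L v v' e B : ℕ) (σ : Config) : Prop :=
  σ.calls ≤ L ∧ (∀ I ∈ σ.flowCalls, I.Admissible v e B) ∧ ∀ N ∈ σ.cutCalls, N.Admissible v' e B

lemma CallsOK.backward {w L v v' e B : ℕ} (σ : Config) (g : Prop)
    (h : AllNext w σ g fun σ' _ => CallsOK L v v' e B σ') : CallsOK L v v' e B σ := by
  rcases σ with ⟨_ | ⟨P, rest⟩, reg, mem, fc, cc⟩
  · exact h
  · cases P
    case flip r => exact h true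
    case maxFlow nv ne p s t q =>
      obtain ⟨h1, h2, h3⟩ := h fun _ => 0
      refine ⟨le_trans ?_ h1, fun I hI => h2 I (List.mem_cons_of_mem _ hI), h3⟩
      simp only [calls, List.length_cons]; omega
    case minCut nv ne p q =>
      obtain ⟨h1, h2, h3⟩ := h ∅
      refine ⟨le_trans ?_ h1, h2, fun I hI => h3 I (List.mem_cons_of_mem _ hI)⟩
      simp only [calls, List.length_cons]; omega
    case loop r P =>
      simp only [AllNext, Prog.AllNext] at h
      split_ifs at h <;> exact h
    all_goals exact h

/-- The union bound over the calls: if every run makes at most `L` calls, all of them admissible,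
and every run without a wrong answer ends in `E`, then `E` is missed with probability at most `δ`
times the number of the remaining calls. -/
theorem Reaches.error_le {w L v v' e B : ℕ} {Q : Config → Prop → Prop} {F : FlowSub} {M : CutSub}
    {δ : ℝ≥0∞} (hF : F.ErrorAtMost v e B δ) (hM : M.ErrorAtMost v' e B δ) {E : Config → Prop}
    (hQ : ∀ σ g, Q σ g → σ.Halted ∧ CallsOK L v v' e B σ ∧ (g → E σ))
    {T : ℕ} {σ : Config} {g : Prop} (h : Reaches w Q T σ g) (hg : g) :
    (run w F M T σ).toOuterMeasure {σ | ¬ E σ} ≤ (L - σ.calls : ℕ) * δ := by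
  have hdone : ∀ (T : ℕ) (σ : Config) (g : Prop), g → Q σ g →
      (run w F M T σ).toOuterMeasure {σ | ¬ E σ} ≤ (L - σ.calls : ℕ) * δ := by
    intro T σ g hg h
    obtain ⟨h1, -, h3⟩ := hQ _ _ h
    rw [run_of_halted _ _ _ h1, PMF.toOuterMeasure_pure_apply,
      if_neg (show σ ∉ {σ | ¬ E σ} from fun hn => hn (h3 hg))]
    exact zero_le
  have hok : ∀ {T : ℕ} {σ : Config} {g : Prop}, Reaches w Q T σ g → CallsOK L v v' e B σ :=
    fun h => h.of_backward (fun σ g h => (hQ σ g h).2.1) CallsOK.backward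
  induction T generalizing σ g with
  | zero => exact hdone 0 _ _ hg h
  | succ T ih =>
    rcases h with h | h
    · exact hdone _ _ _ hg h
    rw [run]
    -- a call uses up one unit of the budget
    have hcall : ∀ c : ℕ, c + 1 ≤ L → δ + ((L - (c + 1) : ℕ) : ℝ≥0∞) * δ = (L - c : ℕ) * δ := by
      intro c hc
      rw [show L - c = (L - (c + 1)) + 1 by omega]
      push_cast
      rw [add_mul, one_mul, add_comm]
    rcases σ with ⟨_ | ⟨P, rest⟩, reg, mem, fc, cc⟩
    · simp only [Config.step, PMF.pure_bind]
      exact ih (g := g) h hg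
    · cases P
      case flip r =>
        simp only [Config.step, Prog.step, PMF.bind_map]
        refine (PMF.toOuterMeasure_bind_le _ _ ∅ _ (δ := 0) (by simp)
          fun b _ => ?_).trans (by rw [zero_add])
        exact ih (h b) hg
      case maxFlow nv ne p s t q =>
        simp only [Config.step, Prog.step, PMF.bind_map]
        have ih' := fun f => ih (h f)
        obtain ⟨h1, h2, -⟩ := hok (h fun _ => 0)
        have h2' := hF _ (h2 _ List.mem_cons_self)
        simp only [calls, List.length_cons] at h1 ih' ⊢
        rw [Nat.add_right_comm] at h1
        rw [← hcall _ h1]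
        refine PMF.toOuterMeasure_bind_le _ _ _ _ h2' fun f hf => ?_
        rw [← Nat.add_right_comm]
        exact ih' f ⟨hg, not_not.1 hf⟩
      case minCut nv ne p q =>
        simp only [Config.step, Prog.step, PMF.bind_map]
        have ih' := fun S => ih (h S)
        obtain ⟨h1, -, h3⟩ := hok (h ∅)
        have h3' := hM _ (h3 _ List.mem_cons_self)
        simp only [calls, List.length_cons] at h1 ih' ⊢
        rw [← Nat.add_assoc] at h1
        rw [← hcall _ h1]
        refine PMF.toOuterMeasure_bind_le _ _ _ _ h3' fun f hf => ?_
        rw [Nat.add_assoc]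
        exact ih' f ⟨hg, not_not.1 hf⟩
      case loop r P =>
        simp only [Config.step, Prog.step, PMF.pure_bind]
        refine (ih (g := g) h hg).trans ?_
        split_ifs <;> exact le_rfl
      all_goals
        simp only [Config.step, Prog.step, PMF.pure_bind]
        exact ih (g := g) h hg

end Config

/-! ### A program logic -/

/-- The data of a configuration: everything but the programs that remain to be executed. -/
structure St where
  reg : ℕ → ℕ
  mem : ℕ → ℕ
  flowCalls : List FlowInstance
  cutCalls : List Net

namespace St

/-- The configuration with the given data in which `todo` remains to be executed. -/
def cfg (s : St) (todo : List Prog) : Config := ⟨todo, s.reg, s.mem, s.flowCalls, s.cutCalls⟩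

/-- Put `x` into register `r`. -/
def setReg (s : St) (r x : ℕ) : St := { s with reg := Function.update s.reg r x }

/-- Put `x` into the memory cell `a`. -/
def setMem (s : St) (a x : ℕ) : St := { s with mem := Function.update s.mem a x }

end St

/-- Within `t` steps the machine with data `s` executes the program `P` and then has data that
satisfy `R`, whatever the random answers. The propositions `g` and the second argument of `R` assert
that all answers so far are correct. -/
def Runs (w : ℕ) (P : Prog) (t : ℕ) (s : St) (g : Prop) (R : St → Prop → Prop) : Prop :=
  ∀ rest, Config.Reaches w (fun σ g' => ∃ s' : St, σ = s'.cfg rest ∧ R s' g') t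
    (s.cfg (P :: rest)) g

lemma Runs.mono {w : ℕ} {P : Prog} {t u : ℕ} {s : St} {g : Prop} {R R' : St → Prop → Prop}
    (h : Runs w P t s g R) (htu : t ≤ u) (hR : ∀ s' g', R s' g' → R' s' g') :
    Runs w P u s g R' := fun rest =>
  (h rest).mono htu fun _ _ ⟨s', h1, h2⟩ => ⟨s', h1, hR _ _ h2⟩

lemma Runs.seq {w : ℕ} {P Q : Prog} {t u : ℕ} {s : St} {g : Prop} {R R' : St → Prop → Prop}
    (h : Runs w P t s g R) (h' : ∀ s' g', R s' g' → Runs w Q u s' g' R') :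
    Runs w (.seq P Q) (t + u + 1) s g R' := fun rest => by
  refine Config.Reaches.step ?_
  refine (h (Q :: rest)).bind ?_
  rintro _ g' ⟨s', rfl, hs'⟩
  exact h' s' g' hs' rest

/-- A loop whose body decreases the bound `j` on the number of the remaining rounds. -/
lemma Runs.while_loop {w r tb : ℕ} {P : Prog} (I : ℕ → St → Prop → Prop)
    (hbody : ∀ j s g, I j s g → s.reg r ≠ 0 →
      ∃ j', j = j' + 1 ∧ Runs w P tb s g (I j')) (j : ℕ) (s : St) (g : Prop) (h : I j s g) :
    Runs w (.loop r P) (j * (tb + 1) + 1) s g fun s' g' => s'.reg r = 0 ∧ ∃ j', I j' s' g' := by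
  induction j generalizing s g with
  | zero =>
    intro rest
    refine Config.Reaches.step ?_
    have h0 : s.reg r = 0 := by
      by_contra h0
      obtain ⟨j', h1, -⟩ := hbody _ _ _ h h0
      omega
    simp only [Config.AllNext, St.cfg, Prog.AllNext, h0, ne_eq, not_true_eq_false, if_false]
    exact Config.Reaches.of_post ⟨s, rfl, h0, _, h⟩
  | succ j ih =>
    intro rest
    rw [show (j + 1) * (tb + 1) + 1 = (tb + (j * (tb + 1) + 1)) + 1 by ring]
    refine Config.Reaches.step ?_
    by_cases h0 : s.reg r = 0
    · simp only [Config.AllNext, St.cfg, Prog.AllNext, h0, ne_eq, not_true_eq_false, if_false]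
      exact Config.Reaches.of_post ⟨s, rfl, h0, _, h⟩
    · obtain ⟨j', h1, h2⟩ := hbody _ _ _ h h0
      obtain rfl : j = j' := by omega
      simp only [Config.AllNext, St.cfg, Prog.AllNext, h0, ne_eq, not_false_eq_true, if_true]
      refine (h2 (.loop r P :: rest)).bind ?_
      rintro _ g' ⟨s', rfl, hs'⟩
      exact ih s' g' hs' rest

/-! ### Programs without loops and calls -/

namespace Prog

/-- The result of a program without loops, random bits and calls if no operation overflows. -/
def exec : Prog → St → St
  | .const r k, s => s.setReg r k
  | .op .add r a b, s => s.setReg r (s.reg a + s.reg b)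
  | .op .sub r a b, s => s.setReg r (s.reg a - s.reg b)
  | .op .mul r a b, s => s.setReg r (s.reg a * s.reg b)
  | .op .div r a b, s => s.setReg r (s.reg a / s.reg b)
  | .op .lt r a b, s => s.setReg r (if s.reg a < s.reg b then 1 else 0)
  | .load r a, s => s.setReg r (s.mem (s.reg a))
  | .store a b, s => s.setMem (s.reg a) (s.reg b)
  | .seq P Q, s => Q.exec (P.exec s)
  | .cond r P Q, s => if s.reg r ≠ 0 then P.exec s else Q.exec s
  | _, s => s

/-- The program has no loops, random bits and calls, and no operation overflows words that are less
than `B`. -/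
def Ok (B : ℕ) : Prog → St → Prop
  | .const _ k, _ => k < B
  | .op .add _ a b, s => s.reg a + s.reg b < B
  | .op .mul _ a b, s => s.reg a * s.reg b < B
  | .op .sub _ _ _, _ => True
  | .op .div _ _ _, _ => True
  | .op .lt _ _ _, _ => True
  | .load _ _, _ => True
  | .store _ _, _ => True
  | .seq P Q, s => P.Ok B s ∧ Q.Ok B (P.exec s)
  | .cond r P Q, s => if s.reg r ≠ 0 then P.Ok B s else Q.Ok B s
  | _, _ => False

/-- A bound on the number of steps of a program without loops. -/
def cost : Prog → ℕ
  | .seq P Q => P.cost + Q.cost + 1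
  | .cond _ P Q => P.cost + Q.cost + 1
  | _ => 1

/-- The program has no loops and calls and writes only to registers from `b` on. -/
def Keeps (b : ℕ) : Prog → Bool
  | .const r _ => b ≤ r
  | .op _ r _ _ => b ≤ r
  | .load r _ => b ≤ r
  | .store _ _ => true
  | .seq P Q => P.Keeps b && Q.Keeps b
  | .cond _ P Q => P.Keeps b && Q.Keeps b
  | _ => false

end Prog

/-- The states `s` and `s'` agree in the registers below `b` and in the recorded calls. -/
def St.Same (b : ℕ) (s s' : St) : Prop :=
  (∀ r < b, s'.reg r = s.reg r) ∧ s'.flowCalls = s.flowCalls ∧ s'.cutCalls = s.cutCalls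

lemma St.Same.refl (b : ℕ) (s : St) : s.Same b s := ⟨fun _ _ => rfl, rfl, rfl⟩

lemma St.Same.trans {b : ℕ} {s s' s'' : St} (h : s.Same b s') (h' : s'.Same b s'') :
    s.Same b s'' :=
  ⟨fun r hr => (h'.1 r hr).trans (h.1 r hr), h'.2.1.trans h.2.1, h'.2.2.trans h.2.2⟩

lemma St.same_setReg {b r : ℕ} (s : St) (x : ℕ) (h : b ≤ r) : s.Same b (s.setReg r x) :=
  ⟨fun r' hr' => Function.update_of_ne (by omega) _ _, rfl, rfl⟩

lemma Prog.same_exec {b : ℕ} (P : Prog) (s : St) (h : P.Keeps b = true) : s.Same b (P.exec s) := by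
  induction P generalizing s with
  | const r k => exact s.same_setReg _ (by simpa [Keeps] using h)
  | op o r a b' => cases o <;> exact s.same_setReg _ (by simpa [Keeps] using h)
  | load r a => exact s.same_setReg _ (by simpa [Keeps] using h)
  | store a b => exact ⟨fun _ _ => rfl, rfl, rfl⟩
  | seq P Q ihP ihQ =>
    simp only [Keeps, Bool.and_eq_true] at h
    exact (ihP s h.1).trans (ihQ _ h.2)
  | cond r P Q ihP ihQ =>
    simp only [Keeps, Bool.and_eq_true] at h
    simp only [exec]
    split_ifs
    exacts [ihP s h.1, ihQ s h.2]
  | _ => exact St.Same.refl _ _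

/-- A program without loops and calls does what `Prog.exec` says. -/
lemma Runs.of_exec {w : ℕ} {P : Prog} {s : St} (g : Prop) (h : P.Ok (2 ^ w) s) :
    Runs w P P.cost s g fun s' g' => s' = P.exec s ∧ g' = g := by
  induction P generalizing s with
  | seq P Q ihP ihQ =>
    refine Runs.seq (ihP h.1) ?_
    rintro _ _ ⟨rfl, rfl⟩
    exact ihQ h.2
  | cond r P Q ihP ihQ =>
    intro rest
    change Config.Reaches _ _ (P.cost + Q.cost + 1) _ _
    refine Config.Reaches.step ?_
    change Config.Reaches _ _ _ ⟨(if s.reg r ≠ 0 then P else Q) :: rest, _, _, _, _⟩ _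
    by_cases h0 : s.reg r ≠ 0
    · have e : (Prog.cond r P Q).exec s = P.exec s := if_pos h0
      rw [if_pos h0, e]
      simp only [Prog.Ok, if_pos h0] at h
      exact (ihP h rest).of_le (Nat.le_add_right _ _)
    · have e : (Prog.cond r P Q).exec s = Q.exec s := if_neg h0
      rw [if_neg h0, e]
      simp only [Prog.Ok, if_neg h0] at h
      exact (ihQ h rest).of_le (Nat.le_add_left _ _)
  | const r k => exact fun rest => Or.inr ⟨_, by
      simp only [Config.setReg, Nat.mod_eq_of_lt (show k < 2 ^ w from h)]; rfl, rfl, rfl⟩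
  | op o r a b =>
    cases o
    case add => exact fun rest => Or.inr ⟨_, by
      simp only [Config.setReg, WordOp.eval, St.cfg,
        Nat.mod_eq_of_lt (show s.reg a + s.reg b < 2 ^ w from h)]; rfl, rfl, rfl⟩
    case mul => exact fun rest => Or.inr ⟨_, by
      simp only [Config.setReg, WordOp.eval, St.cfg,
        Nat.mod_eq_of_lt (show s.reg a * s.reg b < 2 ^ w from h)]; rfl, rfl, rfl⟩
    all_goals exact fun rest => Or.inr ⟨_, rfl, rfl, rfl⟩
  | load r a => exact fun rest => Or.inr ⟨_, rfl, rfl, rfl⟩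
  | store a b => exact fun rest => Or.inr ⟨_, rfl, rfl, rfl⟩
  | _ => exact h.elim

/-- A loop that counts register `r` down from `N`. -/
lemma Runs.for_loop {w r N : ℕ} {P : Prog} (I : ℕ → St → Prop)
    (hbody : ∀ i < N, ∀ s, I i s → s.reg r = N - i →
      P.Ok (2 ^ w) s ∧ I (i + 1) (P.exec s) ∧ (P.exec s).reg r = N - (i + 1))
    {s : St} (g : Prop) (h0 : I 0 s) (hr : s.reg r = N) :
    Runs w (.loop r P) (N * (P.cost + 1) + 1) s g fun s' g' => I N s' ∧ g' = g := by
  refine (Runs.while_loop (w := w) (r := r) (tb := P.cost) (P := P)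
    (fun j s g' => j ≤ N ∧ s.reg r = j ∧ I (N - j) s ∧ g' = g) ?_ N s g
    ⟨le_rfl, hr, by simpa using h0, rfl⟩).mono le_rfl ?_
  · rintro j s _ ⟨hj, hj', hI, rfl⟩ hne
    obtain ⟨j', rfl⟩ : ∃ j', j = j' + 1 := ⟨j - 1, by omega⟩
    refine ⟨j', rfl, ?_⟩
    obtain ⟨h1, h2, h3⟩ := hbody (N - (j' + 1)) (by omega) s hI (by omega)
    refine (Runs.of_exec _ h1).mono le_rfl ?_
    rintro _ _ ⟨rfl, rfl⟩
    rw [show N - (j' + 1) + 1 = N - j' by omega] at h2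
    exact ⟨by omega, by omega, h2, rfl⟩
  · rintro s' g' ⟨h1, j', -, h2, h3, h4⟩
    obtain rfl : j' = 0 := by omega
    exact ⟨by simpa using h3, h4⟩

/-! ### Blocks of memory and calls of the subroutines -/

/-- The list `l` of words is stored from address `a` on. -/
def Blk (mem : ℕ → ℕ) (a : ℕ) (l : List ℕ) : Prop :=
  ∀ i (h : i < l.length), mem (a + i) = l[i]

namespace Blk

lemma nil (mem : ℕ → ℕ) (a : ℕ) : Blk mem a [] := fun i h => by simp at h

lemma congr {mem mem' : ℕ → ℕ} {a : ℕ} {l : List ℕ} (h : Blk mem a l)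
    (hm : ∀ x, a ≤ x → x < a + l.length → mem' x = mem x) : Blk mem' a l := fun i hi =>
  (hm _ (by omega) (by omega)).trans (h i hi)

lemma update {mem : ℕ → ℕ} {a : ℕ} {l : List ℕ} (h : Blk mem a l) (x y : ℕ)
    (hx : x < a ∨ a + l.length ≤ x) : Blk (Function.update mem x y) a l :=
  h.congr fun z _ _ => Function.update_of_ne (by omega) _ _

lemma snoc {mem : ℕ → ℕ} {a : ℕ} {l : List ℕ} (h : Blk mem a l) (x y : ℕ)
    (hx : x = a + l.length) : Blk (Function.update mem x y) a (l ++ [y]) := by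
  intro i hi
  simp only [List.length_append, List.length_cons, List.length_nil] at hi
  subst hx
  rcases Nat.lt_or_ge i l.length with h' | h'
  · rw [Function.update_of_ne (by omega), h i h', List.getElem_append_left]
  · obtain rfl : i = l.length := by omega
    simp

lemma append {mem : ℕ → ℕ} {a : ℕ} {l l' : List ℕ} (h : Blk mem a l)
    (h' : Blk mem (a + l.length) l') : Blk mem a (l ++ l') := by
  intro i hi
  rw [List.length_append] at hi
  rw [List.getElem_append]
  split_ifs with hl
  · exact h i hl
  · rw [← h' (i - l.length) (by omega)]; congr 1; omega

end Blk

/-- The representation of a list of arcs in memory. -/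
def arcWords (l : List Arc) : List ℕ := l.flatMap fun a => [a.tail, a.head, a.cap]

@[simp] lemma arcWords_nil : arcWords [] = [] := rfl

@[simp] lemma arcWords_append (l l' : List Arc) : arcWords (l ++ l') = arcWords l ++ arcWords l' :=
  List.flatMap_append

@[simp] lemma arcWords_cons (a : Arc) (l : List Arc) :
    arcWords (a :: l) = [a.tail, a.head, a.cap] ++ arcWords l := rfl

@[simp] lemma length_arcWords (l : List Arc) : (arcWords l).length = 3 * l.length := by
  induction l with
  | nil => rfl
  | cons a l ih => rw [arcWords_cons, List.length_append, ih]; simp; omega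

lemma arcWords_getElem {l : List Arc} {i : ℕ} (h : i < l.length) :
    (arcWords l)[3 * i]'(by rw [length_arcWords]; omega) = l[i].tail ∧
    (arcWords l)[3 * i + 1]'(by rw [length_arcWords]; omega) = l[i].head ∧
    (arcWords l)[3 * i + 2]'(by rw [length_arcWords]; omega) = l[i].cap := by
  induction l generalizing i with
  | nil => simp at h
  | cons a l ih =>
    rcases i with _ | i
    · simp
    · have := ih (i := i) (by simpa using h)
      simpa [arcWords_cons, Nat.mul_add, Nat.add_right_comm _ 3] using this

lemma Blk.arc {mem : ℕ → ℕ} {p : ℕ} {l : List Arc} (h : Blk mem p (arcWords l)) {i : ℕ}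
    (hi : i < l.length) : mem (p + 3 * i) = l[i].tail ∧ mem (p + 3 * i + 1) = l[i].head ∧
      mem (p + 3 * i + 2) = l[i].cap := by
  obtain ⟨h1, h2, h3⟩ := arcWords_getElem hi
  rw [← h1, ← h2, ← h3]
  exact ⟨h _ _, h (3 * i + 1) _, h (3 * i + 2) _⟩

lemma Blk.readNet_eq {mem : ℕ → ℕ} {p : ℕ} {l : List Arc} (h : Blk mem p (arcWords l)) (nv : ℕ) :
    readNet mem nv l.length p = ⟨nv, l⟩ := by
  simp only [readNet, Net.mk.injEq, true_and]
  refine List.ext_getElem (by simp) fun i h1 h2 => ?_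
  obtain ⟨e1, e2, e3⟩ := h.arc h2
  simp [e1, e2, e3]

lemma writeBlock_of_mem {mem : ℕ → ℕ} {q len : ℕ} {x : Fin len → ℕ} {i : ℕ} (h : i < len) :
    writeBlock mem q len x (q + i) = x ⟨i, h⟩ := by
  have : q ≤ q + i ∧ q + i - q < len := by omega
  rw [writeBlock, dif_pos this]
  congr 2; omega

lemma writeBlock_of_lt {mem : ℕ → ℕ} {q len : ℕ} {x : Fin len → ℕ} {a : ℕ} (h : a < q) :
    writeBlock mem q len x a = mem a := by
  rw [writeBlock, dif_neg (by omega)]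

/-- A call of the maximum flow subroutine: `φ i` is the word that it stores for the arc `i`. -/
lemma Runs.maxFlow {w nv ne p s' t q : ℕ} {s : St} {g : Prop} {N : Net}
    (hv : s.reg nv = N.numV) (he : s.reg ne = N.arcs.length)
    (hp : Blk s.mem (s.reg p) (arcWords N.arcs)) :
    Runs w (.maxFlow nv ne p s' t q) 1 s g fun s₁ g₁ => ∃ f : Fin N.arcs.length → ℕ,
      s₁ = { s with
        mem := writeBlock s.mem (s.reg q) N.arcs.length fun i => f i % 2 ^ w
        flowCalls := ⟨N, s.reg s', s.reg t⟩ :: s.flowCalls } ∧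
      g₁ = (g ∧ FlowInstance.IsMaxFlow ⟨N, s.reg s', s.reg t⟩ f) := by
  have hN : readNet s.mem (s.reg nv) (s.reg ne) (s.reg p) = N := by
    rw [hv, he, hp.readNet_eq]
  subst hN
  exact fun rest => Or.inr fun f => ⟨_, rfl, f, rfl, rfl⟩

/-- A call of the minimum cut subroutine. -/
lemma Runs.minCut {w nv ne p q : ℕ} {s : St} {g : Prop} {N : Net}
    (hv : s.reg nv = N.numV) (he : s.reg ne = N.arcs.length)
    (hp : Blk s.mem (s.reg p) (arcWords N.arcs)) :
    Runs w (.minCut nv ne p q) 1 s g fun s₁ g₁ => ∃ S : Finset ℕ,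
      s₁ = { s with
        mem := writeBlock s.mem (s.reg q) N.numV fun i => if (i : ℕ) ∈ S then 1 else 0
        cutCalls := N :: s.cutCalls } ∧
      g₁ = (g ∧ N.IsMinCut S) := by
  have hN : readNet s.mem (s.reg nv) (s.reg ne) (s.reg p) = N := by
    rw [hv, he, hp.readNet_eq]
  subst hN
  exact fun rest => Or.inr fun S => ⟨_, rfl, S, rfl, rfl⟩

/-! ### Covering a weighted graph by forests: the Nash-Williams theorem -/

namespace NashWilliams

open SimpleGraph Finset
open scoped Classical

variable {V : Type*}

/-- The edges of `H` with both ends in `S`. -/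
noncomputable def edgesIn [Fintype V] (H : SimpleGraph V) (S : Finset V) : Finset (Sym2 V) :=
  H.edgeFinset.filter fun e => ∀ v ∈ e, v ∈ S

lemma card_edgesIn [Fintype V] (H : SimpleGraph V) (S : Finset V) :
    #(edgesIn H S) = Nat.card (H.induce (S : Set V)).edgeSet := by
  rw [Nat.card_eq_fintype_card, ← edgeFinset_card]
  symm
  refine card_bij (fun e _ => e.map Subtype.val) ?_ ?_ ?_
  · intro e he
    induction e using Sym2.ind with | _ x y =>
    simpa [edgesIn] using he
  · intro e _ e' _ h
    exact Sym2.map.injective Subtype.val_injective h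
  · intro e he
    induction e using Sym2.ind with | _ x y =>
    simp only [edgesIn, mem_filter, mem_edgeFinset, mem_edgeSet, Sym2.mem_iff, forall_eq_or_imp,
      forall_eq] at he
    exact ⟨s(⟨x, he.2.1⟩, ⟨y, he.2.2⟩), by simpa using he.1, rfl⟩

lemma card_edgesIn_le [Fintype V] {H : SimpleGraph V} (hH : H.IsAcyclic) {S : Finset V}
    (hS : S.Nonempty) :
    #(edgesIn H S) + 1 ≤ #S := by
  rw [card_edgesIn]
  have : Nonempty (S : Set V) := hS.to_subtype
  obtain ⟨T, hT, -, hT'⟩ := (connected_top (V := (S : Set V))).exists_isTree_le_of_le_of_isAcyclic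
    (le_top : H.induce (S : Set V) ≤ ⊤) (hH.induce _)
  have h1 := hT'.card_edgeFinset
  have h2 := card_le_card (edgeFinset_mono hT)
  rw [Nat.card_eq_fintype_card, ← edgeFinset_card]
  have h3 : Fintype.card (S : Set V) = #S := Fintype.card_coe S
  rw [h3] at h1
  omega

lemma le_card_edgesIn [Fintype V] {H : SimpleGraph V} {S : Finset V}
    (h : (H.induce (S : Set V)).Connected) : #S ≤ #(edgesIn H S) + 1 := by
  rw [card_edgesIn]
  simpa using h.card_vert_le_card_edgeSet_add_one

/-- The sparsity condition of Nash-Williams: a nonempty set of `s` vertices spans edges of total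
weight at most `k * (s - 1)`. -/
def Sparse [Fintype V] (G : SimpleGraph V) (c : Sym2 V → ℕ) (k : ℕ) : Prop :=
  ∀ S : Finset V, S.Nonempty → k + ∑ e ∈ edgesIn G S, c e ≤ k * #S

/-- The number of members of a family of graphs that contain `e`. -/
noncomputable def cover {k : ℕ} (F : Fin k → SimpleGraph V) (e : Sym2 V) : ℕ :=
  ∑ i, if e ∈ (F i).edgeSet then 1 else 0

lemma cover_eq_ncard {k : ℕ} (F : Fin k → SimpleGraph V) (e : Sym2 V) :
    cover F e = {i | e ∈ (F i).edgeSet}.ncard := by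
  rw [cover, sum_boole, Set.ncard_eq_toFinset_card', Set.toFinset_ofPred]; simp

lemma sum_cover {k : ℕ} (F : Fin k → SimpleGraph V) (A : Finset (Sym2 V)) :
    ∑ e ∈ A, cover F e = ∑ i, #(A.filter fun e => e ∈ (F i).edgeSet) := by
  simp only [cover, card_filter]
  exact sum_comm

lemma edgesIn_filter [Fintype V] {G H : SimpleGraph V} (h : H ≤ G) (S : Finset V) :
    ((edgesIn G S).filter fun e => e ∈ H.edgeSet) = edgesIn H S := by
  ext e
  simp only [edgesIn, mem_filter, mem_edgeFinset]
  exact ⟨fun ⟨⟨_, h2⟩, h3⟩ => ⟨h3, h2⟩, fun ⟨h1, h2⟩ => ⟨⟨edgeSet_mono h h1, h2⟩, h1⟩⟩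

lemma Sparse.of_hasForestCover [Fintype V] {G : SimpleGraph V} {c : Sym2 V → ℕ} {k : ℕ}
    (h : HasForestCover G c k) : Sparse G c k := by
  obtain ⟨F, h1, h2⟩ := h
  intro S hS
  have : ∑ e ∈ edgesIn G S, c e = ∑ i, #(edgesIn (F i) S) := by
    simp only [← edgesIn_filter (h1 _).1, ← sum_cover]
    refine sum_congr rfl fun e he => ?_
    rw [cover_eq_ncard, h2 e (by simpa using (mem_filter.1 he).1)]
  rw [this]
  calc k + ∑ i, #(edgesIn (F i) S) = ∑ i, (#(edgesIn (F i) S) + 1) := by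
        rw [sum_add_distrib]; simp [add_comm]
    _ ≤ ∑ _i : Fin k, #S := sum_le_sum fun i _ => card_edgesIn_le (h1 i).2 hS
    _ = k * #S := by simp

/-- A partial cover: forests in which no edge occurs too often. -/
structure Valid (G : SimpleGraph V) (c : Sym2 V → ℕ) {k : ℕ} (F : Fin k → SimpleGraph V) :
    Prop where
  le : ∀ i, F i ≤ G
  acyclic : ∀ i, (F i).IsAcyclic
  cover_le : ∀ e ∈ G.edgeSet, cover F e ≤ c e

/-- The total number of edges of a partial cover. -/
noncomputable def size [Fintype V] (G : SimpleGraph V) {k : ℕ} (F : Fin k → SimpleGraph V) : ℕ :=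
  ∑ e ∈ G.edgeFinset, cover F e

lemma cover_update {k : ℕ} (F : Fin k → SimpleGraph V) (i : Fin k) (H : SimpleGraph V)
    (e : Sym2 V) : cover (Function.update F i H) e + (if e ∈ (F i).edgeSet then 1 else 0) =
      cover F e + (if e ∈ H.edgeSet then 1 else 0) := by
  unfold cover
  rw [← add_sum_erase _ _ (mem_univ i), ← add_sum_erase _ _ (mem_univ i), Function.update_self]
  rw [sum_congr rfl (g := fun j => if e ∈ (F j).edgeSet then 1 else 0) fun j hj => by
    rw [Function.update_of_ne (ne_of_mem_erase hj)]]
  omega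

/-- In a partial cover of maximum size, the ends of an edge that is not covered often enough are
connected in each of the forests. -/
lemma Valid.reachable [Fintype V] {G : SimpleGraph V} {c : Sym2 V → ℕ} {k : ℕ}
    {F : Fin k → SimpleGraph V} (hF : Valid G c F)
    (hmax : ∀ F' : Fin k → SimpleGraph V, Valid G c F' → size G F' ≤ size G F)
    {x y : V} (hxy : G.Adj x y) (hc : cover F s(x, y) < c s(x, y)) (i : Fin k) :
    (F i).Reachable x y := by
  by_contra hr
  have hmem : ∀ e, e ∈ (F i ⊔ edge x y).edgeSet ↔ e ∈ (F i).edgeSet ∨ e = s(x, y) := by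
    intro e
    rw [edgeSet_sup, edgeSet_edge_of_ne hxy.ne]; rfl
  have hnot : s(x, y) ∉ (F i).edgeSet := fun h => hr (Adj.reachable h)
  have hcov : ∀ e, cover (Function.update F i (F i ⊔ edge x y)) e =
      cover F e + if e = s(x, y) then 1 else 0 := by
    intro e
    have := cover_update F i (F i ⊔ edge x y) e
    simp only [hmem] at this
    by_cases h1 : e = s(x, y)
    · subst h1; simp [hnot] at this ⊢; omega
    · simp [h1] at this ⊢; omega
  have hval : Valid G c (Function.update F i (F i ⊔ edge x y)) := by
    refine ⟨fun j => ?_, fun j => ?_, fun e he => ?_⟩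
    · by_cases hj : j = i
      · subst hj
        rw [Function.update_self]
        exact sup_le (hF.le j) ((edge_le_iff _).2 (Or.inr hxy))
      · rw [Function.update_of_ne hj]; exact hF.le j
    · by_cases hj : j = i
      · subst hj
        rw [Function.update_self]
        exact (hF.acyclic j).sup_edge_of_not_reachable hr
      · rw [Function.update_of_ne hj]; exact hF.acyclic j
    · rw [hcov]
      split_ifs with h
      · rw [h]; exact hc
      · exact hF.cover_le e he
  have := hmax _ hval
  simp only [size, hcov, sum_add_distrib, sum_ite_eq', mem_edgeFinset, mem_edgeSet, hxy,
    if_true] at this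
  omega

/-- The partial covers that arise from `F₀` by successive edge replacements, together with the ends
of an edge that is not covered often enough. A replacement puts this edge into one of the forests
and removes from it an edge that separates its ends; the removed edge then is the next one. -/
inductive Exchange {k : ℕ} (F₀ : Fin k → SimpleGraph V) (x₀ y₀ : V) :
    (Fin k → SimpleGraph V) → V → V → Prop
  | base : Exchange F₀ x₀ y₀ F₀ x₀ y₀
  | step {F : Fin k → SimpleGraph V} {x y : V} (h : Exchange F₀ x₀ y₀ F x y) (i : Fin k) (x' y' : V)
      (hadj : (F i).Adj x' y') (hsep : ¬ ((F i).deleteEdges {s(x', y')}).Reachable x y) :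
      Exchange F₀ x₀ y₀
        (Function.update F i ((F i).deleteEdges {s(x', y')} ⊔ edge x y)) x' y'

lemma mem_replace {H : SimpleGraph V} {x y x' y' : V} (hne : x ≠ y) (e : Sym2 V) :
    e ∈ (H.deleteEdges {s(x', y')} ⊔ edge x y).edgeSet ↔
      (e ∈ H.edgeSet ∧ e ≠ s(x', y')) ∨ e = s(x, y) := by
  rw [edgeSet_sup, edgeSet_edge_of_ne hne, edgeSet_deleteEdges]; rfl

/-- Replacements do not change the number of covered edges, so that maximality is preserved. -/
lemma Exchange.spec [Fintype V] {G : SimpleGraph V} {c : Sym2 V → ℕ} {k : ℕ}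
    {F₀ : Fin k → SimpleGraph V} {x₀ y₀ : V} (hF₀ : Valid G c F₀) (hxy₀ : G.Adj x₀ y₀)
    (hc₀ : cover F₀ s(x₀, y₀) < c s(x₀, y₀))
    {F : Fin k → SimpleGraph V} {x y : V} (h : Exchange F₀ x₀ y₀ F x y) :
    Valid G c F ∧ size G F = size G F₀ ∧ G.Adj x y ∧ cover F s(x, y) < c s(x, y) := by
  induction h with
  | base => exact ⟨hF₀, rfl, hxy₀, hc₀⟩
  | @step F x y h i x' y' hadj hsep ih =>
    obtain ⟨hF, hs, hxy, hc⟩ := ih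
    have hnot : s(x, y) ∈ (F i).edgeSet → s(x, y) = s(x', y') := by
      intro h1
      by_contra h2
      exact hsep (Adj.reachable (deleteEdges_adj.2 ⟨h1, h2⟩))
    have hcov : ∀ e, cover (Function.update F i ((F i).deleteEdges {s(x', y')} ⊔ edge x y)) e +
        (if e = s(x', y') then 1 else 0) = cover F e + if e = s(x, y) then 1 else 0 := by
      intro e
      have := cover_update F i ((F i).deleteEdges {s(x', y')} ⊔ edge x y) e
      simp only [mem_replace hxy.ne] at this
      have h1 : e = s(x', y') → e ∈ (F i).edgeSet := fun h => by rw [h]; exact hadj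
      have h2 : e = s(x, y) → e ∈ (F i).edgeSet → e = s(x', y') := fun h => by
        rw [h]; exact hnot
      split_ifs at this ⊢ <;> first | omega | (exfalso; tauto)
    refine ⟨⟨fun j => ?_, fun j => ?_, fun e he => ?_⟩, ?_, hF.le i hadj, ?_⟩
    · by_cases hj : j = i
      · subst hj
        rw [Function.update_self]
        exact sup_le ((deleteEdges_le _).trans (hF.le j)) ((edge_le_iff _).2 (Or.inr hxy))
      · rw [Function.update_of_ne hj]; exact hF.le j
    · by_cases hj : j = i
      · subst hj
        rw [Function.update_self]
        exact ((hF.acyclic j).anti (deleteEdges_le _)).sup_edge_of_not_reachable hsep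
      · rw [Function.update_of_ne hj]; exact hF.acyclic j
    · have h1 := hcov e
      have h2 := hF.cover_le e he
      by_cases h3 : e = s(x, y)
      · rw [if_pos h3] at h1; rw [← h3] at hc; omega
      · rw [if_neg h3] at h1; omega
    · rw [← hs]
      have := sum_congr (rfl : G.edgeFinset = G.edgeFinset) fun e _ => hcov e
      simp only [sum_add_distrib, sum_ite_eq', mem_edgeFinset, mem_edgeSet, hxy, hF.le i hadj,
        if_true] at this
      exact Nat.add_right_cancel this
    · have h1 := hcov s(x', y')
      rw [if_pos rfl] at h1
      have h2 := hF.cover_le _ (show s(x', y') ∈ G.edgeSet from hF.le i hadj)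
      split_ifs at h1 with h3
      · rw [← h3] at hc; omega
      · omega

lemma reachable_of_forall_adj {H H' : SimpleGraph V} (h : ∀ u v, H.Adj u v → H'.Reachable u v)
    {u v : V} (huv : H.Reachable u v) : H'.Reachable u v := by
  obtain ⟨p⟩ := huv
  induction p with
  | nil => exact Reachable.refl _
  | cons hadj _ ih => exact (h _ _ hadj).trans ih

/-- If the ends of a path of a forest are connected by edges outside `R` only through edges of `R`
then they are connected inside `R`. -/
lemma reachable_inf_of_separating {H R : SimpleGraph V} (hH : H.IsAcyclic) {x y : V}
    (hxy : H.Reachable x y)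
    (hR : ∀ u v, H.Adj u v → ¬ (H.deleteEdges {s(u, v)}).Reachable x y → R.Adj u v) :
    (H ⊓ R).Reachable x y := by
  obtain ⟨p, hp⟩ := hxy.exists_isPath
  refine ⟨p.transfer _ fun e he => ?_⟩
  induction e using Sym2.ind with | _ u v =>
  have hadj : H.Adj u v := p.adj_of_mem_edges he
  refine ⟨hadj, hR u v hadj fun hr => ?_⟩
  obtain ⟨q, hq⟩ := hr.exists_isPath
  have hle : H.deleteEdges {s(u, v)} ≤ H := deleteEdges_le _
  have := congrArg Subtype.val
    ((hH.subsingleton_path x y).elim ⟨p, hp⟩ ⟨q.mapLe hle, hq.mapLe hle⟩)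
  simp only at this
  rw [this, Walk.edges_mapLe_eq_edges] at he
  have := q.edges_subset_edgeSet he
  simp [edgeSet_deleteEdges] at this

/-- The hard direction of the Nash-Williams theorem. If a partial cover `F` of maximum size leaves
an edge uncovered, let `R` be the graph of all edges that can be made uncovered by edge
replacements. The connectivity of `F i ⊓ R` does not change under edge replacements, so that it is
the connectivity of `R` for each `i`, and the vertices of a component of `R` violate sparsity. -/
lemma Sparse.hasForestCover [Fintype V] {G : SimpleGraph V} {c : Sym2 V → ℕ} {k : ℕ}
    (hsp : Sparse G c k) : HasForestCover G c k := by
  obtain ⟨F₀, hF₀, hmax⟩ : ∃ F₀ : Fin k → SimpleGraph V, Valid G c F₀ ∧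
      ∀ F', Valid G c F' → size G F' ≤ size G F₀ := by
    obtain ⟨F₀, h1, h2⟩ := Set.exists_max_image {F : Fin k → SimpleGraph V | Valid G c F} (size G)
      (Set.toFinite _) ⟨fun _ => ⊥, ⟨fun _ => bot_le, fun _ => isAcyclic_bot, fun e _ => by
        simp [cover]⟩⟩
    exact ⟨F₀, h1, h2⟩
  by_cases hall : ∀ e ∈ G.edgeSet, cover F₀ e = c e
  · exact ⟨F₀, fun i => ⟨hF₀.le i, hF₀.acyclic i⟩, fun e he => by
      rw [← hall e he, cover_eq_ncard]⟩
  exfalso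
  push Not at hall
  obtain ⟨e₀, he₀, hne⟩ := hall
  induction e₀ using Sym2.ind with | _ x₀ y₀ =>
  have hc₀ := lt_of_le_of_ne (hF₀.cover_le _ he₀) hne
  have spec := fun {F x y} (h : Exchange F₀ x₀ y₀ F x y) => h.spec hF₀ he₀ hc₀
  let R : SimpleGraph V := SimpleGraph.fromEdgeSet
    {e | ∃ F x y, Exchange F₀ x₀ y₀ F x y ∧ e = s(x, y)}
  have hRadj : ∀ {F x y}, Exchange F₀ x₀ y₀ F x y → R.Adj x y := fun h =>
    (fromEdgeSet_adj _).2 ⟨⟨_, _, _, h, rfl⟩, (spec h).2.2.1.ne⟩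
  -- an edge of a forest that separates the ends of an uncovered edge can be exchanged for it
  have hreach : ∀ {F x y}, Exchange F₀ x₀ y₀ F x y → ∀ i, (F i ⊓ R).Reachable x y := by
    intro F x y h i
    obtain ⟨hF, hs, hxy, hc⟩ := spec h
    exact reachable_inf_of_separating (hF.acyclic i)
      (hF.reachable (fun F' hF' => (hmax F' hF').trans hs.ge) hxy hc i)
      fun u v huv hsep => hRadj (h.step i u v huv hsep)
  -- the edge added by a replacement joins vertices that are already connected within `R`
  have hinv : ∀ {F x y}, Exchange F₀ x₀ y₀ F x y → ∀ i u v, (F i ⊓ R).Reachable u v →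
      (F₀ i ⊓ R).Reachable u v := by
    intro F x y h
    induction h with
    | base => exact fun _ _ _ h => h
    | @step F x y h i x' y' hadj hsep ih =>
      intro j u v huv
      by_cases hj : j = i
      · subst hj
        rw [Function.update_self] at huv
        refine ih j u v (reachable_of_forall_adj (fun a b hab => ?_) huv)
        have h1 := (mem_edgeSet _).2 hab.1
        rw [mem_replace (spec h).2.2.1.ne] at h1
        rcases h1 with h1 | h1
        · exact Adj.reachable ⟨h1.1, hab.2⟩
        · rcases Sym2.eq_iff.1 h1 with ⟨rfl, rfl⟩ | ⟨rfl, rfl⟩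
          exacts [hreach h j, (hreach h j).symm]
      · rw [Function.update_of_ne hj] at huv
        exact ih j u v huv
  have hiff : ∀ i u v, R.Reachable u v → (F₀ i ⊓ R).Reachable u v := by
    intro i u v huv
    refine reachable_of_forall_adj (fun a b hab => ?_) huv
    obtain ⟨⟨F, x, y, h, hab⟩, -⟩ := (fromEdgeSet_adj _).1 hab
    rcases Sym2.eq_iff.1 hab with ⟨rfl, rfl⟩ | ⟨rfl, rfl⟩
    exacts [hinv h i _ _ (hreach h i), (hinv h i _ _ (hreach h i)).symm]
  let U : Finset V := univ.filter fun v => R.Reachable x₀ v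
  have hx₀ : x₀ ∈ U := by simp [U]
  have hy₀ : y₀ ∈ U := by simpa [U] using (hRadj .base).reachable
  have hconn : ∀ i, ((F₀ i).induce (U : Set V)).Connected := by
    intro i
    have hsupp : (U : Set V) = ((F₀ i ⊓ R).connectedComponentMk x₀).supp := by
      ext v
      rw [ConnectedComponent.mem_supp_iff, ConnectedComponent.eq]
      simp only [U, coe_filter, mem_univ, true_and, Set.mem_ofPred_eq]
      exact ⟨fun h => (hiff i _ _ h).symm, fun h => (h.mono inf_le_right).symm⟩
    rw [hsupp]
    exact ((F₀ i ⊓ R).connectedComponentMk x₀).connected_toSimpleGraph.mono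
      (comap_monotone _ inf_le_left)
  have h1 : ∑ e ∈ edgesIn G U, cover F₀ e < ∑ e ∈ edgesIn G U, c e := by
    refine sum_lt_sum (fun e he => hF₀.cover_le e (by simpa using (mem_filter.1 he).1))
      ⟨s(x₀, y₀), ?_, hc₀⟩
    simp only [edgesIn, mem_filter, mem_edgeFinset, Sym2.mem_iff, forall_eq_or_imp, forall_eq]
    exact ⟨he₀, hx₀, hy₀⟩
  have h2 : k * #U ≤ ∑ e ∈ edgesIn G U, cover F₀ e + k := by
    rw [sum_cover]
    simp only [edgesIn_filter (hF₀.le _)]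
    calc k * #U = ∑ _i : Fin k, #U := by simp
      _ ≤ ∑ i, (#(edgesIn (F₀ i) U) + 1) := sum_le_sum fun i _ => le_card_edgesIn (hconn i)
      _ = _ := by rw [sum_add_distrib]; simp
  have h3 := hsp U ⟨x₀, hx₀⟩
  omega

/-- The Nash-Williams theorem. -/
theorem hasForestCover_iff [Fintype V] {G : SimpleGraph V} {c : Sym2 V → ℕ} {k : ℕ} :
    HasForestCover G c k ↔ Sparse G c k :=
  ⟨Sparse.of_hasForestCover, Sparse.hasForestCover⟩

end NashWilliams

/-! ### Testing sparsity with one maximum flow and one minimum cut -/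

/-- A weighted graph on the vertices `1, …, p`: the edge number `i`, for `i < m`, joins `a i` and
`b i` and has weight `c i`. The values of `a`, `b`, `c` from `m` on are irrelevant. -/
structure EdgeData where
  m : ℕ
  p : ℕ
  a : ℕ → ℕ
  b : ℕ → ℕ
  c : ℕ → ℕ

namespace EdgeData

open Finset

/-- The edges join distinct vertices among `1, …, p`, there are no parallel edges, and the number of
vertices is linear in the number of edges, as it is without isolated vertices. -/
structure Proper (E : EdgeData) : Prop where
  a_pos : ∀ i < E.m, 1 ≤ E.a i
  a_le : ∀ i < E.m, E.a i ≤ E.p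
  b_pos : ∀ i < E.m, 1 ≤ E.b i
  b_le : ∀ i < E.m, E.b i ≤ E.p
  ne : ∀ i < E.m, E.a i ≠ E.b i
  inj : ∀ i < E.m, ∀ j < E.m, E.a i = E.a j → E.b i = E.b j → i = j
  inj' : ∀ i < E.m, ∀ j < E.m, E.a i = E.b j → E.b i = E.a j → i = j
  p_le : E.p ≤ 2 * E.m
  p_pos : 1 ≤ E.p

/-- The total weight of the edges spanned by `S`. -/
def weightIn (E : EdgeData) (S : Finset ℕ) : ℕ :=
  ∑ i ∈ range E.m, if E.a i ∈ S ∧ E.b i ∈ S then E.c i else 0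

/-- The sparsity condition of Nash-Williams. -/
def Sparse (E : EdgeData) (k : ℕ) : Prop :=
  ∀ S ⊆ Icc 1 E.p, S.Nonempty → k + E.weightIn S ≤ k * #S

/-- The arcs of the flow network. The sink is `0`, the source is `3 * m + 1`, and `2 * m + 1 + i` is
the node of the edge `i`. -/
def flowArcs (E : EdgeData) (k : ℕ) : List Arc :=
  ((List.range E.m).flatMap fun i => [⟨3 * E.m + 1, 2 * E.m + 1 + i, E.c i⟩,
    ⟨2 * E.m + 1 + i, E.a i, E.c i⟩, ⟨2 * E.m + 1 + i, E.b i, E.c i⟩]) ++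
  (List.range E.p).map fun j => ⟨j + 1, 0, k⟩

/-- The flow network in which each edge sends its weight to its ends, which pass on at most `k`. -/
def flowNet (E : EdgeData) (k : ℕ) : Net := ⟨3 * E.m + 2, E.flowArcs k⟩

/-- The arcs of the network that tests the cut condition for the orientation given by a flow `φ`. -/
def cutArcs (E : EdgeData) (k : ℕ) (φ : ℕ → ℕ) : List Arc :=
  ((List.range E.m).flatMap fun i => [⟨E.a i, E.b i, φ (3 * i + 2)⟩,
    ⟨E.b i, E.a i, φ (3 * i + 1)⟩]) ++
  (List.range E.p).flatMap fun j => [⟨0, j + 1, k - φ (3 * E.m + j)⟩, ⟨j + 1, 0, k⟩]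

/-- The network of `EdgeData.cutArcs`, whose vertices are the root `0` and those of the graph. If
`φ` saturates the source of the flow network, then the in-cuts of the sets `S` of vertices of the
graph have value `k * #S - weightIn S`, and those of the sets that contain the root have value at
least `k` because of the arcs to the root. -/
def cutNet (E : EdgeData) (k : ℕ) (φ : ℕ → ℕ) : Net := ⟨E.p + 1, E.cutArcs k φ⟩

/-! ### Sums over arcs -/

/-- The sum of `Ψ a (φ i)` over the arcs `a` of a list, where `i` is the position of `a`, counted
from `o` on. -/
def arcSum (Ψ : Arc → ℕ → ℕ) (φ : ℕ → ℕ) : List Arc → ℕ → ℕ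
  | [], _ => 0
  | a :: l, o => Ψ a (φ o) + arcSum Ψ φ l (o + 1)

lemma sum_get_eq (Ψ : Arc → ℕ → ℕ) (φ : ℕ → ℕ) (l : List Arc) (o : ℕ) :
    ∑ i : Fin l.length, Ψ (l.get i) (φ (o + i)) = arcSum Ψ φ l o := by
  induction l generalizing o with
  | nil => rfl
  | cons a l ih =>
    rw [arcSum, ← ih]
    simp only [List.length_cons]
    rw [Fin.sum_univ_succ]
    simp [Nat.add_assoc, Nat.add_comm 1]

lemma arcSum_append (Ψ : Arc → ℕ → ℕ) (φ : ℕ → ℕ) (l l' : List Arc) (o : ℕ) :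
    arcSum Ψ φ (l ++ l') o = arcSum Ψ φ l o + arcSum Ψ φ l' (o + l.length) := by
  induction l generalizing o with
  | nil => simp [arcSum]
  | cons a l ih => simp [arcSum, ih, Nat.add_assoc, Nat.add_comm 1]

lemma length_flatMap_range {α : Type*} (A : ℕ → List α) (d : ℕ) (h : ∀ i, (A i).length = d)
    (m : ℕ) : ((List.range m).flatMap A).length = d * m := by
  induction m with
  | zero => simp
  | succ m ih => simp [List.range_succ, List.flatMap_append, ih, h, Nat.mul_succ]

lemma arcSum_flatMap (Ψ : Arc → ℕ → ℕ) (φ : ℕ → ℕ) (A : ℕ → List Arc) (d : ℕ)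
    (h : ∀ i, (A i).length = d) (m o : ℕ) : arcSum Ψ φ ((List.range m).flatMap A) o =
      ∑ i ∈ range m, arcSum Ψ φ (A i) (o + d * i) := by
  induction m with
  | zero => simp [arcSum]
  | succ m ih =>
    simp [List.range_succ, List.flatMap_append, arcSum_append, sum_range_succ, ih,
      length_flatMap_range A d h]

lemma length_flowArcs (E : EdgeData) (k : ℕ) : (E.flowArcs k).length = 3 * E.m + E.p := by
  rw [flowArcs, List.length_append, length_flatMap_range _ 3 (fun _ => rfl)]; simp

lemma length_cutArcs (E : EdgeData) (k : ℕ) (φ : ℕ → ℕ) :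
    (E.cutArcs k φ).length = 2 * E.m + 2 * E.p := by
  rw [cutArcs, List.length_append, length_flatMap_range _ 2 (fun _ => rfl),
    length_flatMap_range _ 2 (fun _ => rfl)]

lemma sum_flowArcs (E : EdgeData) (k : ℕ) (Ψ : Arc → ℕ → ℕ) (φ : ℕ → ℕ) :
    ∑ i : Fin (E.flowArcs k).length, Ψ ((E.flowArcs k).get i) (φ i) =
      ∑ i ∈ range E.m, (Ψ ⟨3 * E.m + 1, 2 * E.m + 1 + i, E.c i⟩ (φ (3 * i)) +
        Ψ ⟨2 * E.m + 1 + i, E.a i, E.c i⟩ (φ (3 * i + 1)) +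
        Ψ ⟨2 * E.m + 1 + i, E.b i, E.c i⟩ (φ (3 * i + 2))) +
      ∑ j ∈ range E.p, Ψ ⟨j + 1, 0, k⟩ (φ (3 * E.m + j)) := by
  have := sum_get_eq Ψ φ (E.flowArcs k) 0
  simp only [Nat.zero_add] at this
  rw [this, flowArcs, arcSum_append, arcSum_flatMap _ _ _ 3 (fun _ => rfl),
    List.map_eq_flatMap, arcSum_flatMap _ _ _ 1 (fun _ => rfl),
    length_flatMap_range _ 3 (fun _ => rfl)]
  simp [arcSum, Nat.add_assoc]

lemma inCut_cutNet (E : EdgeData) (k : ℕ) (φ : ℕ → ℕ) (S : Finset ℕ) :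
    (E.cutNet k φ).inCut S =
      ∑ i ∈ range E.m, ((if E.a i ∉ S ∧ E.b i ∈ S then φ (3 * i + 2) else 0) +
        if E.b i ∉ S ∧ E.a i ∈ S then φ (3 * i + 1) else 0) +
      ∑ j ∈ range E.p, ((if 0 ∉ S ∧ j + 1 ∈ S then k - φ (3 * E.m + j) else 0) +
        if j + 1 ∉ S ∧ 0 ∈ S then k else 0) := by
  have key : ∀ l : List Arc, ∀ o,
      (l.map fun a => if a.tail ∉ S ∧ a.head ∈ S then a.cap else 0).sum =
      arcSum (fun a _ => if a.tail ∉ S ∧ a.head ∈ S then a.cap else 0) φ l o := by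
    intro l
    induction l with
    | nil => intro o; rfl
    | cons a l ih => intro o; rw [List.map_cons, List.sum_cons, arcSum, ih (o + 1)]
  rw [Net.inCut, cutNet, key _ 0, cutArcs, arcSum_append, arcSum_flatMap _ _ _ 2 (fun _ => rfl),
    arcSum_flatMap _ _ _ 2 (fun _ => rfl)]
  simp [arcSum]

/-! ### Orientations and flows -/

/-- Hall's theorem: in a sparse graph the weight of each edge can be divided between its ends such
that no vertex gets more than `k`. -/
lemma Sparse.exists_orientation {E : EdgeData} (hE : E.Proper) {k : ℕ} (h : E.Sparse k) :
    ∃ x y : ℕ → ℕ, (∀ i < E.m, x i + y i = E.c i) ∧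
      ∀ v, ∑ i ∈ range E.m,
        ((if E.a i = v then x i else 0) + if E.b i = v then y i else 0) ≤ k := by
  classical
  -- one item for each unit of weight, and `k` places at each vertex
  let ι := Σ i : Fin E.m, Fin (E.c i)
  let t : ι → Finset (ℕ × Fin k) := fun e => ({E.a e.1, E.b e.1} : Finset ℕ) ×ˢ univ
  have hall : ∀ A : Finset ι, #A ≤ #(A.biUnion t) := by
    intro A
    rcases A.eq_empty_or_nonempty with rfl | ⟨e₀, he₀⟩
    · simp
    let S : Finset ℕ := A.biUnion fun e => {E.a e.1, E.b e.1}
    have hS : A.biUnion t = S ×ˢ univ := by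
      ext ⟨v, q⟩
      simp [t, S]
    have h1 : S ⊆ Icc 1 E.p := by
      intro v hv
      simp only [S, mem_biUnion, mem_insert, mem_singleton] at hv
      obtain ⟨e, -, rfl | rfl⟩ := hv
      · exact mem_Icc.2 ⟨hE.a_pos _ e.1.2, hE.a_le _ e.1.2⟩
      · exact mem_Icc.2 ⟨hE.b_pos _ e.1.2, hE.b_le _ e.1.2⟩
    have h2 := h S h1 ⟨E.a e₀.1, mem_biUnion.2 ⟨e₀, he₀, by simp⟩⟩
    have h3 : #A ≤ E.weightIn S := by
      have : A ⊆ (univ.filter fun i : Fin E.m => E.a i ∈ S ∧ E.b i ∈ S).sigma fun _ => univ := by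
        intro e he
        exact mem_sigma.2 ⟨mem_filter.2 ⟨mem_univ _, mem_biUnion.2 ⟨e, he, by simp⟩,
          mem_biUnion.2 ⟨e, he, by simp⟩⟩, mem_univ _⟩
      refine (card_le_card this).trans ?_
      rw [card_sigma, weightIn, Finset.sum_range, sum_filter]
      simp
    rw [hS, card_product, card_univ, Fintype.card_fin]
    rw [mul_comm] at h2
    omega
  obtain ⟨f, hf, hft⟩ := (all_card_le_biUnion_card_iff_exists_injective t).1 hall
  have hends : ∀ e : ι, (f e).1 = E.a e.1 ∨ (f e).1 = E.b e.1 := by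
    intro e
    have := hft e
    simp only [t, mem_product, mem_insert, mem_singleton, mem_univ, and_true] at this
    exact this
  let cnt : ℕ → ℕ → ℕ := fun i v =>
    if h : i < E.m then #(univ.filter fun q : Fin (E.c i) => (f ⟨⟨i, h⟩, q⟩).1 = v) else 0
  refine ⟨fun i => cnt i (E.a i), fun i => cnt i (E.b i), ?_, ?_⟩
  · intro i hi
    simp only [cnt, dif_pos hi]
    rw [← card_union_of_disjoint, ← filter_or, filter_true_of_mem, card_univ, Fintype.card_fin]
    · exact fun q _ => hends ⟨⟨i, hi⟩, q⟩
    · rw [disjoint_filter]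
      exact fun q _ h1 h2 => hE.ne i hi (h1.symm.trans h2)
  · intro v
    calc ∑ i ∈ range E.m, ((if E.a i = v then cnt i (E.a i) else 0) +
          if E.b i = v then cnt i (E.b i) else 0) ≤ ∑ i ∈ range E.m, cnt i v := by
          refine sum_le_sum fun i hi => ?_
          have := hE.ne i (mem_range.1 hi)
          split_ifs with h1 h2 h2
          · exact (this (h1.trans h2.symm)).elim
          · rw [h1]; rfl
          · rw [h2]; simp
          · simp
      _ = #(univ.filter fun e : ι => (f e).1 = v) := by
          have : (univ.filter fun e : ι => (f e).1 = v) = (univ : Finset (Fin E.m)).sigma fun i =>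
              univ.filter fun q => (f ⟨i, q⟩).1 = v := by
            ext ⟨i, q⟩
            exact ⟨fun h => mem_sigma.2 ⟨mem_univ _, mem_filter.2 ⟨mem_univ _, (mem_filter.1 h).2⟩⟩,
              fun h => mem_filter.2 ⟨mem_univ _, (mem_filter.1 (mem_sigma.1 h).2).2⟩⟩
          rw [this, card_sigma, Finset.sum_range]
          refine sum_congr rfl fun i _ => ?_
          simp only [cnt, dif_pos i.2]
      _ ≤ #(({v} : Finset ℕ) ×ˢ (univ : Finset (Fin k))) := by
          refine card_le_card_of_injOn f ?_ hf.injOn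
          intro e he
          simp only [coe_filter, mem_univ, true_and, Set.mem_ofPred_eq] at he
          exact mem_coe.2 (mem_product.2 ⟨mem_singleton.2 he, mem_univ _⟩)
      _ = k := by simp

lemma outFlow_flowNet (E : EdgeData) (k : ℕ) (f : Fin (E.flowArcs k).length → ℕ) (φ : ℕ → ℕ)
    (hφ : ∀ i : Fin (E.flowArcs k).length, φ i = f i) (v : ℕ) : (E.flowNet k).outFlow f v =
      ∑ i ∈ range E.m, ((if 3 * E.m + 1 = v then φ (3 * i) else 0) +
        (if 2 * E.m + 1 + i = v then φ (3 * i + 1) else 0) +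
        (if 2 * E.m + 1 + i = v then φ (3 * i + 2) else 0)) +
      ∑ j ∈ range E.p, if j + 1 = v then φ (3 * E.m + j) else 0 := by
  rw [← sum_flowArcs E k (fun a x => if a.tail = v then x else 0)]
  simp only [hφ]
  rfl

lemma inFlow_flowNet (E : EdgeData) (k : ℕ) (f : Fin (E.flowArcs k).length → ℕ) (φ : ℕ → ℕ)
    (hφ : ∀ i : Fin (E.flowArcs k).length, φ i = f i) (v : ℕ) : (E.flowNet k).inFlow f v =
      ∑ i ∈ range E.m, ((if 2 * E.m + 1 + i = v then φ (3 * i) else 0) +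
        (if E.a i = v then φ (3 * i + 1) else 0) + (if E.b i = v then φ (3 * i + 2) else 0)) +
      ∑ j ∈ range E.p, if 0 = v then φ (3 * E.m + j) else 0 := by
  rw [← sum_flowArcs E k (fun a x => if a.head = v then x else 0)]
  simp only [hφ]
  rfl

lemma le_cap_flowArcs_iff (E : EdgeData) (k : ℕ) (φ : ℕ → ℕ) :
    (∀ i : Fin (E.flowArcs k).length, φ i ≤ ((E.flowArcs k).get i).cap) ↔
      (∀ i < E.m, φ (3 * i) ≤ E.c i ∧ φ (3 * i + 1) ≤ E.c i ∧ φ (3 * i + 2) ≤ E.c i) ∧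
      ∀ j < E.p, φ (3 * E.m + j) ≤ k := by
  -- both sides say that the total excess is zero
  have := E.sum_flowArcs k (fun a x => x - a.cap) φ
  have h1 : (∀ i : Fin (E.flowArcs k).length, φ i ≤ ((E.flowArcs k).get i).cap) ↔
      ∑ i : Fin (E.flowArcs k).length, (φ i - ((E.flowArcs k).get i).cap) = 0 := by
    simp [sum_eq_zero_iff, Nat.sub_eq_zero_iff_le]
  rw [h1, this]
  simp [sum_eq_zero_iff, Nat.sub_eq_zero_iff_le, and_assoc]

lemma isFlow_flowNet_iff {E : EdgeData} (hE : E.Proper) (k : ℕ)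
    (f : Fin (E.flowArcs k).length → ℕ) (φ : ℕ → ℕ)
    (hφ : ∀ i : Fin (E.flowArcs k).length, φ i = f i) :
    (E.flowNet k).IsFlow (3 * E.m + 1) 0 f ↔
      ((∀ i < E.m, φ (3 * i) ≤ E.c i ∧ φ (3 * i + 1) ≤ E.c i ∧ φ (3 * i + 2) ≤ E.c i) ∧
        ∀ j < E.p, φ (3 * E.m + j) ≤ k) ∧
      (∀ i < E.m, φ (3 * i) = φ (3 * i + 1) + φ (3 * i + 2)) ∧
      ∀ v, 1 ≤ v → v ≤ 2 * E.m → (∑ i ∈ range E.m, ((if E.a i = v then φ (3 * i + 1) else 0) +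
        if E.b i = v then φ (3 * i + 2) else 0)) =
          ∑ j ∈ range E.p, if j + 1 = v then φ (3 * E.m + j) else 0 := by
  rw [← le_cap_flowArcs_iff]
  change ((∀ i, f i ≤ ((E.flowNet k).arcs.get i).cap) ∧ ∀ v < (E.flowNet k).numV, v ≠ 3 * E.m + 1 →
    v ≠ 0 → (E.flowNet k).inFlow f v = (E.flowNet k).outFlow f v) ↔ _
  have hcap : (∀ i, f i ≤ ((E.flowNet k).arcs.get i).cap) ↔
      ∀ i : Fin (E.flowArcs k).length, φ i ≤ ((E.flowArcs k).get i).cap := by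
    simp only [hφ]; rfl
  rw [hcap]
  refine and_congr_right fun _ => ?_
  -- conservation at the node of an edge
  have hedge : ∀ i < E.m, ((E.flowNet k).inFlow f (2 * E.m + 1 + i) =
      (E.flowNet k).outFlow f (2 * E.m + 1 + i) ↔
        φ (3 * i) = φ (3 * i + 1) + φ (3 * i + 2)) := by
    intro i hi
    rw [E.inFlow_flowNet k f φ hφ, E.outFlow_flowNet k f φ hφ]
    rw [sum_eq_single (s := range E.m) i, sum_eq_single (s := range E.m) i]
    · have h1 := hE.a_le i hi
      have h2 := hE.b_le i hi
      have h3 := hE.p_le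
      rw [if_pos rfl, if_neg (by omega), if_neg (by omega), if_neg (by omega), if_pos rfl,
        if_pos rfl, sum_eq_zero, sum_eq_zero]
      · omega
      · intro j hj
        rw [mem_range] at hj
        rw [if_neg (by omega)]
      · intro j hj
        rw [if_neg (by omega)]
    · intro j hj hne
      rw [mem_range] at hj
      rw [if_neg (by omega), if_neg (by omega), if_neg (by omega), add_zero, add_zero]
    · intro h; exact absurd (mem_range.2 hi) h
    · intro j hj hne
      rw [mem_range] at hj
      have h1 := hE.a_le j hj
      have h2 := hE.b_le j hj
      have h3 := hE.p_le
      rw [if_neg (by omega), if_neg (by omega), if_neg (by omega), add_zero, add_zero]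
    · intro h; exact absurd (mem_range.2 hi) h
  -- conservation at a vertex of the graph
  have hvert : ∀ v, 1 ≤ v → v ≤ 2 * E.m → ((E.flowNet k).inFlow f v = (E.flowNet k).outFlow f v ↔
      (∑ i ∈ range E.m, ((if E.a i = v then φ (3 * i + 1) else 0) +
        if E.b i = v then φ (3 * i + 2) else 0)) =
          ∑ j ∈ range E.p, if j + 1 = v then φ (3 * E.m + j) else 0) := by
    intro v h1 h2
    rw [E.inFlow_flowNet k f φ hφ, E.outFlow_flowNet k f φ hφ]
    have e1 : ∀ i ∈ range E.m, ((if 2 * E.m + 1 + i = v then φ (3 * i) else 0) +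
        (if E.a i = v then φ (3 * i + 1) else 0) + (if E.b i = v then φ (3 * i + 2) else 0)) =
        (if E.a i = v then φ (3 * i + 1) else 0) + if E.b i = v then φ (3 * i + 2) else 0 := by
      intro i hi
      rw [if_neg (by omega), zero_add]
    have e2 : ∀ i ∈ range E.m, ((if 3 * E.m + 1 = v then φ (3 * i) else 0) +
        (if 2 * E.m + 1 + i = v then φ (3 * i + 1) else 0) +
        (if 2 * E.m + 1 + i = v then φ (3 * i + 2) else 0)) = 0 := by
      intro i hi
      rw [if_neg (by omega), if_neg (by omega), if_neg (by omega)]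
    have e3 : ∀ j ∈ range E.p, (if 0 = v then φ (3 * E.m + j) else 0) = 0 := by
      intro j hj
      rw [if_neg (by omega)]
    rw [sum_congr rfl e1, sum_eq_zero e2, sum_eq_zero e3, add_zero, zero_add]
  constructor
  · intro h
    refine ⟨fun i hi => (hedge i hi).1 (h _ ?_ ?_ ?_), fun v h1 h2 => (hvert v h1 h2).1
      (h _ ?_ ?_ ?_)⟩
    all_goals first | omega | (simp only [flowNet]; omega)
  · rintro ⟨h1, h2⟩ v hv hs ht
    simp only [flowNet] at hv
    rcases Nat.lt_or_ge v (2 * E.m + 1) with h | h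
    · exact (hvert v (by omega) (by omega)).2 (h2 v (by omega) (by omega))
    · obtain ⟨i, rfl⟩ := Nat.exists_eq_add_of_le h
      exact (hedge i (by omega)).2 (h1 i (by omega))

lemma flowValue_flowNet {E : EdgeData} (hE : E.Proper) (k : ℕ)
    (f : Fin (E.flowArcs k).length → ℕ) (φ : ℕ → ℕ)
    (hφ : ∀ i : Fin (E.flowArcs k).length, φ i = f i) :
    (E.flowNet k).flowValue (3 * E.m + 1) f = ∑ i ∈ range E.m, φ (3 * i) := by
  have h3 := hE.p_le
  have e1 : (E.flowNet k).outFlow f (3 * E.m + 1) = ∑ i ∈ range E.m, φ (3 * i) := by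
    rw [E.outFlow_flowNet k f φ hφ, sum_eq_zero (s := range E.p), add_zero]
    · refine sum_congr rfl fun i hi => ?_
      rw [mem_range] at hi
      rw [if_pos rfl, if_neg (by omega), if_neg (by omega), add_zero, add_zero]
    · intro j hj
      rw [mem_range] at hj
      rw [if_neg (by omega)]
  have e2 : (E.flowNet k).inFlow f (3 * E.m + 1) = 0 := by
    rw [E.inFlow_flowNet k f φ hφ, sum_eq_zero (s := range E.m), sum_eq_zero (s := range E.p),
      add_zero]
    · intro j hj
      rw [if_neg (by omega)]
    · intro i hi
      rw [mem_range] at hi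
      have h1 := hE.a_le i hi
      have h2 := hE.b_le i hi
      rw [if_neg (by omega), if_neg (by omega), if_neg (by omega), add_zero, add_zero]
  change (((E.flowNet k).outFlow f (3 * E.m + 1) : ℕ) : ℤ) -
    (E.flowNet k).inFlow f (3 * E.m + 1) = _
  rw [e1, e2]
  simp

/-- In a sparse graph, every maximum flow saturates the arcs that leave the source. -/
lemma Sparse.saturated {E : EdgeData} (hE : E.Proper) {k : ℕ} (h : E.Sparse k)
    (f : Fin (E.flowArcs k).length → ℕ) (φ : ℕ → ℕ)
    (hφ : ∀ i : Fin (E.flowArcs k).length, φ i = f i)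
    (hf : FlowInstance.IsMaxFlow ⟨E.flowNet k, 3 * E.m + 1, 0⟩ f) {i : ℕ} (hi : i < E.m) :
    E.c i ≤ φ (3 * i) := by
  obtain ⟨x, y, hxy, hload⟩ := h.exists_orientation hE
  let load : ℕ → ℕ := fun v =>
    ∑ i ∈ range E.m, ((if E.a i = v then x i else 0) + if E.b i = v then y i else 0)
  -- the flow given by the orientation
  let γ : ℕ → ℕ := fun t =>
    if t < 3 * E.m then
      if t % 3 = 0 then E.c (t / 3) else if t % 3 = 1 then x (t / 3) else y (t / 3)
    else load (t - 3 * E.m + 1)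
  have γ0 : ∀ i < E.m, γ (3 * i) = E.c i := fun i hi => by
    simp only [γ]
    rw [if_pos (by omega), if_pos (by omega), show 3 * i / 3 = i by omega]
  have γ1 : ∀ i < E.m, γ (3 * i + 1) = x i := fun i hi => by
    simp only [γ]
    rw [if_pos (by omega), if_neg (by omega), if_pos (by omega),
      show (3 * i + 1) / 3 = i by omega]
  have γ2 : ∀ i < E.m, γ (3 * i + 2) = y i := fun i hi => by
    simp only [γ]
    rw [if_pos (by omega), if_neg (by omega), if_neg (by omega),
      show (3 * i + 2) / 3 = i by omega]
  have γ3 : ∀ j, γ (3 * E.m + j) = load (j + 1) := fun j => by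
    simp only [γ]
    rw [if_neg (by omega), show 3 * E.m + j - 3 * E.m + 1 = j + 1 by omega]
  have hγ : (E.flowNet k).IsFlow (3 * E.m + 1) 0 fun i => γ i := by
    refine (isFlow_flowNet_iff hE k _ γ fun _ => rfl).2 ⟨⟨fun i hi => ?_, fun j hj => ?_⟩,
      fun i hi => ?_, fun v h1 h2 => ?_⟩
    · rw [γ0 i hi, γ1 i hi, γ2 i hi]
      have := hxy i hi
      omega
    · rw [γ3]; exact hload _
    · rw [γ0 i hi, γ1 i hi, γ2 i hi, hxy i hi]
    · have e1 : ∀ i ∈ range E.m, ((if E.a i = v then γ (3 * i + 1) else 0) +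
          if E.b i = v then γ (3 * i + 2) else 0) =
          (if E.a i = v then x i else 0) + if E.b i = v then y i else 0 := by
        intro i hi
        rw [γ1 i (mem_range.1 hi), γ2 i (mem_range.1 hi)]
      rw [sum_congr rfl e1]
      simp only [γ3]
      rcases Nat.lt_or_ge E.p v with h3 | h3
      · rw [sum_eq_zero, sum_eq_zero]
        · intro j hj
          rw [mem_range] at hj
          rw [if_neg (by omega)]
        · intro i hi
          rw [mem_range] at hi
          have h1 := hE.a_le i hi
          have h2 := hE.b_le i hi
          rw [if_neg (by omega), if_neg (by omega), add_zero]
      · rw [sum_eq_single (s := range E.p) (v - 1)]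
        · rw [if_pos (by omega), show v - 1 + 1 = v by omega]
        · intro j _ hj
          rw [if_neg (by omega)]
        · intro h
          rw [mem_range] at h
          omega
  have hval := hf.2 _ hγ
  simp only at hval
  rw [flowValue_flowNet hE k f φ hφ] at hval
  have hγval := flowValue_flowNet hE k (fun i => γ i) γ fun _ => rfl
  rw [sum_congr rfl fun i hi => γ0 i (mem_range.1 hi)] at hγval
  replace hval := hγval.symm.le.trans hval
  have hle := ((isFlow_flowNet_iff hE k f φ hφ).1 hf.1).1.1
  by_contra hlt
  have : ∑ i ∈ range E.m, φ (3 * i) < ∑ i ∈ range E.m, E.c i :=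
    sum_lt_sum (fun i hi => (hle i (mem_range.1 hi)).1) ⟨i, mem_range.2 hi, by omega⟩
  exact absurd (by exact_mod_cast hval) (not_le.2 this)

/-- For a flow that saturates the source, the in-cuts of the cut network measure how far the
corresponding sets of vertices are from violating sparsity. -/
lemma inCut_add_weightIn {E : EdgeData} (hE : E.Proper) {k : ℕ}
    (f : Fin (E.flowArcs k).length → ℕ) (φ : ℕ → ℕ)
    (hφ : ∀ i : Fin (E.flowArcs k).length, φ i = f i)
    (hf : (E.flowNet k).IsFlow (3 * E.m + 1) 0 f) (hsat : ∀ i < E.m, E.c i ≤ φ (3 * i))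
    {S : Finset ℕ} (hS : S ⊆ Icc 1 E.p) : (E.cutNet k φ).inCut S + E.weightIn S = k * #S := by
  obtain ⟨⟨h1, h2⟩, h3, h4⟩ := (isFlow_flowNet_iff hE k f φ hφ).1 hf
  have h0 : 0 ∉ S := fun h => by have := mem_Icc.1 (hS h); omega
  have hload : ∀ j < E.p, φ (3 * E.m + j) =
      ∑ i ∈ range E.m, ((if E.a i = j + 1 then φ (3 * i + 1) else 0) +
        if E.b i = j + 1 then φ (3 * i + 2) else 0) := by
    intro j hj
    have := hE.p_le
    rw [h4 (j + 1) (by omega) (by omega)]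
    simp [hj]
  have hsum : ∀ g : ℕ → ℕ, ∑ j ∈ range E.p, (if j + 1 ∈ S then g (j + 1) else 0) =
      ∑ v ∈ S, g v := by
    intro g
    rw [← sum_filter]
    refine sum_bij (fun j _ => j + 1) ?_ ?_ ?_ ?_
    · intro j hj; exact (mem_filter.1 hj).2
    · intro j _ j' _ h; omega
    · intro v hv
      have := mem_Icc.1 (hS hv)
      exact ⟨v - 1, mem_filter.2 ⟨mem_range.2 (by omega), by
        rwa [show v - 1 + 1 = v by omega]⟩, by omega⟩
    · intro j _; rfl
  have hA : ∑ j ∈ range E.p, (if j + 1 ∈ S then k - φ (3 * E.m + j) else 0) +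
      ∑ i ∈ range E.m, ((if E.a i ∈ S then φ (3 * i + 1) else 0) +
        if E.b i ∈ S then φ (3 * i + 2) else 0) = k * #S := by
    have e1 : ∑ i ∈ range E.m, ((if E.a i ∈ S then φ (3 * i + 1) else 0) +
        if E.b i ∈ S then φ (3 * i + 2) else 0) =
        ∑ j ∈ range E.p, if j + 1 ∈ S then φ (3 * E.m + j) else 0 := by
      rw [sum_congr (s₁ := range E.p) rfl fun j hj => by rw [hload j (mem_range.1 hj)],
        hsum fun v => ∑ i ∈ range E.m, ((if E.a i = v then φ (3 * i + 1) else 0) +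
          if E.b i = v then φ (3 * i + 2) else 0), sum_comm]
      refine sum_congr rfl fun i _ => ?_
      rw [sum_add_distrib, sum_ite_eq, sum_ite_eq]
    rw [e1, ← sum_add_distrib]
    calc _ = ∑ j ∈ range E.p, (if j + 1 ∈ S then k else 0) := by
          refine sum_congr rfl fun j hj => ?_
          have := h2 j (mem_range.1 hj)
          split_ifs
          · omega
          · rfl
      _ = k * #S := by rw [hsum fun _ => k, sum_const, smul_eq_mul, mul_comm]
  rw [inCut_cutNet, ← hA, weightIn]
  have hB : ∑ j ∈ range E.p, ((if 0 ∉ S ∧ j + 1 ∈ S then k - φ (3 * E.m + j) else 0) +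
      if j + 1 ∉ S ∧ 0 ∈ S then k else 0) =
      ∑ j ∈ range E.p, if j + 1 ∈ S then k - φ (3 * E.m + j) else 0 :=
    sum_congr rfl fun j _ => by simp [h0]
  rw [hB, add_right_comm, ← sum_add_distrib, add_comm]
  congr 1
  refine sum_congr rfl fun i hi => ?_
  have e1 := hsat i (mem_range.1 hi)
  have e2 := (h1 i (mem_range.1 hi)).1
  have e3 := h3 i (mem_range.1 hi)
  by_cases ha : E.a i ∈ S <;> by_cases hb : E.b i ∈ S <;> simp [ha, hb]
  omega

/-- Correctness of the test: with a maximum flow and a minimum cut, the flow saturates the source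
and the cut has value at least `k` if and only if the graph is sparse. -/
theorem sparse_iff {E : EdgeData} (hE : E.Proper) {k : ℕ}
    (f : Fin (E.flowArcs k).length → ℕ) (φ : ℕ → ℕ)
    (hφ : ∀ i : Fin (E.flowArcs k).length, φ i = f i)
    (hf : FlowInstance.IsMaxFlow ⟨E.flowNet k, 3 * E.m + 1, 0⟩ f) {S : Finset ℕ}
    (hS : (E.cutNet k φ).IsMinCut S) :
    ((∀ i < E.m, E.c i ≤ φ (3 * i)) ∧ k ≤ (E.cutNet k φ).inCut S) ↔ E.Sparse k := by
  constructor
  · rintro ⟨hsat, hk⟩ S' hS' hne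
    have h1 := inCut_add_weightIn hE f φ hφ hf.1 hsat hS'
    have h2 := hS.2 S' ⟨hne, by
      rw [Finset.ssubset_iff_of_subset]
      · exact ⟨0, by simp [cutNet], fun h => by have := mem_Icc.1 (hS' h); omega⟩
      · intro v hv
        have := mem_Icc.1 (hS' hv)
        exact mem_range.2 (by simp only [cutNet]; omega)⟩
    omega
  · intro h
    have hsat : ∀ i < E.m, E.c i ≤ φ (3 * i) := fun i hi => h.saturated hE f φ hφ hf hi
    refine ⟨hsat, ?_⟩
    obtain ⟨⟨hne, hss⟩, -⟩ := hS
    by_cases h0 : 0 ∈ S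
    · -- some vertex is not in `S`, and its arc to the root is cut
      obtain ⟨v, hv, hvS⟩ := Finset.exists_of_ssubset hss
      have hv0 : v ≠ 0 := fun h => hvS (h ▸ h0)
      have hvp : v < E.p + 1 := mem_range.1 hv
      rw [inCut_cutNet]
      refine le_trans ?_ (Nat.le_add_left _ _)
      refine le_trans ?_ (single_le_sum (fun _ _ => Nat.zero_le _)
        (mem_range.2 (show v - 1 < E.p by omega)))
      rw [show v - 1 + 1 = v by omega]
      simp [h0, hvS]
    · have hsub : S ⊆ Icc 1 E.p := by
        intro v hv
        have h1 : v < E.p + 1 := mem_range.1 (hss.1 hv)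
        have h2 : v ≠ 0 := fun h => h0 (h ▸ hv)
        exact mem_Icc.2 ⟨by omega, by omega⟩
      have h1 := inCut_add_weightIn hE f φ hφ hf.1 hsat hsub
      have h2 := h S hsub hne
      omega

end EdgeData

namespace EdgeData

open Finset

/-! ### The networks are proper instances of bounded size -/

lemma admissible_flowNet {E : EdgeData} (hE : E.Proper) {k B K : ℕ} (hm : 1 ≤ E.m) (hK : 5 ≤ K)
    (hc : ∀ i < E.m, E.c i ≤ B) (hk : k ≤ B) :
    FlowInstance.Admissible ⟨E.flowNet k, 3 * E.m + 1, 0⟩ (K * E.m) (K * E.m) B := by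
  have hp := hE.p_le
  have hKm : 5 * E.m ≤ K * E.m := Nat.mul_le_mul_right _ hK
  refine ⟨⟨?_, ?_⟩, by simp [flowNet], by simp [flowNet], by simp, ?_, ?_, ?_⟩
  · intro a ha
    simp only [flowNet, flowArcs, List.mem_append, List.mem_flatMap, List.mem_range, List.mem_map,
      List.mem_cons, List.not_mem_nil, or_false] at ha ⊢
    rcases ha with ⟨i, hi, h⟩ | ⟨j, hj, rfl⟩
    · have h1 := hE.a_le i hi
      have h2 := hE.b_le i hi
      rcases h with rfl | rfl | rfl <;> refine ⟨?_, ?_, ?_⟩ <;> dsimp only <;> omega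
    · refine ⟨?_, ?_, ?_⟩ <;> dsimp only <;> omega
  · simp only [flowNet, flowArcs, List.map_append, List.map_flatMap, List.map_map, List.map_cons,
      List.map_nil]
    rw [List.nodup_append]
    refine ⟨List.nodup_flatMap.2 ⟨?_, ?_⟩, ?_, ?_⟩
    · intro i hi
      have h1 := hE.a_le i (List.mem_range.1 hi)
      have h2 := hE.b_le i (List.mem_range.1 hi)
      have h3 := hE.ne i (List.mem_range.1 hi)
      simp only [List.nodup_cons, List.mem_cons, Prod.mk.injEq, List.not_mem_nil, or_false,
        List.nodup_nil, and_true, not_false_eq_true]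
      omega
    · refine List.nodup_range.pairwise_of_forall_ne fun i hi j hj hij => ?_
      rw [List.mem_range] at hi hj
      have h1 := hE.a_le i hi
      have h2 := hE.b_le i hi
      have h3 := hE.a_le j hj
      have h4 := hE.b_le j hj
      simp only [Function.onFun, List.disjoint_left, List.mem_cons, List.not_mem_nil, or_false]
      rintro ⟨x, y⟩ hx hy
      simp only [Prod.mk.injEq] at hx hy
      omega
    · exact List.nodup_range.map fun i j h => by simpa using h
    · intro x hx y hy
      obtain ⟨x1, x2⟩ := x
      obtain ⟨y1, y2⟩ := y
      simp only [List.mem_flatMap, List.mem_range, List.mem_map, Function.comp, List.mem_cons,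
        Prod.mk.injEq, List.not_mem_nil, or_false] at hx hy
      obtain ⟨i, hi, hx⟩ := hx
      obtain ⟨j, hj, hy⟩ := hy
      have h1 := hE.a_pos i hi
      have h2 := hE.b_pos i hi
      simp only [ne_eq, Prod.mk.injEq]
      omega
  · simp only [flowNet]; omega
  · simp only [flowNet]; rw [length_flowArcs]; omega
  · intro a ha
    simp only [flowNet, flowArcs, List.mem_append, List.mem_flatMap, List.mem_range, List.mem_map,
      List.mem_cons, List.not_mem_nil, or_false] at ha
    rcases ha with ⟨i, hi, h⟩ | ⟨j, hj, rfl⟩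
    · rcases h with rfl | rfl | rfl <;> exact hc i hi
    · exact hk

lemma admissible_cutNet {E : EdgeData} (hE : E.Proper) {k B K n : ℕ} {φ : ℕ → ℕ} (hK : 6 ≤ K)
    (hn : E.p ≤ n) (hφ : ∀ i < 3 * E.m, φ i ≤ B) (hk : k ≤ B) :
    (E.cutNet k φ).Admissible (K * n) (K * E.m) B := by
  have hp := hE.p_le
  have hp' := hE.p_pos
  have hKm : 6 * E.m ≤ K * E.m := Nat.mul_le_mul_right _ hK
  have hKn : 6 * n ≤ K * n := Nat.mul_le_mul_right _ hK
  refine ⟨⟨?_, ?_⟩, by simp only [cutNet]; omega, ?_, ?_, ?_⟩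
  · intro a ha
    simp only [cutNet, cutArcs, List.mem_append, List.mem_flatMap, List.mem_range,
      List.mem_cons, List.not_mem_nil, or_false] at ha ⊢
    rcases ha with ⟨i, hi, h⟩ | ⟨j, hj, h⟩
    · have h1 := hE.a_le i hi
      have h2 := hE.b_le i hi
      have h3 := hE.ne i hi
      rcases h with rfl | rfl <;> refine ⟨?_, ?_, ?_⟩ <;> dsimp only <;> omega
    · rcases h with rfl | rfl <;> refine ⟨?_, ?_, ?_⟩ <;> dsimp only <;> omega
  · simp only [cutNet, cutArcs, List.map_append, List.map_flatMap, List.map_cons, List.map_nil]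
    rw [List.nodup_append]
    refine ⟨List.nodup_flatMap.2 ⟨?_, ?_⟩, List.nodup_flatMap.2 ⟨?_, ?_⟩, ?_⟩
    · intro i hi
      have h3 := hE.ne i (List.mem_range.1 hi)
      simp only [List.nodup_cons, List.mem_cons, Prod.mk.injEq, List.not_mem_nil, or_false,
        List.nodup_nil, and_true, not_false_eq_true]
      omega
    · refine List.nodup_range.pairwise_of_forall_ne fun i hi j hj hij => ?_
      rw [List.mem_range] at hi hj
      have h1 := hE.inj i hi j hj
      have h2 := hE.inj' i hi j hj
      simp only [Function.onFun, List.disjoint_left, List.mem_cons, List.not_mem_nil, or_false]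
      rintro ⟨x, y⟩ hx hy
      simp only [Prod.mk.injEq] at hx hy
      rcases hx with ⟨rfl, rfl⟩ | ⟨rfl, rfl⟩ <;> rcases hy with ⟨h3, h4⟩ | ⟨h3, h4⟩
      exacts [hij (h1 h3 h4), hij (h2 h3 h4), hij (h2 h4 h3), hij (h1 h4 h3)]
    · intro i _
      simp
    · refine List.nodup_range.pairwise_of_forall_ne fun i hi j hj hij => ?_
      simp only [Function.onFun, List.disjoint_left, List.mem_cons, List.not_mem_nil, or_false]
      rintro ⟨x, y⟩ hx hy
      simp only [Prod.mk.injEq] at hx hy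
      omega
    · intro x hx y hy
      obtain ⟨x1, x2⟩ := x
      obtain ⟨y1, y2⟩ := y
      simp only [List.mem_flatMap, List.mem_range, List.mem_cons,
        Prod.mk.injEq, List.not_mem_nil, or_false] at hx hy
      obtain ⟨i, hi, hx⟩ := hx
      obtain ⟨j, hj, hy⟩ := hy
      have h1 := hE.a_pos i hi
      have h2 := hE.b_pos i hi
      simp only [ne_eq, Prod.mk.injEq]
      omega
  · simp only [cutNet]; omega
  · simp only [cutNet]; rw [length_cutArcs]; omega
  · intro a ha
    simp only [cutNet, cutArcs, List.mem_append, List.mem_flatMap, List.mem_range,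
      List.mem_cons, List.not_mem_nil, or_false] at ha
    rcases ha with ⟨i, hi, h⟩ | ⟨j, hj, h⟩
    · rcases h with rfl | rfl <;> exact hφ _ (by omega)
    · rcases h with rfl | rfl
      · exact (Nat.sub_le _ _).trans hk
      · exact hk

/-! ### Relabelled copies of a graph -/

/-- `E` lists the edges of `G` after a relabelling `t` of the vertices that is injective on the
vertices with a nonzero label, among them all ends of edges. -/
structure Represents (E : EdgeData) {n : ℕ} (es : List (Fin n × Fin n)) (c : Sym2 (Fin n) → ℕ)
    (t : Fin n → ℕ) : Prop where
  length_eq : es.length = E.m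
  a_eq : ∀ i (h : i < es.length), E.a i = t es[i].1
  b_eq : ∀ i (h : i < es.length), E.b i = t es[i].2
  c_eq : ∀ i (h : i < es.length), E.c i = c s(es[i].1, es[i].2)
  a_ne : ∀ i < E.m, E.a i ≠ 0
  b_ne : ∀ i < E.m, E.b i ≠ 0
  inj : ∀ x y, t x = t y → t x ≠ 0 → x = y
  le : ∀ x, t x ≤ E.p
  surj : ∀ v, 1 ≤ v → v ≤ E.p → ∃ x, t x = v

variable {E : EdgeData} {n : ℕ} {G : SimpleGraph (Fin n)} {es : List (Fin n × Fin n)}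
  {c : Sym2 (Fin n) → ℕ} {t : Fin n → ℕ}

lemma Represents.proper (h : E.Represents es c t) (hes : IsEdgeList G es) (hm : 1 ≤ E.m)
    (hp : E.p ≤ 2 * E.m) : E.Proper := by
  have hlen := h.length_eq
  have hnd : ∀ i j, (hi : i < es.length) → (hj : j < es.length) →
      s(es[i].1, es[i].2) = s(es[j].1, es[j].2) → i = j := by
    intro i j hi hj hij
    refine (hes.1.getElem_inj_iff (i := i) (j := j) (hi := by simpa) (hj := by simpa)).1 ?_
    simpa using hij
  have hat : ∀ i, (hi : i < es.length) → t es[i].1 ≠ 0 := fun i hi => by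
    rw [← h.a_eq i hi]; exact h.a_ne i (by omega)
  have hbt : ∀ i, (hi : i < es.length) → t es[i].2 ≠ 0 := fun i hi => by
    rw [← h.b_eq i hi]; exact h.b_ne i (by omega)
  have ha : ∀ i < E.m, E.a i ≤ E.p := fun i hi => by
    rw [h.a_eq i (by omega)]; exact h.le _
  have hb : ∀ i < E.m, E.b i ≤ E.p := fun i hi => by
    rw [h.b_eq i (by omega)]; exact h.le _
  refine ⟨fun i hi => Nat.one_le_iff_ne_zero.2 (h.a_ne i hi), ha,
    fun i hi => Nat.one_le_iff_ne_zero.2 (h.b_ne i hi), hb, ?_, ?_, ?_, hp, ?_⟩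
  · intro i hi hab
    have hi' : i < es.length := by omega
    rw [h.a_eq i hi', h.b_eq i hi'] at hab
    have hmem := (hes.2 s(es[i].1, es[i].2)).1 (List.mem_map.2 ⟨es[i], List.getElem_mem _, rfl⟩)
    exact G.ne_of_adj hmem (h.inj _ _ hab (hat i hi'))
  · intro i hi j hj h1 h2
    have hi' : i < es.length := by omega
    have hj' : j < es.length := by omega
    rw [h.a_eq i hi', h.a_eq j hj'] at h1
    rw [h.b_eq i hi', h.b_eq j hj'] at h2
    exact hnd i j hi' hj' (by rw [h.inj _ _ h1 (hat i hi'), h.inj _ _ h2 (hbt i hi')])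
  · intro i hi j hj h1 h2
    have hi' : i < es.length := by omega
    have hj' : j < es.length := by omega
    rw [h.a_eq i hi', h.b_eq j hj'] at h1
    rw [h.b_eq i hi', h.a_eq j hj'] at h2
    exact hnd i j hi' hj' (by
      rw [h.inj _ _ h1 (hat i hi'), h.inj _ _ h2 (hbt i hi'), Sym2.eq_swap])
  · exact (Nat.one_le_iff_ne_zero.2 (h.a_ne 0 hm)).trans (ha 0 hm)

lemma Represents.p_le (h : E.Represents es c t) : E.p ≤ n := by
  have : Icc 1 E.p ⊆ (univ : Finset (Fin n)).image t := by
    intro v hv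
    rw [mem_Icc] at hv
    obtain ⟨x, hx⟩ := h.surj v hv.1 hv.2
    exact mem_image.2 ⟨x, mem_univ _, hx⟩
  simpa using (card_le_card this).trans card_image_le

lemma Represents.sum_edgesIn (h : E.Represents es c t) (hes : IsEdgeList G es)
    (S : Finset (Fin n)) : ∑ e ∈ NashWilliams.edgesIn G S, c e =
      ∑ i : Fin es.length, if es[i].1 ∈ S ∧ es[i].2 ∈ S then E.c i else 0 := by
  classical
  have h1 : NashWilliams.edgesIn G S =
      (es.map fun p => s(p.1, p.2)).toFinset.filter fun e => ∀ v ∈ e, v ∈ S := by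
    ext e
    simp only [NashWilliams.edgesIn, mem_filter, SimpleGraph.mem_edgeFinset, List.mem_toFinset]
    rw [hes.2 e]
  rw [h1, sum_filter, List.sum_toFinset _ hes.1, List.map_map, ← Fin.sum_univ_getElem]
  rw [← Fin.sum_congr' _ (show es.length = _ by simp)]
  refine sum_congr rfl fun i _ => ?_
  simp [h.c_eq i i.2]

lemma Represents.weightIn_eq (h : E.Represents es c t) (S : Finset ℕ) : E.weightIn S =
    ∑ i : Fin es.length, if t es[i].1 ∈ S ∧ t es[i].2 ∈ S then E.c i else 0 := by
  rw [weightIn, ← h.length_eq, Finset.sum_range]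
  refine sum_congr rfl fun i _ => ?_
  rw [h.a_eq i i.2, h.b_eq i i.2]
  rfl

lemma Represents.sparse_iff (h : E.Represents es c t) (hes : IsEdgeList G es) {k : ℕ} :
    E.Sparse k ↔ NashWilliams.Sparse G c k := by
  have hlen := h.length_eq
  have hat : ∀ i : Fin es.length, t es[i].1 ≠ 0 := fun i => by
    have := h.a_ne i (by omega)
    rwa [h.a_eq i i.2] at this
  have hbt : ∀ i : Fin es.length, t es[i].2 ≠ 0 := fun i => by
    have := h.b_ne i (by omega)
    rwa [h.b_eq i i.2] at this
  constructor
  · intro hE S hS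
    let S' : Finset ℕ := (S.image t).erase 0
    have hmem : ∀ x, t x ≠ 0 → (t x ∈ S' ↔ x ∈ S) := by
      intro x hx
      simp only [S', mem_erase, mem_image]
      exact ⟨fun ⟨_, y, hy, hyx⟩ => (h.inj _ _ hyx (hyx ▸ hx)) ▸ hy, fun hxS => ⟨hx, x, hxS, rfl⟩⟩
    have hW : E.weightIn S' = ∑ e ∈ NashWilliams.edgesIn G S, c e := by
      rw [h.weightIn_eq, h.sum_edgesIn hes]
      exact sum_congr rfl fun i _ => by simp only [hmem _ (hat i), hmem _ (hbt i)]
    have hcard : #S' ≤ #S := (card_le_card (erase_subset _ _)).trans card_image_le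
    rw [← hW]
    rcases S'.eq_empty_or_nonempty with h0 | h0
    · have : E.weightIn S' = 0 := by rw [h0]; simp [weightIn]
      rw [this]
      exact Nat.le_mul_of_pos_right _ hS.card_pos
    · refine (hE S' ?_ h0).trans (Nat.mul_le_mul_left _ hcard)
      intro v hv
      simp only [S', mem_erase, mem_image] at hv
      obtain ⟨hv0, x, -, rfl⟩ := hv
      exact mem_Icc.2 ⟨by omega, h.le x⟩
  · intro hG S' hS' hne
    have h0 : 0 ∉ S' := fun h => by have := mem_Icc.1 (hS' h); omega
    let S : Finset (Fin n) := univ.filter fun x => t x ∈ S'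
    have hW : E.weightIn S' = ∑ e ∈ NashWilliams.edgesIn G S, c e := by
      rw [h.weightIn_eq, h.sum_edgesIn hes]
      exact sum_congr rfl fun i _ => by simp [S]
    have hcard : #S ≤ #S' := by
      refine card_le_card_of_injOn t (fun x hx => by simpa [S] using hx) fun x hx y _ hxy => ?_
      refine h.inj _ _ hxy fun h' => h0 ?_
      have : t x ∈ S' := by simpa [S] using hx
      rwa [h'] at this
    have hSne : S.Nonempty := by
      obtain ⟨v, hv⟩ := hne
      have := mem_Icc.1 (hS' hv)
      obtain ⟨x, hx⟩ := h.surj v this.1 this.2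
      exact ⟨x, by simpa [S, hx] using hv⟩
    rw [hW]
    exact (hG S hSne).trans (Nat.mul_le_mul_left _ hcard)

/-- Sparsity can only be gained when `k` grows. -/
lemma Sparse.mono {k k' : ℕ} (h : E.Sparse k) (hk : k ≤ k') : E.Sparse k' := by
  intro S hS hne
  have h1 := h S hS hne
  obtain ⟨d, rfl⟩ := Nat.exists_eq_add_of_le hk
  have h2 : d ≤ d * #S := Nat.le_mul_of_pos_right _ hne.card_pos
  rw [Nat.add_mul]
  omega

/-- The total weight of the edges is an upper bound for the arboricity. -/
lemma sparse_total (hE : E.Proper) : E.Sparse (∑ i ∈ range E.m, E.c i) := by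
  intro S hS hne
  rcases Nat.lt_or_ge #S 2 with h | h
  · have h1 : #S = 1 := by have := hne.card_pos; omega
    obtain ⟨v, rfl⟩ := card_eq_one.1 h1
    have : E.weightIn {v} = 0 := by
      refine sum_eq_zero fun i hi => if_neg ?_
      rintro ⟨h2, h3⟩
      exact hE.ne i (mem_range.1 hi) ((mem_singleton.1 h2).trans (mem_singleton.1 h3).symm)
    rw [this, h1]; omega
  · have : E.weightIn S ≤ ∑ i ∈ range E.m, E.c i :=
      sum_le_sum fun i _ => by split_ifs <;> omega
    nlinarith

lemma not_sparse_zero (hE : E.Proper) (hm : 1 ≤ E.m) (hc : 1 ≤ E.c 0) : ¬ E.Sparse 0 := by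
  intro h
  have h1 := h {E.a 0, E.b 0} (by
    intro v hv
    rcases mem_insert.1 hv with rfl | hv
    · exact mem_Icc.2 ⟨hE.a_pos 0 hm, hE.a_le 0 hm⟩
    · rw [mem_singleton.1 hv]
      exact mem_Icc.2 ⟨hE.b_pos 0 hm, hE.b_le 0 hm⟩) ⟨E.a 0, by simp⟩
  have h2 : E.c 0 ≤ E.weightIn {E.a 0, E.b 0} := by
    refine le_trans ?_ (single_le_sum (fun _ _ => Nat.zero_le _) (mem_range.2 hm))
    simp
  omega

lemma Represents.isArboricity (h : E.Represents es c t) (hes : IsEdgeList G es) {k : ℕ}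
    (h1 : E.Sparse (k + 1)) (h0 : ¬ E.Sparse k) : IsArboricity G c (k + 1) := by
  refine ⟨NashWilliams.hasForestCover_iff.2 ((h.sparse_iff hes).1 h1), fun k' hk' => ?_⟩
  by_contra hlt
  exact h0 (((h.sparse_iff hes).2 (NashWilliams.hasForestCover_iff.1 hk')).mono (by omega))

end EdgeData

/-! ### The test as a program -/

namespace St

@[simp] lemma setReg_reg (s : St) (r x r' : ℕ) :
    (s.setReg r x).reg r' = if r' = r then x else s.reg r' := Function.update_apply _ _ _ _

@[simp] lemma setReg_mem (s : St) (r x : ℕ) : (s.setReg r x).mem = s.mem := rfl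

@[simp] lemma setMem_reg (s : St) (a x : ℕ) : (s.setMem a x).reg = s.reg := rfl

@[simp] lemma setMem_mem (s : St) (a x : ℕ) :
    (s.setMem a x).mem = Function.update s.mem a x := rfl

end St

lemma Blk.emit {mem : ℕ → ℕ} {a : ℕ} {l : List Arc} (h : Blk mem a (arcWords l))
    (x y z q₀ q₁ q₂ : ℕ) (h0 : q₀ = a + 3 * l.length) (h1 : q₁ = q₀ + 1) (h2 : q₂ = q₀ + 2) :
    Blk (Function.update (Function.update (Function.update mem q₀ x) q₁ y) q₂ z) a
      (arcWords (l ++ [⟨x, y, z⟩])) := by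
  have := ((h.snoc q₀ x (by simpa using h0)).snoc q₁ y (by simp; omega)).snoc q₂ z
    (by simp; omega)
  simpa using this

namespace Prog

infixr:60 " ;; " => Prog.seq

/-- `r := a`. Register `8` holds the constant `0` and register `9` the constant `1`. -/
def mov (r a : ℕ) : Prog := .op .add r a 8

/-- `r := r + 1` -/
def inc (r : ℕ) : Prog := .op .add r r 9

/-- `r := r - 1` -/
def dec (r : ℕ) : Prog := .op .sub r r 9

/-- Store an arc at the address in register `12` and advance this register. -/
def emit (x y z : ℕ) : Prog :=
  .store 12 x ;; inc 12 ;; .store 12 y ;; inc 12 ;; .store 12 z ;; inc 12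

/-- Read an arc from the address in register `11` into `x`, `y`, `z` and advance this register. -/
def readArc (x y z : ℕ) : Prog :=
  .load x 11 ;; inc 11 ;; .load y 11 ;; inc 11 ;; .load z 11 ;; inc 11

/-- The arcs of the flow network for one edge. -/
def flowEdge : Prog :=
  readArc 13 14 15 ;; emit 17 18 15 ;; emit 18 13 15 ;; emit 18 14 15 ;; inc 18 ;; dec 10

end Prog

/-- The edges of the graph as they are stored in memory. -/
def EdgeData.edges (E : EdgeData) : List Arc := (List.range E.m).map fun i => ⟨E.a i, E.b i, E.c i⟩

/-- The global registers and the edges as they are during the test of `k`; all scratch memory is at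
addresses from `base` on. -/
structure Env (E : EdgeData) (base k : ℕ) (s : St) : Prop where
  k_eq : s.reg 2 = k
  m_eq : s.reg 3 = E.m
  p_eq : s.reg 4 = E.p
  base_eq : s.reg 5 = base
  zero_eq : s.reg 8 = 0
  one_eq : s.reg 9 = 1
  edges : Blk s.mem 2 (arcWords E.edges)

lemma Blk.edge {mem : ℕ → ℕ} {E : EdgeData} (h : Blk mem 2 (arcWords E.edges)) {i : ℕ}
    (hi : i < E.m) : mem (2 + 3 * i) = E.a i ∧ mem (2 + (3 * i + 1)) = E.b i ∧
      mem (2 + (3 * i + 2)) = E.c i := by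
  have := h.arc (i := i) (by simpa [EdgeData.edges] using hi)
  simpa [EdgeData.edges, Nat.add_assoc] using this

lemma EdgeData.length_edges (E : EdgeData) : (arcWords E.edges).length = 3 * E.m := by
  simp [EdgeData.edges]

lemma Env.same {E : EdgeData} {base k : ℕ} {s s' : St} (h : Env E base k s) (h' : s.Same 10 s')
    (he : Blk s'.mem 2 (arcWords E.edges)) : Env E base k s' := by
  obtain ⟨h2, h3, h4, h5, h8, h9, -⟩ := h
  have hs := h'.1
  exact ⟨(hs 2 (by norm_num)).trans h2, (hs 3 (by norm_num)).trans h3,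
    (hs 4 (by norm_num)).trans h4, (hs 5 (by norm_num)).trans h5,
    (hs 8 (by norm_num)).trans h8, (hs 9 (by norm_num)).trans h9, he⟩

namespace Prog

/-- The arc of the flow network for one vertex. -/
def flowVertex : Prog := emit 13 8 2 ;; inc 13 ;; dec 10

/-- The arcs of the cut network for one edge, and the count of edges that are not saturated. -/
def cutEdge : Prog :=
  readArc 13 14 15 ;; .load 21 19 ;; inc 19 ;; .op .lt 21 21 15 ;; .op .add 16 16 21 ;;
  .load 21 19 ;; inc 19 ;; .load 22 19 ;; inc 19 ;; emit 13 14 22 ;; emit 14 13 21 ;; dec 10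

/-- The arcs of the cut network for one vertex. -/
def cutVertex : Prog :=
  .load 21 19 ;; inc 19 ;; .op .sub 21 2 21 ;; emit 8 13 21 ;; emit 13 8 2 ;; inc 13 ;; dec 10

/-- Subtract the contribution of one arc to the cut from the number in register `15`. -/
def cutValue : Prog :=
  readArc 13 14 21 ;; .op .add 13 12 13 ;; .load 13 13 ;; .op .add 14 12 14 ;; .load 14 14 ;;
  .op .sub 13 9 13 ;; .op .mul 13 13 14 ;; .op .mul 13 13 21 ;; .op .sub 15 15 13 ;; dec 10

end Prog

open Prog in
lemma flowEdge_loop {E : EdgeData} {w base k : ℕ} {s₀ : St} (g : Prop) (h₀ : Env E base k s₀)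
    (hbase : 2 + 3 * E.m ≤ base) (hB : base + 9 * E.m + 20 < 2 ^ w)
    (h10 : s₀.reg 10 = E.m) (h11 : s₀.reg 11 = 2) (h12 : s₀.reg 12 = base)
    (h17 : s₀.reg 17 = 3 * E.m + 1) (h18 : s₀.reg 18 = 2 * E.m + 1) :
    Runs w (.loop 10 flowEdge) (E.m * (flowEdge.cost + 1) + 1) s₀ g fun s g' =>
      (s₀.Same 10 s ∧ Env E base k s ∧ s.reg 12 = base + 9 * E.m ∧ s.reg 17 = 3 * E.m + 1 ∧
        Blk s.mem base (arcWords ((List.range E.m).flatMap fun i =>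
          [⟨3 * E.m + 1, 2 * E.m + 1 + i, E.c i⟩, ⟨2 * E.m + 1 + i, E.a i, E.c i⟩,
            ⟨2 * E.m + 1 + i, E.b i, E.c i⟩]))) ∧ g' = g := by
  have hlen := EdgeData.length_flatMap_range (fun i =>
    [(⟨3 * E.m + 1, 2 * E.m + 1 + i, E.c i⟩ : Arc),
    ⟨2 * E.m + 1 + i, E.a i, E.c i⟩, ⟨2 * E.m + 1 + i, E.b i, E.c i⟩]) 3 (fun _ => rfl)
  have hel := E.length_edges
  refine (Runs.for_loop (fun i s => s₀.Same 10 s ∧ Env E base k s ∧ s.reg 11 = 2 + 3 * i ∧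
    s.reg 12 = base + 9 * i ∧ s.reg 17 = 3 * E.m + 1 ∧ s.reg 18 = 2 * E.m + 1 + i ∧
    Blk s.mem base (arcWords ((List.range i).flatMap fun i =>
          [⟨3 * E.m + 1, 2 * E.m + 1 + i, E.c i⟩, ⟨2 * E.m + 1 + i, E.a i, E.c i⟩,
            ⟨2 * E.m + 1 + i, E.b i, E.c i⟩]))) ?_ g
    ⟨St.Same.refl _ _, h₀, h11, h12, h17, h18, Blk.nil _ _⟩ h10).mono le_rfl ?_
  · rintro i hi s ⟨h1, h2, h3, h4, h5, h6, h7⟩ hr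
    have h9 := h2.one_eq
    obtain ⟨e1, e2, e3⟩ := h2.edges.edge hi
    have hsame : s.Same 10 (flowEdge.exec s) := same_exec _ _ rfl
    refine ⟨?_, ⟨h1.trans hsame, h2.same hsame ?_, ?_, ?_, ?_, ?_, ?_⟩, ?_⟩
    · simp [flowEdge, readArc, emit, inc, dec, Ok, exec, h9]
      omega
    · simp [flowEdge, readArc, emit, inc, dec, exec, h9]
      repeat' apply Blk.update
      · exact h2.edges
      all_goals right; omega
    · simp [flowEdge, readArc, emit, inc, dec, exec, h9]; omega
    · simp [flowEdge, readArc, emit, inc, dec, exec, h9]; omega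
    · simp [flowEdge, readArc, emit, inc, dec, exec, h9]; omega
    · simp [flowEdge, readArc, emit, inc, dec, exec, h9]; omega
    · have := ((h7.emit (s.reg 17) (s.reg 18) (E.c i) (s.reg 12) _ _ (by rw [hlen]; omega) rfl
        rfl).emit (s.reg 18) (E.a i) (E.c i) (s.reg 12 + 3) _ _
          (by rw [List.length_append, hlen]; simp; omega) rfl rfl).emit (s.reg 18) (E.b i) (E.c i)
          (s.reg 12 + 6) _ _ (by rw [List.length_append, List.length_append, hlen]; simp; omega)
          rfl rfl
      simp [flowEdge, readArc, emit, inc, dec, exec, h9, List.range_succ, h3, e1, e2, e3, h5, h6,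
        Nat.add_assoc] at this ⊢
      exact this
    · simp [flowEdge, readArc, emit, inc, dec, exec, h9]; omega
  · rintro s g' ⟨⟨h1, h2, h3, h4, h5, h6, h7⟩, h8⟩
    exact ⟨⟨h1, h2, h4, h5, h7⟩, h8⟩

open Prog in
lemma flowVertex_loop {E : EdgeData} {w base k q : ℕ} {s₀ : St} (g : Prop) (h₀ : Env E base k s₀)
    (hbase : 2 + 3 * E.m ≤ base) (hB : q + 3 * E.p + 20 < 2 ^ w) {l : List Arc}
    (hq : q = base + 3 * l.length) (hl : Blk s₀.mem base (arcWords l))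
    (h10 : s₀.reg 10 = E.p) (h12 : s₀.reg 12 = q) (h13 : s₀.reg 13 = 1)
    (h17 : s₀.reg 17 = 3 * E.m + 1) :
    Runs w (.loop 10 flowVertex) (E.p * (flowVertex.cost + 1) + 1) s₀ g fun s g' =>
      (s₀.Same 10 s ∧ Env E base k s ∧ s.reg 12 = q + 3 * E.p ∧ s.reg 17 = 3 * E.m + 1 ∧
        Blk s.mem base (arcWords (l ++ (List.range E.p).map fun j => ⟨j + 1, 0, k⟩))) ∧
      g' = g := by
  have hel := E.length_edges
  refine (Runs.for_loop (fun j s => s₀.Same 10 s ∧ Env E base k s ∧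
    s.reg 12 = q + 3 * j ∧ s.reg 13 = j + 1 ∧ s.reg 17 = 3 * E.m + 1 ∧
    Blk s.mem base (arcWords (l ++ (List.range j).map fun j => ⟨j + 1, 0, k⟩))) ?_ g
    ⟨St.Same.refl _ _, h₀, h12, h13, h17, by simpa using hl⟩ h10).mono le_rfl ?_
  · rintro j hj s ⟨h1, h2, h3, h4, h5, h6⟩ hr
    have h9 := h2.one_eq
    have h8 := h2.zero_eq
    have hk := h2.k_eq
    have hsame : s.Same 10 (flowVertex.exec s) := same_exec _ _ rfl
    refine ⟨?_, ⟨h1.trans hsame, h2.same hsame ?_, ?_, ?_, ?_, ?_⟩, ?_⟩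
    · simp [flowVertex, emit, inc, dec, Ok, exec, h9]
      omega
    · simp [flowVertex, emit, inc, dec, exec, h9]
      repeat' apply Blk.update
      · exact h2.edges
      all_goals right; omega
    · simp [flowVertex, emit, inc, dec, exec, h9]; omega
    · simp [flowVertex, emit, inc, dec, exec, h9]; omega
    · simp [flowVertex, emit, inc, dec, exec, h9]; omega
    · have := h6.emit (s.reg 13) (s.reg 8) (s.reg 2) (s.reg 12) _ _ (by simp; omega) rfl rfl
      simp [flowVertex, emit, inc, dec, exec, h9, List.range_succ, h4, h8, hk] at this ⊢
      exact this
    · simp [flowVertex, emit, inc, dec, exec, h9]; omega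
  · rintro s g' ⟨⟨h1, h2, h3, h4, h5, h6⟩, h7⟩
    exact ⟨⟨h1, h2, h3, h5, h6⟩, h7⟩

/-- The words `φ 0, …, φ (len - 1)` are stored from address `a` on. -/
def Vals (mem : ℕ → ℕ) (a len : ℕ) (φ : ℕ → ℕ) : Prop := ∀ i < len, mem (a + i) = φ i

lemma Vals.update {mem : ℕ → ℕ} {a len : ℕ} {φ : ℕ → ℕ} (h : Vals mem a len φ) (x y : ℕ)
    (hx : x < a ∨ a + len ≤ x) : Vals (Function.update mem x y) a len φ := fun i hi => by
  rw [Function.update_of_ne (by omega), h i hi]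

open Prog in
lemma cutEdge_loop {E : EdgeData} {w base k q r len : ℕ} {φ : ℕ → ℕ} {s₀ : St} (g : Prop)
    (h₀ : Env E base k s₀) (hq : 2 + 3 * E.m ≤ q) (hr : q + len ≤ r) (hlen : 3 * E.m ≤ len)
    (hB : r + 6 * E.m + 20 < 2 ^ w) (hφ : Vals s₀.mem q len φ)
    (h10 : s₀.reg 10 = E.m) (h11 : s₀.reg 11 = 2) (h12 : s₀.reg 12 = r)
    (h16 : s₀.reg 16 = 0) (h19 : s₀.reg 19 = q) :
    Runs w (.loop 10 cutEdge) (E.m * (cutEdge.cost + 1) + 1) s₀ g fun s g' =>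
      (s₀.Same 10 s ∧ Env E base k s ∧ s.reg 12 = r + 6 * E.m ∧
        (s.reg 16 ≤ E.m ∧ (s.reg 16 = 0 ↔ ∀ i < E.m, E.c i ≤ φ (3 * i))) ∧
        s.reg 19 = q + 3 * E.m ∧ s.reg 24 = s₀.reg 24 ∧ Vals s.mem q len φ ∧
        Blk s.mem r (arcWords ((List.range E.m).flatMap fun i =>
          [⟨E.a i, E.b i, φ (3 * i + 2)⟩, ⟨E.b i, E.a i, φ (3 * i + 1)⟩]))) ∧ g' = g := by
  have hlen' := EdgeData.length_flatMap_range (fun i => [(⟨E.a i, E.b i, φ (3 * i + 2)⟩ : Arc),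
    ⟨E.b i, E.a i, φ (3 * i + 1)⟩]) 2 (fun _ => rfl)
  have hel := E.length_edges
  refine (Runs.for_loop (fun i s => s₀.Same 10 s ∧ Env E base k s ∧ s.reg 11 = 2 + 3 * i ∧
    s.reg 12 = r + 6 * i ∧ (s.reg 16 ≤ i ∧ (s.reg 16 = 0 ↔ ∀ j < i, E.c j ≤ φ (3 * j))) ∧
    s.reg 19 = q + 3 * i ∧ s.reg 24 = s₀.reg 24 ∧ Vals s.mem q len φ ∧
    Blk s.mem r (arcWords ((List.range i).flatMap fun i =>
      [⟨E.a i, E.b i, φ (3 * i + 2)⟩, ⟨E.b i, E.a i, φ (3 * i + 1)⟩]))) ?_ g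
    ⟨St.Same.refl _ _, h₀, h11, h12, by simp [h16], h19, rfl, hφ, Blk.nil _ _⟩ h10).mono
      le_rfl ?_
  · rintro i hi s ⟨h1, h2, h3, h4, ⟨h5, h5'⟩, h6, h7, h8, h9⟩ hr
    have h9' := h2.one_eq
    obtain ⟨e1, e2, e3⟩ := h2.edges.edge hi
    have f0 := h8 (3 * i) (by omega)
    have f1 := h8 (3 * i + 1) (by omega)
    have f2 := h8 (3 * i + 2) (by omega)
    have hsame : s.Same 10 (cutEdge.exec s) := same_exec _ _ rfl
    refine ⟨?_, ⟨h1.trans hsame, h2.same hsame ?_, ?_, ?_, ⟨?_, ?_⟩, ?_, ?_, ?_, ?_⟩, ?_⟩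
    · simp [cutEdge, readArc, emit, inc, dec, Ok, exec, h9']
      split_ifs <;> omega
    · simp [cutEdge, readArc, emit, inc, dec, exec, h9']
      repeat' apply Blk.update
      · exact h2.edges
      all_goals right; omega
    · simp [cutEdge, readArc, emit, inc, dec, exec, h9']; omega
    · simp [cutEdge, readArc, emit, inc, dec, exec, h9']; omega
    · simp [cutEdge, readArc, emit, inc, dec, exec, h9']; split_ifs <;> omega
    · simp [cutEdge, readArc, emit, inc, dec, exec, h9', h3, h6, Nat.add_assoc, e3, f0, h5']
      constructor
      · rintro ⟨h, h'⟩ j hj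
        rcases Nat.lt_or_ge j i with h'' | h''
        · exact h j h''
        · obtain rfl : j = i := by omega
          exact h'
      · exact fun h => ⟨fun j hj => h j (by omega), h i (by omega)⟩
    · simp [cutEdge, readArc, emit, inc, dec, exec, h9']; omega
    · simp [cutEdge, readArc, emit, inc, dec, exec, h9']; omega
    · simp [cutEdge, readArc, emit, inc, dec, exec, h9']
      repeat' apply Vals.update
      · exact h8
      all_goals right; omega
    · have := ((h9.emit (E.a i) (E.b i) (φ (3 * i + 2)) (s.reg 12) _ _ (by rw [hlen']; omega) rfl
        rfl).emit (E.b i) (E.a i) (φ (3 * i + 1)) (s.reg 12 + 3) _ _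
          (by rw [List.length_append, hlen']; simp; omega) rfl rfl)
      simp [cutEdge, readArc, emit, inc, dec, exec, h9', List.range_succ, h3, e1, e2, h6, f1, f2,
        Nat.add_assoc] at this ⊢
      exact this
    · simp [cutEdge, readArc, emit, inc, dec, exec, h9']; omega
  · rintro s g' ⟨⟨h1, h2, h3, h4, h5, h6, h7, h8, h9⟩, h10⟩
    exact ⟨⟨h1, h2, h4, h5, h6, h7, h8, h9⟩, h10⟩

open Prog in
lemma cutVertex_loop {E : EdgeData} {w base k q r r' len : ℕ} {φ : ℕ → ℕ} {s₀ : St} (g : Prop)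
    (h₀ : Env E base k s₀) (hq : 2 + 3 * E.m ≤ q) (hr : q + len ≤ r) (hlen : 3 * E.m + E.p ≤ len)
    (hB : r' + 6 * E.p + 20 < 2 ^ w) (hφ : Vals s₀.mem q len φ) {l : List Arc}
    (hr' : r' = r + 3 * l.length) (hl : Blk s₀.mem r (arcWords l))
    (h10 : s₀.reg 10 = E.p) (h12 : s₀.reg 12 = r') (h13 : s₀.reg 13 = 1)
    (h19 : s₀.reg 19 = q + 3 * E.m) :
    Runs w (.loop 10 cutVertex) (E.p * (cutVertex.cost + 1) + 1) s₀ g fun s g' =>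
      (s₀.Same 10 s ∧ Env E base k s ∧ s.reg 12 = r' + 6 * E.p ∧ s.reg 16 = s₀.reg 16 ∧
        s.reg 24 = s₀.reg 24 ∧
        Blk s.mem r (arcWords (l ++ (List.range E.p).flatMap fun j =>
          [⟨0, j + 1, k - φ (3 * E.m + j)⟩, ⟨j + 1, 0, k⟩]))) ∧ g' = g := by
  have hlen' := EdgeData.length_flatMap_range (fun j => [(⟨0, j + 1, k - φ (3 * E.m + j)⟩ : Arc),
    ⟨j + 1, 0, k⟩]) 2 (fun _ => rfl)
  have hel := E.length_edges
  refine (Runs.for_loop (fun j s => s₀.Same 10 s ∧ Env E base k s ∧ s.reg 12 = r' + 6 * j ∧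
    s.reg 13 = j + 1 ∧ s.reg 16 = s₀.reg 16 ∧ s.reg 19 = q + (3 * E.m + j) ∧
    s.reg 24 = s₀.reg 24 ∧ Vals s.mem q len φ ∧
    Blk s.mem r (arcWords (l ++ (List.range j).flatMap fun j =>
          [⟨0, j + 1, k - φ (3 * E.m + j)⟩, ⟨j + 1, 0, k⟩]))) ?_ g
    ⟨St.Same.refl _ _, h₀, h12, h13, rfl, h19, rfl, hφ, by simpa using hl⟩ h10).mono
      le_rfl ?_
  · rintro j hj s ⟨h1, h2, h3, h4, h5, h6, h7, h8, h9⟩ hr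
    have h9' := h2.one_eq
    have h8' := h2.zero_eq
    have hk := h2.k_eq
    have f0 := h8 (3 * E.m + j) (by omega)
    have hsame : s.Same 10 (cutVertex.exec s) := same_exec _ _ rfl
    refine ⟨?_, ⟨h1.trans hsame, h2.same hsame ?_, ?_, ?_, ?_, ?_, ?_, ?_, ?_⟩, ?_⟩
    · simp [cutVertex, emit, inc, dec, Ok, exec, h9']
      omega
    · simp [cutVertex, emit, inc, dec, exec, h9']
      repeat' apply Blk.update
      · exact h2.edges
      all_goals right; omega
    · simp [cutVertex, emit, inc, dec, exec, h9']; omega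
    · simp [cutVertex, emit, inc, dec, exec, h9']; omega
    · simp [cutVertex, emit, inc, dec, exec, h9']; omega
    · simp [cutVertex, emit, inc, dec, exec, h9']; omega
    · simp [cutVertex, emit, inc, dec, exec, h9']; omega
    · simp [cutVertex, emit, inc, dec, exec, h9']
      repeat' apply Vals.update
      · exact h8
      all_goals right; omega
    · have := ((h9.emit 0 (j + 1) (k - φ (3 * E.m + j)) (s.reg 12) _ _
        (by rw [List.length_append, hlen']; omega) rfl
        rfl).emit (j + 1) 0 k (s.reg 12 + 3) _ _
          (by rw [List.length_append, List.length_append, hlen']; simp; omega) rfl rfl)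
      simp [cutVertex, emit, inc, dec, exec, h9', List.range_succ, h4, h8', hk, h6, f0,
        Nat.add_assoc] at this ⊢
      exact this
    · simp [cutVertex, emit, inc, dec, exec, h9']; omega
  · rintro s g' ⟨⟨h1, h2, h3, h4, h5, h6, h7, h8, h9⟩, h10⟩
    exact ⟨⟨h1, h2, h3, h5, h7, h9⟩, h10⟩

open Prog in
lemma cutValue_loop {w r q nv k : ℕ} {s₀ : St} (g : Prop) (S : Finset ℕ) {l : List Arc}
    (h9 : s₀.reg 9 = 1) (hl : Blk s₀.mem r (arcWords l))
    (hS : ∀ v < nv, s₀.mem (q + v) = if v ∈ S then 1 else 0)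
    (hv : ∀ a ∈ l, a.tail < nv ∧ a.head < nv ∧ a.cap < 2 ^ w)
    (hB : r + 3 * l.length + 20 < 2 ^ w) (hB' : q + nv < 2 ^ w)
    (h10 : s₀.reg 10 = l.length) (h11 : s₀.reg 11 = r) (h12 : s₀.reg 12 = q)
    (h15 : s₀.reg 15 = k) :
    Runs w (.loop 10 cutValue) (l.length * (cutValue.cost + 1) + 1) s₀ g fun s g' =>
      (s₀.Same 10 s ∧ s.mem = s₀.mem ∧ s.reg 16 = s₀.reg 16 ∧
        s.reg 15 = k - (l.map fun a => if a.tail ∉ S ∧ a.head ∈ S then a.cap else 0).sum) ∧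
      g' = g := by
  refine (Runs.for_loop (fun j s => s₀.Same 10 s ∧ s.mem = s₀.mem ∧ s.reg 11 = r + 3 * j ∧
    s.reg 12 = q ∧ s.reg 16 = s₀.reg 16 ∧
    s.reg 15 = k - ((l.take j).map fun a => if a.tail ∉ S ∧ a.head ∈ S then a.cap else 0).sum)
    ?_ g ⟨St.Same.refl _ _, rfl, h11, h12, rfl, by simp [h15]⟩ h10).mono le_rfl ?_
  · rintro j hj s ⟨h1, h2, h3, h4, h5, h6⟩ hr
    have h9' : s.reg 9 = 1 := (h1.1 9 (by norm_num)).trans h9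
    obtain ⟨e1, e2, e3⟩ := hl.arc hj
    rw [Nat.add_assoc] at e2 e3
    obtain ⟨v1, v2, v3⟩ := hv _ (List.getElem_mem hj)
    have s1 := hS _ v1
    have s2 := hS _ v2
    have hsame : s.Same 10 (cutValue.exec s) := same_exec _ _ rfl
    refine ⟨?_, ⟨h1.trans hsame, ?_, ?_, ?_, ?_, ?_⟩, ?_⟩
    · have hw : w ≠ 0 := by rintro rfl; simp at hB
      by_cases ht : l[j].tail ∈ S <;> by_cases hh : l[j].head ∈ S <;>
        simp [cutValue, readArc, inc, dec, Ok, exec, h9', h2, h3, h4, Nat.add_assoc, e1, e2, e3,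
          s1, s2, ht, hh] <;> omega
    · simp [cutValue, readArc, inc, dec, exec, h2]
    · simp [cutValue, readArc, inc, dec, exec, h9']; omega
    · simp [cutValue, readArc, inc, dec, exec, h9']; omega
    · simp [cutValue, readArc, inc, dec, exec, h9']; omega
    · rw [List.take_add_one, List.getElem?_eq_getElem hj]
      simp [cutValue, readArc, inc, dec, exec, h9', h2, h3, h4, Nat.add_assoc, e1, e2, e3, s1,
        s2, h6, Nat.sub_sub]
      split_ifs <;> simp_all
    · simp [cutValue, readArc, inc, dec, exec, h9']; omega
  · rintro s g' ⟨⟨h1, h2, h3, h4, h5, h6⟩, h7⟩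
    exact ⟨⟨h1, h2, h5, by simpa using h6⟩, h7⟩

/-- A program without loops that leaves the global registers and the records of the calls alone. -/
lemma Runs.block {w : ℕ} {P : Prog} {s : St} (g : Prop) (R : St → Prop) (h : P.Ok (2 ^ w) s)
    (hk : P.Keeps 10 = true) (hR : R (P.exec s)) :
    Runs w P P.cost s g fun s' g' => (s.Same 10 s' ∧ R s') ∧ g' = g :=
  (Runs.of_exec g h).mono le_rfl fun _ _ ⟨h1, h2⟩ => ⟨by rw [h1]; exact ⟨P.same_exec s hk, hR⟩, h2⟩

/-- `Runs.seq` for a program with the time bound `T`, of which `u` steps remain for the second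
part. -/
lemma Runs.seq_le {w : ℕ} {P Q : Prog} {t T : ℕ} (u : ℕ) {s : St} {g : Prop}
    {R R' : St → Prop → Prop} (h : Runs w P t s g R) (hT : t + u + 1 ≤ T)
    (h' : ∀ s' g', R s' g' → Runs w Q u s' g' R') : Runs w (.seq P Q) T s g R' :=
  (h.seq h').mono hT fun _ _ h => h

namespace Prog

/-- The test whether the graph is sparse for the number `k` in register `2`. In the end register
`16` holds `0` if the test succeeds. -/
def test : Prog :=
  (.op .add 18 3 3 ;; .op .add 17 18 3 ;; inc 18 ;; inc 17 ;; mov 10 3 ;; mov 12 5 ;;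
    .op .add 11 9 9) ;;
  .loop 10 flowEdge ;; (mov 10 4 ;; mov 13 9) ;; .loop 10 flowVertex ;;
  (.op .add 22 17 9 ;; .op .sub 23 17 9 ;; .op .add 23 23 4) ;; .maxFlow 22 23 5 17 8 12 ;;
  (mov 19 12 ;; .op .add 24 12 23 ;; mov 12 24 ;; mov 16 8 ;; mov 10 3 ;; .op .add 11 9 9) ;;
  .loop 10 cutEdge ;; (mov 10 4 ;; mov 13 9) ;; .loop 10 cutVertex ;;
  (.op .add 22 4 9 ;; .op .add 23 3 4 ;; .op .add 23 23 23) ;; .minCut 22 23 24 12 ;;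
  (mov 10 23 ;; mov 11 24 ;; mov 15 2) ;; .loop 10 cutValue ;; .op .add 16 16 15

end Prog

set_option linter.unusedSimpArgs false in
open Prog in
/-- The test makes one call of each subroutine, of admissible size whatever the answers are, and if
both answers are correct it finds out whether the graph is sparse. From the address `base` on, the
scratch memory holds the `3 * m + p` arcs of the flow network, the flow, the `2 * m + 2 * p` arcs of
the cut network, and the indicator of the cut, which is less than `40 * m + 40` words. -/
lemma test_spec {E : EdgeData} (hE : E.Proper) (hm : 1 ≤ E.m) {w base k K n : ℕ} {s₀ : St}
    (g : Prop)
    (h₀ : Env E base k s₀) (hbase : 2 + 3 * E.m ≤ base) (hB : base + 40 * E.m + 40 < 2 ^ w)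
    (hk : E.m + k < 2 ^ w) (hc : ∀ i < E.m, E.c i < 2 ^ w) (hK : 6 ≤ K) (hn : E.p ≤ n) :
    Runs w test (1000 * E.m) s₀ g fun s g' =>
      ((∀ r < 10, s.reg r = s₀.reg r) ∧ Env E base k s ∧
        (∃ I, s.flowCalls = I :: s₀.flowCalls ∧ I.Admissible (K * E.m) (K * E.m) (2 ^ w)) ∧
        ∃ N, s.cutCalls = N :: s₀.cutCalls ∧ N.Admissible (K * n) (K * E.m) (2 ^ w)) ∧
      (g' → g ∧ (s.reg 16 = 0 ↔ E.Sparse k)) := by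
  have hp := hE.p_le
  have hel := E.length_edges
  have hfl := E.length_flowArcs k
  have hl1 := EdgeData.length_flatMap_range (fun i =>
    [(⟨3 * E.m + 1, 2 * E.m + 1 + i, E.c i⟩ : Arc),
    ⟨2 * E.m + 1 + i, E.a i, E.c i⟩, ⟨2 * E.m + 1 + i, E.b i, E.c i⟩]) 3 (fun _ => rfl) E.m
  have hpw : 0 < 2 ^ w := by positivity
  have hw : w ≠ 0 := by rintro rfl; omega
  have hadm1 := EdgeData.admissible_flowNet hE (k := k) (B := 2 ^ w - 1) (K := K) hm (by omega)
    (fun i hi => by have := hc i hi; omega) (by omega)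
  have hadm1' := EdgeData.admissible_flowNet hE (k := k) (B := 2 ^ w) (K := K) hm (by omega)
    (fun i hi => by have := hc i hi; omega) (by omega)
  have c1 : flowEdge.cost = 51 := rfl
  have c2 : flowVertex.cost = 15 := rfl
  have c3 : cutEdge.cost = 53 := rfl
  have c4 : cutVertex.cost = 33 := rfl
  have c5 : cutValue.cost = 29 := rfl
  refine Runs.seq_le (980 * E.m) (Runs.block _ (fun s => s.mem = s₀.mem ∧
    s.reg 10 = E.m ∧ s.reg 11 = 2 ∧
    s.reg 12 = base ∧ s.reg 17 = 3 * E.m + 1 ∧ s.reg 18 = 2 * E.m + 1) ?_ rfl ?_)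
    (by simp only [mov, inc, cost]; omega) ?_
  · obtain ⟨h2, h3, h4, h5, h8, h9, -⟩ := h₀
    simp [mov, inc, Ok, exec, h2, h3, h4, h5, h8, h9]
    omega
  · obtain ⟨h2, h3, h4, h5, h8, h9, -⟩ := h₀
    simp [mov, inc, Ok, exec, h2, h3, h4, h5, h8, h9]
    omega
  rintro s₁ _ ⟨⟨hs₁, hm₁, h10, h11, h12, h17, h18⟩, rfl⟩
  have he₁ : Env E base k s₁ := h₀.same hs₁ (by rw [hm₁]; exact h₀.edges)
  refine Runs.seq_le (920 * E.m) (flowEdge_loop _ he₁ hbase (by omega) h10 h11 h12 h17 h18)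
    (by rw [c1]; omega) ?_
  clear h10 h11 h12 h17 h18
  rintro s₂ _ ⟨⟨hs₂, he₂, h12, h17, hblk⟩, rfl⟩
  replace hs₂ := hs₁.trans hs₂
  clear hs₁ hm₁ he₁
  refine Runs.seq_le (910 * E.m) (Runs.block _ (fun s => s.mem = s₂.mem ∧
    s.reg 10 = E.p ∧ s.reg 13 = 1 ∧
    s.reg 12 = base + 9 * E.m ∧ s.reg 17 = 3 * E.m + 1) ?_ rfl ?_)
    (by simp only [mov, inc, cost]; omega) ?_
  · obtain ⟨h2, h3, h4, h5, h8, h9, -⟩ := he₂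
    simp [mov, inc, Ok, exec, h2, h3, h4, h5, h8, h9]
    omega
  · obtain ⟨h2, h3, h4, h5, h8, h9, -⟩ := he₂
    simp [mov, inc, Ok, exec, h2, h3, h4, h5, h8, h9, h12, h17]
  clear h12 h17
  rintro s₃ _ ⟨⟨hs₃, hm₃, h10, h13, h12, h17⟩, rfl⟩
  have he₃ : Env E base k s₃ := he₂.same hs₃ (by rw [hm₃]; exact he₂.edges)
  refine Runs.seq_le (870 * E.m) (flowVertex_loop _ he₃ hbase (by omega) (by rw [hl1]; omega)
    (by rw [hm₃]; exact hblk) h10 h12 h13 h17)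
    (by rw [c2]; omega) ?_
  clear h10 h13 h12 h17
  rintro s₄ _ ⟨⟨hs₄, he₄, h12, h17, hblk₄⟩, rfl⟩
  replace hs₄ := (hs₂.trans hs₃).trans hs₄
  clear hs₂ hs₃ hm₃ he₃ he₂ hblk
  refine Runs.seq_le (860 * E.m) (Runs.block _ (fun s => s.mem = s₄.mem ∧ s.reg 22 = 3 * E.m + 2 ∧
    s.reg 23 = 3 * E.m + E.p ∧ s.reg 12 = base + 9 * E.m + 3 * E.p ∧ s.reg 17 = 3 * E.m + 1)
    ?_ rfl ?_)
    (by simp only [mov, inc, cost]; omega) ?_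
  · obtain ⟨h2, h3, h4, h5, h8, h9, -⟩ := he₄
    simp [mov, inc, Ok, exec, h2, h3, h4, h5, h8, h9, h17]
    omega
  · obtain ⟨h2, h3, h4, h5, h8, h9, -⟩ := he₄
    simp [mov, inc, Ok, exec, h2, h3, h4, h5, h8, h9, h17, h12]
  clear h12 h17
  rintro s₅ _ ⟨⟨hs₅, hm₅, h22, h23, h12, h17⟩, rfl⟩
  have he₅ : Env E base k s₅ := he₄.same hs₅ (by rw [hm₅]; exact he₄.edges)
  refine Runs.seq_le (855 * E.m) (Runs.maxFlow (N := E.flowNet k) h22 (h23.trans hfl.symm)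
    (by rw [he₅.base_eq, hm₅]; exact hblk₄))
    (by omega) ?_
  rintro s₆ _ ⟨f, hs₆, rfl⟩
  rw [he₅.zero_eq, h17] at hs₆ ⊢
  -- the words stored by the flow subroutine
  obtain ⟨φ, hφ⟩ : ∃ φ : ℕ → ℕ, ∀ i, φ i = s₆.mem (base + 9 * E.m + 3 * E.p + i) :=
    ⟨_, fun _ => rfl⟩
  have hφf : ∀ i : Fin (E.flowArcs k).length, φ i = f i % 2 ^ w := by
    intro i
    rw [hφ, hs₆]
    dsimp only
    rw [h12]
    exact writeBlock_of_mem (len := (E.flowNet k).arcs.length) i.2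
  have hφlt : ∀ i < 3 * E.m + E.p, φ i < 2 ^ w := fun i hi => by
    rw [hφf ⟨i, by omega⟩]; exact Nat.mod_lt _ hpw
  have hφeq : FlowInstance.IsMaxFlow ⟨E.flowNet k, 3 * E.m + 1, 0⟩ f →
      ∀ i : Fin (E.flowArcs k).length, φ i = f i := by
    intro hf i
    have h1 : f i ≤ ((E.flowArcs k).get i).cap := hf.1.1 i
    have h2 : ((E.flowArcs k).get i).cap ≤ 2 ^ w - 1 := hadm1.2.2.2.2.2.2 _ (List.get_mem _ i)
    rw [hφf, Nat.mod_eq_of_lt]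
    omega
  have hvals₆ : Vals s₆.mem (base + 9 * E.m + 3 * E.p) (3 * E.m + E.p) φ := fun i _ => (hφ i).symm
  have hreg₆ : s₆.reg = s₅.reg := by rw [hs₆]
  have hsame₆ : ∀ r < 10, s₆.reg r = s₀.reg r := fun r hr => by
    rw [hreg₆, hs₅.1 r hr, hs₄.1 r hr]
  have hfc₆ : s₆.flowCalls = ⟨E.flowNet k, 3 * E.m + 1, 0⟩ :: s₀.flowCalls := by
    rw [hs₆]; dsimp only; rw [hs₅.2.1, hs₄.2.1]
  have hcc₆ : s₆.cutCalls = s₀.cutCalls := by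
    rw [hs₆]; dsimp only; rw [hs₅.2.2, hs₄.2.2]
  have hed₆ : Blk s₆.mem 2 (arcWords E.edges) := by
    refine he₅.edges.congr fun x h1 h2 => ?_
    rw [hs₆]
    dsimp only
    rw [h12]
    exact writeBlock_of_lt (by omega)
  have he₆ : Env E base k s₆ := by
    obtain ⟨h2, h3, h4, h5, h8, h9, -⟩ := he₅
    exact ⟨hreg₆ ▸ h2, hreg₆ ▸ h3, hreg₆ ▸ h4, hreg₆ ▸ h5, hreg₆ ▸ h8, hreg₆ ▸ h9, hed₆⟩
  rw [← hreg₆] at h12 h23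
  clear hs₆ hs₅ hm₅ h22 h17 he₅ hed₆ hφ hs₄ he₄ hblk₄ hreg₆
  refine Runs.seq_le (840 * E.m) (Runs.block _ (fun s => s.mem = s₆.mem ∧
    s.reg 10 = E.m ∧ s.reg 11 = 2 ∧
    s.reg 12 = base + 12 * E.m + 4 * E.p ∧ s.reg 16 = 0 ∧
    s.reg 19 = base + 9 * E.m + 3 * E.p ∧ s.reg 24 = base + 12 * E.m + 4 * E.p) ?_ rfl ?_)
    (by simp only [mov, inc, cost]; omega) ?_
  · obtain ⟨h2, h3, h4, h5, h8, h9, -⟩ := he₆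
    simp [mov, Ok, exec, h3, h8, h9, h12, h23]
    omega
  · obtain ⟨h2, h3, h4, h5, h8, h9, -⟩ := he₆
    simp [mov, exec, h3, h8, h9, h12, h23]
    omega
  clear h12 h23
  rintro s₇ _ ⟨⟨hs₇, hm₇, h10, h11, h12, h16, h19, h24⟩, rfl⟩
  have he₇ : Env E base k s₇ := he₆.same hs₇ (by rw [hm₇]; exact he₆.edges)
  refine Runs.seq_le (780 * E.m) (cutEdge_loop _ he₇ (q := base + 9 * E.m + 3 * E.p)
    (r := base + 12 * E.m + 4 * E.p) (len := 3 * E.m + E.p) (by omega) (by omega) (by omega)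
    (by omega) (by rw [hm₇]; exact hvals₆) h10 h11 h12 h16 h19)
    (by rw [c3]; omega) ?_
  rw [h24]
  clear h10 h11 h12 h16 h19 h24
  rintro s₈ _ ⟨⟨hs₈, he₈, h12, h16, h19, h24, hvals₈, hblk₈⟩, rfl⟩
  replace hs₈ := hs₇.trans hs₈
  clear hs₇ hm₇ he₇ he₆ hvals₆
  refine Runs.seq_le (770 * E.m) (Runs.block _ (fun s => s.mem = s₈.mem ∧
    s.reg 10 = E.p ∧ s.reg 13 = 1 ∧
    s.reg 12 = base + 18 * E.m + 4 * E.p ∧ s.reg 16 = s₈.reg 16 ∧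
    s.reg 19 = base + 9 * E.m + 3 * E.p + 3 * E.m ∧ s.reg 24 = base + 12 * E.m + 4 * E.p)
    ?_ rfl ?_)
    (by simp only [mov, inc, cost]; omega) ?_
  · obtain ⟨h2, h3, h4, h5, h8, h9, -⟩ := he₈
    simp [mov, Ok, exec, h4, h8, h9]
    omega
  · obtain ⟨h2, h3, h4, h5, h8, h9, -⟩ := he₈
    simp [mov, exec, h4, h8, h9, h12, h19, h24]
    omega
  clear h12 h19 h24
  have hl2 := EdgeData.length_flatMap_range (fun i => [(⟨E.a i, E.b i, φ (3 * i + 2)⟩ : Arc),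
    ⟨E.b i, E.a i, φ (3 * i + 1)⟩]) 2 (fun _ => rfl) E.m
  rintro s₉ _ ⟨⟨hs₉, hm₉, h10, h13, h12, h16', h19, h24⟩, rfl⟩
  have he₉ : Env E base k s₉ := he₈.same hs₉ (by rw [hm₉]; exact he₈.edges)
  refine Runs.seq_le (700 * E.m) (cutVertex_loop _ he₉ (q := base + 9 * E.m + 3 * E.p)
    (r := base + 12 * E.m + 4 * E.p) (len := 3 * E.m + E.p) (by omega) (by omega) (by omega)
    (by omega) (by rw [hm₉]; exact hvals₈)
    (by rw [hl2]; omega)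
    (by rw [hm₉]; exact hblk₈) h10 h12 h13 h19)
    (by rw [c4]; omega) ?_
  rw [h24, h16']
  clear h10 h13 h12 h16' h19 h24
  rintro t₁ _ ⟨⟨ht₁, het₁, h12, h16', h24, hblk₁⟩, rfl⟩
  replace ht₁ := (hs₈.trans hs₉).trans ht₁
  rw [← h16'] at h16
  clear hs₈ hs₉ hm₉ he₉ he₈ hvals₈ hblk₈ h16'
  have hcl := E.length_cutArcs k φ
  refine Runs.seq_le (690 * E.m) (Runs.block _ (fun s => s.mem = t₁.mem ∧ s.reg 22 = E.p + 1 ∧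
    s.reg 23 = 2 * E.m + 2 * E.p ∧ s.reg 12 = base + 18 * E.m + 10 * E.p ∧
    s.reg 16 = t₁.reg 16 ∧ s.reg 24 = base + 12 * E.m + 4 * E.p) ?_ rfl ?_)
    (by simp only [mov, inc, cost]; omega) ?_
  · obtain ⟨h2, h3, h4, h5, h8, h9, -⟩ := het₁
    simp [Ok, exec, h3, h4, h8, h9]
    omega
  · obtain ⟨h2, h3, h4, h5, h8, h9, -⟩ := het₁
    simp [exec, h3, h4, h8, h9, h12, h24]
    omega
  rw [h24] at *
  clear h12 h24
  rintro t₂ _ ⟨⟨ht₂, hm₂, h22, h23, h12, h16', h24⟩, rfl⟩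
  have het₂ : Env E base k t₂ := het₁.same ht₂ (by rw [hm₂]; exact het₁.edges)
  have hblk₂ : Blk t₂.mem (base + 12 * E.m + 4 * E.p) (arcWords (E.cutArcs k φ)) := by
    rw [hm₂]; exact hblk₁
  refine Runs.seq_le (685 * E.m) (Runs.minCut (N := E.cutNet k φ) h22 (h23.trans hcl.symm)
    (by rw [h24]; exact hblk₂))
    (by omega) ?_
  rintro t₃ _ ⟨S, hs₃, rfl⟩
  have hreg₃ : t₃.reg = t₂.reg := by rw [hs₃]
  have hadm2 := EdgeData.admissible_cutNet hE (k := k) (B := 2 ^ w) (K := K) (φ := φ) hK hn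
    (fun i hi => (hφlt i (by omega)).le) (by omega)
  have hcap : ∀ a ∈ E.cutArcs k φ, a.tail < E.p + 1 ∧ a.head < E.p + 1 ∧ a.cap < 2 ^ w := by
    intro a ha
    have h1 := hadm2.1.1 a ha
    have h2 := (EdgeData.admissible_cutNet hE (k := k) (B := 2 ^ w - 1) (K := K) (φ := φ) hK hn
      (fun i hi => by have := hφlt i (by omega); omega) (by omega)).2.2.2.2 a ha
    exact ⟨h1.1, h1.2.1, by omega⟩
  have hsame₃ : ∀ r < 10, t₃.reg r = s₀.reg r := fun r hr => by
    rw [hreg₃, ht₂.1 r hr, ht₁.1 r hr, hsame₆ r hr]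
  have hfc₃ : t₃.flowCalls = ⟨E.flowNet k, 3 * E.m + 1, 0⟩ :: s₀.flowCalls := by
    rw [hs₃]; dsimp only; rw [ht₂.2.1, ht₁.2.1, hfc₆]
  have hcc₃ : t₃.cutCalls = E.cutNet k φ :: s₀.cutCalls := by
    rw [hs₃]; dsimp only; rw [ht₂.2.2, ht₁.2.2, hcc₆]
  have hmem₃ : ∀ x < base + 18 * E.m + 10 * E.p, t₃.mem x = t₂.mem x := fun x hx => by
    rw [hs₃]
    dsimp only
    rw [h12]
    exact writeBlock_of_lt hx
  have hS₃ : ∀ v < E.p + 1, t₃.mem (base + 18 * E.m + 10 * E.p + v) = if v ∈ S then 1 else 0 := by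
    intro v hv
    rw [hs₃]
    dsimp only
    rw [h12, writeBlock_of_mem (show v < (E.cutNet k φ).numV from hv)]
  have het₃ : Env E base k t₃ := by
    obtain ⟨h2, h3, h4, h5, h8, h9, he⟩ := het₂
    exact ⟨hreg₃ ▸ h2, hreg₃ ▸ h3, hreg₃ ▸ h4, hreg₃ ▸ h5, hreg₃ ▸ h8, hreg₃ ▸ h9,
      he.congr fun x h1 h2 => hmem₃ x (by omega)⟩
  have hblk₃ : Blk t₃.mem (base + 12 * E.m + 4 * E.p) (arcWords (E.cutArcs k φ)) :=
    hblk₂.congr fun x h1 h2 => hmem₃ x (by rw [length_arcWords] at h2; omega)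
  rw [← hreg₃] at h12 h23 h24 h16'
  clear hs₃ hreg₃ hmem₃ ht₁ ht₂ hm₂ het₁ het₂ hblk₁ hblk₂ h22
  refine Runs.seq_le (675 * E.m) (Runs.block _ (fun s => s.mem = t₃.mem ∧
    s.reg 10 = 2 * E.m + 2 * E.p ∧
    s.reg 11 = base + 12 * E.m + 4 * E.p ∧ s.reg 12 = base + 18 * E.m + 10 * E.p ∧
    s.reg 15 = k ∧ s.reg 16 = t₁.reg 16) ?_ rfl ?_)
    (by simp only [mov, inc, cost]; omega) ?_
  · obtain ⟨h2, h3, h4, h5, h8, h9, -⟩ := het₃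
    simp [mov, Ok, exec, h2, h8, h23, h24]
    omega
  · obtain ⟨h2, h3, h4, h5, h8, h9, -⟩ := het₃
    simp [mov, exec, h2, h8, h23, h24, h12, h16']
  clear h12 h23 h24 h16'
  rintro t₄ _ ⟨⟨ht₄, hm₄, h10, h11, h12, h15, h16'⟩, rfl⟩
  have het₄ : Env E base k t₄ := het₃.same ht₄ (by rw [hm₄]; exact het₃.edges)
  refine Runs.seq_le (400 * E.m) (cutValue_loop _ S het₄.one_eq (by rw [hm₄]; exact hblk₃)
    (by rw [hm₄]; exact hS₃) hcap (by omega) (by omega) (by omega) h11 h12 h15)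
    (by rw [c5, hcl]; omega) ?_
  rw [h16']
  clear h10 h11 h12 h15 h16'
  rintro t₅ _ ⟨⟨ht₅, hm₅, h16', h15⟩, rfl⟩
  have het₅ : Env E base k t₅ := het₄.same ht₅ (by rw [hm₅]; exact het₄.edges)
  have h15' : t₅.reg 15 = k - (E.cutNet k φ).inCut S := h15
  have hout : (t₅.reg 16 + t₅.reg 15 = 0) ↔
      ((∀ i < E.m, E.c i ≤ φ (3 * i)) ∧ k ≤ (E.cutNet k φ).inCut S) := by
    rw [← h16.2, h15', h16']
    omega
  have hle : t₅.reg 16 + t₅.reg 15 < 2 ^ w := by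
    rw [h15', h16']
    have := h16.1
    omega
  refine (Runs.of_exec (P := .op .add 16 16 15) _ hle).mono (by simp only [cost]; omega) ?_
  rintro _ _ ⟨rfl, rfl⟩
  have ht : t₃.Same 10 (Prog.exec (.op .add 16 16 15) t₅) :=
    (ht₄.trans ht₅).trans (same_exec _ _ rfl)
  refine ⟨⟨fun r hr => (ht.1 r hr).trans (hsame₃ r hr), het₃.same ht het₅.edges,
    ⟨_, ht.2.1.trans hfc₃, hadm1'⟩, _, ht.2.2.trans hcc₃, hadm2⟩, ?_⟩
  rintro ⟨⟨hg, hf⟩, hS⟩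
  refine ⟨hg, ?_⟩
  rw [← EdgeData.sparse_iff hE f φ (hφeq hf) hf hS, ← hout]
  simp [exec]

/-! ### Binary search -/

namespace Prog

/-- One round of the binary search: it tests the number halfway between the registers `1` and `0`,
updates one of them, and sets register `6` to whether they still differ by more than one. -/
def searchStep : Prog :=
  (.op .add 2 0 1 ;; .op .add 20 9 9 ;; .op .div 2 2 20) ;; test ;;
    (.cond 16 (mov 1 2) (mov 0 2) ;; .op .add 20 1 9 ;; .op .lt 6 20 0)

/-- The binary search for the least number for which the test succeeds. It starts with an upper
bound in register `0` and ends with the result there. -/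
def search : Prog := (mov 1 8 ;; .op .lt 6 9 0) ;; .loop 6 searchStep

end Prog

/-- All calls so far are of admissible size. -/
def St.Admissible (s : St) (v v' e B : ℕ) : Prop :=
  (∀ I ∈ s.flowCalls, I.Admissible v e B) ∧ ∀ N ∈ s.cutCalls, N.Admissible v' e B

/-- The state of the binary search when at most `j` rounds remain. The register `0` holds the upper
and the register `1` the lower end of the interval; `tot` bounds the upper end, `J` the number of
calls of each kind. Only `correct` depends on the correctness `g` of the answers. -/
structure SearchInv (E : EdgeData) (base tot J K n B j : ℕ) (s : St) (g : Prop) : Prop where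
  env : ∃ k, Env E base k s
  lt : s.reg 1 < s.reg 0
  le : s.reg 0 ≤ tot
  width : s.reg 0 ≤ s.reg 1 + 2 ^ j
  flag : s.reg 6 = if s.reg 1 + 1 < s.reg 0 then 1 else 0
  flowCalls : s.flowCalls.length + j ≤ J
  cutCalls : s.cutCalls.length + j ≤ J
  admissible : s.Admissible (K * E.m) (K * n) (K * E.m) B
  correct : g → E.Sparse (s.reg 0) ∧ ¬ E.Sparse (s.reg 1)

open Prog in
/-- A round of the search halves the interval. Whatever the answers are, the interval shrinks, so
that the bound on the number of rounds does not depend on their correctness. -/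
lemma SearchInv.step {E : EdgeData} (hE : E.Proper) (hm : 1 ≤ E.m) {w base tot K n J j : ℕ} {s : St}
    {g : Prop} (hbase : 2 + 3 * E.m ≤ base) (hB : base + 40 * E.m + 40 < 2 ^ w)
    (htot : E.m + 2 * tot + 2 < 2 ^ w) (hc : ∀ i < E.m, E.c i < 2 ^ w) (hK : 6 ≤ K) (hn : E.p ≤ n)
    (h : SearchInv E base tot J K n (2 ^ w) j s g) (h6 : s.reg 6 ≠ 0) :
    ∃ j', j = j' + 1 ∧
      Runs w searchStep (1100 * E.m) s g (SearchInv E base tot J K n (2 ^ w) j') := by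
  obtain ⟨⟨k₀, he⟩, hlt, hle, hwid, hflag, hfc, hcc, hadm, hcor⟩ := h
  have hlt' : s.reg 1 + 1 < s.reg 0 := by
    by_contra h'
    rw [if_neg h'] at hflag
    exact h6 hflag
  rcases j with _ | j
  · simp at hwid; omega
  refine ⟨j, rfl, ?_⟩
  obtain ⟨hi, hhi⟩ : ∃ hi, s.reg 0 = hi := ⟨_, rfl⟩
  obtain ⟨lo, hlo⟩ : ∃ lo, s.reg 1 = lo := ⟨_, rfl⟩
  rw [hhi, hlo] at hlt' hwid hcor
  rw [hhi] at hle
  rw [pow_succ] at hwid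
  have hk : (hi + lo) / 2 ≤ tot := by omega
  generalize hkk : (hi + lo) / 2 = k at hk
  refine Runs.seq_le (1050 * E.m) (Runs.of_exec _ ?_) (by simp only [cost]; omega) ?_
  · simp [Ok, exec, he.one_eq, hhi, hlo]
    omega
  rintro s₁ _ ⟨hs₁, rfl⟩
  have he₁ : Env E base k s₁ := by
    obtain ⟨h2, h3, h4, h5, h8, h9, hed⟩ := he
    subst hs₁
    refine ⟨?_, ?_, ?_, ?_, ?_, ?_, hed⟩ <;> simp [exec, h3, h4, h5, h8, h9, hhi, hlo, hkk]
  have h0 : s₁.reg 0 = hi := by rw [hs₁]; simp [exec, hhi]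
  have h1 : s₁.reg 1 = lo := by rw [hs₁]; simp [exec, hlo]
  have hf : s₁.flowCalls = s.flowCalls := by rw [hs₁]; rfl
  have hc' : s₁.cutCalls = s.cutCalls := by rw [hs₁]; rfl
  rw [← hf] at hfc
  rw [← hc'] at hcc
  rw [St.Admissible, ← hf, ← hc'] at hadm
  clear hs₁ hf hc' he hhi hlo hlt hflag h6
  refine Runs.seq_le (20 * E.m) (test_spec hE hm _ he₁ hbase hB (by omega) hc hK hn) (by omega) ?_
  rintro s₂ g₂ ⟨⟨hs₂, he₂, ⟨I, hI, hIa⟩, N, hN, hNa⟩, hg₂⟩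
  rw [← hs₂ 0 (by omega)] at h0
  rw [← hs₂ 1 (by omega)] at h1
  clear he₁ hs₂
  have hok : Ok (2 ^ w) (.cond 16 (mov 1 2) (mov 0 2) ;; .op .add 20 1 9 ;; .op .lt 6 20 0) s₂ := by
    by_cases h16 : s₂.reg 16 = 0 <;>
    · simp [Ok, exec, mov, h16, he₂.k_eq, he₂.one_eq, he₂.zero_eq, h1]
      omega
  refine (Runs.of_exec _ hok).mono (by simp only [cost, mov]; omega) ?_
  clear hok
  rintro s₃ _ ⟨hs₃, rfl⟩
  have he₃ : Env E base k s₃ := by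
    obtain ⟨h2, h3, h4, h5, h8, h9, hed⟩ := he₂
    subst hs₃
    by_cases h16 : s₂.reg 16 = 0 <;>
    · refine ⟨?_, ?_, ?_, ?_, ?_, ?_, ?_⟩ <;>
        simp [exec, mov, h16, h2, h3, h4, h5, h8, h9, hed]
  have h0' : s₃.reg 0 = if s₂.reg 16 = 0 then k else hi := by
    subst hs₃
    by_cases h16 : s₂.reg 16 = 0 <;>
      simp [exec, mov, h16, he₂.k_eq, he₂.zero_eq, h0]
  have h1' : s₃.reg 1 = if s₂.reg 16 = 0 then lo else k := by
    subst hs₃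
    by_cases h16 : s₂.reg 16 = 0 <;>
      simp [exec, mov, h16, he₂.k_eq, he₂.zero_eq, h1]
  have h6' : s₃.reg 6 = if s₃.reg 1 + 1 < s₃.reg 0 then 1 else 0 := by
    subst hs₃
    by_cases h16 : s₂.reg 16 = 0 <;>
      simp [exec, mov, h16, he₂.k_eq, he₂.zero_eq, he₂.one_eq, h1]
  have hf : s₃.flowCalls = I :: s₁.flowCalls := by
    rw [← hI, hs₃]
    by_cases h16 : s₂.reg 16 = 0 <;> simp [exec, mov, h16, St.setReg]
  have hc' : s₃.cutCalls = N :: s₁.cutCalls := by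
    rw [← hN, hs₃]
    by_cases h16 : s₂.reg 16 = 0 <;> simp [exec, mov, h16, St.setReg]
  refine ⟨⟨k, he₃⟩, ?_, ?_, ?_, h6', ?_, ?_, ⟨?_, ?_⟩, ?_⟩
  · rw [h0', h1']; split_ifs <;> omega
  · rw [h0']; split_ifs <;> omega
  · rw [h0', h1']; split_ifs <;> omega
  · rw [hf, List.length_cons]; omega
  · rw [hc', List.length_cons]; omega
  · rw [hf]; exact List.forall_mem_cons.2 ⟨hIa, hadm.1⟩
  · rw [hc']; exact List.forall_mem_cons.2 ⟨hNa, hadm.2⟩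
  · intro hg
    obtain ⟨hg, h16⟩ := hg₂ hg
    obtain ⟨hh, hl⟩ := hcor hg
    rw [h0', h1']
    split_ifs with h'
    · exact ⟨h16.1 h', hl⟩
    · exact ⟨hh, fun hs => h' (h16.2 hs)⟩

open Prog in
/-- If all answers are correct, the binary search finds the least number for which the graph is
sparse. -/
lemma search_spec {E : EdgeData} (hE : E.Proper) (hm : 1 ≤ E.m) {w base tot K n J k₀ : ℕ} {s : St}
    (hbase : 2 + 3 * E.m ≤ base) (hB : base + 40 * E.m + 40 < 2 ^ w)
    (htot : E.m + 2 * tot + 2 < 2 ^ w) (hc : ∀ i < E.m, E.c i < 2 ^ w) (hK : 6 ≤ K) (hn : E.p ≤ n)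
    (he : Env E base k₀ s) (h0 : s.reg 0 = tot) (hJ : tot ≤ 2 ^ J) (hf : s.flowCalls = [])
    (hcut : s.cutCalls = []) (h1 : 1 ≤ E.c 0) (hsum : ∑ i ∈ Finset.range E.m, E.c i = tot) :
    Runs w search (1200 * E.m * (J + 1)) s True fun s g =>
      s.flowCalls.length ≤ J ∧ s.cutCalls.length ≤ J ∧
      s.Admissible (K * E.m) (K * n) (K * E.m) (2 ^ w) ∧
      (g → ∃ k, s.reg 0 = k + 1 ∧ E.Sparse (k + 1) ∧ ¬ E.Sparse k) := by
  have htot1 : 1 ≤ tot := by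
    rw [← hsum]
    exact h1.trans (Finset.single_le_sum (f := E.c) (fun _ _ => Nat.zero_le _)
      (Finset.mem_range.2 (show 0 < E.m by omega)))
  refine Runs.seq_le (J * (1100 * E.m + 1) + 1) (Runs.of_exec _ ?_)
    (by simp only [mov, cost]; nlinarith) ?_
  · simp [Ok, mov, he.zero_eq]
  rintro s₁ _ ⟨hs₁, rfl⟩
  refine (Runs.while_loop (SearchInv E base tot J K n (2 ^ w))
    (fun j s g h h6 => h.step hE hm hbase hB htot hc hK hn h6) J s₁ _ ?_).mono le_rfl ?_
  · subst hs₁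
    refine ⟨⟨k₀, ?_⟩, ?_, ?_, ?_, ?_, ?_, ?_, ⟨?_, ?_⟩, fun _ => ?_⟩
    · obtain ⟨h2, h3, h4, h5, h8, h9, hed⟩ := he
      refine ⟨?_, ?_, ?_, ?_, ?_, ?_, hed⟩ <;> simp [exec, mov, h2, h3, h4, h5, h8, h9]
    · simp [exec, mov, h0, he.zero_eq]; omega
    · simp [exec, mov, h0]
    · simp [exec, mov, h0, he.zero_eq, hJ]
    · simp [exec, mov, h0, he.zero_eq, he.one_eq]
    · simp [exec, mov, St.setReg, hf]
    · simp [exec, mov, St.setReg, hcut]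
    · simp [exec, mov, St.setReg, hf]
    · simp [exec, mov, St.setReg, hcut]
    · simp only [exec, mov, St.setReg_reg, h0, he.zero_eq]
      refine ⟨?_, ?_⟩
      · have := EdgeData.sparse_total hE
        rw [hsum] at this
        simpa using this
      · simpa using EdgeData.not_sparse_zero hE hm h1
  · rintro s₂ g ⟨h6, j, h⟩
    refine ⟨by have := h.flowCalls; omega, by have := h.cutCalls; omega, h.admissible, fun hg => ?_⟩
    obtain ⟨ha, hb⟩ := h.correct hg
    have hlt := h.lt
    have : s₂.reg 0 = s₂.reg 1 + 1 := by
      have := h.flag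
      rw [h6] at this
      split_ifs at this
      omega
    exact ⟨_, this, this ▸ ha, hb⟩

/-! ### The relabelling as a program -/

namespace Prog

/-- Replace the vertex at the address in register `11` by its label, which is found in the table at
the address in register `7`. Vertices without a label have the entry `0` there and get the next
label, which is counted in register `4`. -/
def label : Prog :=
  (.load 13 11 ;; .op .add 14 7 13 ;; .load 15 14) ;;
    .cond 15 (mov 20 8) (inc 4 ;; .store 14 4) ;; .load 15 14 ;; .store 11 15 ;; inc 11

/-- Label the ends of an edge and add its weight to register `0`. -/
def labelEdge : Prog :=
  label ;; label ;; .load 15 11 ;; .op .add 0 0 15 ;; inc 11 ;; dec 10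

/-- Replace the vertices of positive degree by the labels `1, 2, …`. The table of the labels is put
right after the input, and the scratch memory after that table. -/
def relabel : Prog :=
  (.const 9 1 ;; .load 3 9 ;; .load 14 8 ;; .op .add 7 3 3 ;; .op .add 7 7 3 ;; inc 7 ;; inc 7 ;;
    .op .add 5 7 14 ;; mov 10 3 ;; .op .add 11 9 9) ;; .loop 10 labelEdge

end Prog

/-- The table at the address `q` holds an injective labelling `t` of some of the `n` vertices by
`1, …, p`, where `p` is in register `4`. Vertices without a label have `t x = 0`. -/
structure Labels {n : ℕ} (q : ℕ) (t : Fin n → ℕ) (s : St) : Prop where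
  table_eq : s.reg 7 = q
  zero_eq : s.reg 8 = 0
  one_eq : s.reg 9 = 1
  mem_eq : ∀ x : Fin n, s.mem (q + x) = t x
  inj : ∀ x y, t x = t y → t x ≠ 0 → x = y
  le : ∀ x, t x ≤ s.reg 4
  surj : ∀ v, 1 ≤ v → v ≤ s.reg 4 → ∃ x, t x = v

open Prog in
/-- Labelling the vertex `x`, which is stored at the address `a`, extends the labelling. -/
lemma label_spec {n w q a : ℕ} {t : Fin n → ℕ} {s : St} (h : Labels q t s) (x : Fin n)
    (ha : s.reg 11 = a) (haq : a < q) (hx : s.mem a = x) (hq : q + n < 2 ^ w)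
    (hp : s.reg 4 + 1 < 2 ^ w) :
    label.Ok (2 ^ w) s ∧ ∃ t' : Fin n → ℕ, Labels q t' (label.exec s) ∧ t' x ≠ 0 ∧
      (∀ y, t y ≠ 0 → t' y = t y) ∧ (label.exec s).reg 4 ≤ s.reg 4 + 1 ∧
      (label.exec s).reg 11 = a + 1 ∧ (label.exec s).mem a = t' x ∧
      (∀ b < q, b ≠ a → (label.exec s).mem b = s.mem b) ∧
      (∀ r ∈ [0, 3, 5, 10], (label.exec s).reg r = s.reg r) ∧
      (label.exec s).flowCalls = s.flowCalls ∧ (label.exec s).cutCalls = s.cutCalls := by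
  obtain ⟨h7, h8, h9, hmem, hinj, hle, hsurj⟩ := h
  have hxn := x.2
  by_cases h0 : t x = 0
  -- a new label: the table and the edge list are updated
  · have hok : label.Ok (2 ^ w) s := by
      simp [label, Ok, exec, mov, inc, h7, h9, ha, hx, hmem, h0]
      omega
    have hr : ∀ r, (label.exec s).reg r = if r = 11 then a + 1 else if r = 15 then s.reg 4 + 1 else
        if r = 4 then s.reg 4 + 1 else if r = 14 then q + x else if r = 13 then x else s.reg r := by
      intro r
      simp [label, exec, mov, inc, h7, h9, ha, hx, hmem, h0]
      split_ifs <;> simp_all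
    have hm : (label.exec s).mem =
        Function.update (Function.update s.mem (q + x) (s.reg 4 + 1)) a (s.reg 4 + 1) := by
      simp [label, exec, mov, inc, h7, h9, ha, hx, hmem, h0]
    have hc : (label.exec s).flowCalls = s.flowCalls ∧ (label.exec s).cutCalls = s.cutCalls := by
      simp [label, exec, mov, inc, h7, h9, ha, hx, hmem, h0, St.setReg, St.setMem]
    refine ⟨hok, Function.update t x (s.reg 4 + 1), ⟨?_, ?_, ?_, ?_, ?_, ?_, ?_⟩, ?_, ?_, ?_,
      ?_, ?_,
      ?_, ?_, hc⟩
    · simp [hr, h7]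
    · simp [hr, h8]
    · simp [hr, h9]
    · intro y
      rw [hm, Function.update_of_ne (by omega)]
      by_cases hy : y = x
      · subst hy; simp
      · rw [Function.update_of_ne (by omega), Function.update_of_ne hy, hmem]
    · intro y z hyz hy
      have h1 := hle y
      have h2 := hle z
      rw [Function.update_apply, Function.update_apply] at hyz
      rw [Function.update_apply] at hy
      split_ifs at hyz hy with h3 h4 h4
      · rw [h3, h4]
      · omega
      · omega
      · exact hinj _ _ hyz hy
    · intro y
      have h1 := hle y
      have h2 : (label.exec s).reg 4 = s.reg 4 + 1 := by simp [hr]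
      rw [Function.update_apply, h2]
      split_ifs <;> omega
    · intro v h1 h2
      simp [hr] at h2
      rcases Nat.lt_or_ge (s.reg 4) v with h3 | h3
      · exact ⟨x, by rw [Function.update_self]; omega⟩
      · obtain ⟨y, rfl⟩ := hsurj v h1 h3
        refine ⟨y, Function.update_of_ne ?_ _ _⟩
        rintro rfl
        omega
    · simp
    · intro y hy
      refine Function.update_of_ne ?_ _ _
      rintro rfl
      exact hy h0
    · simp [hr]
    · simp [hr]
    · simp [hm]
    · intro b h1 h2
      rw [hm, Function.update_of_ne h2, Function.update_of_ne (by omega)]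
    · intro r h1
      fin_cases h1 <;> simp [hr]
  · have hok : label.Ok (2 ^ w) s := by
      simp [label, Ok, exec, mov, inc, h7, h8, h9, ha, hx, hmem, h0]
      omega
    have hr : ∀ r, (label.exec s).reg r = if r = 11 then a + 1 else if r = 15 then t x else
        if r = 20 then 0 else if r = 14 then q + x else if r = 13 then x else s.reg r := by
      intro r
      simp [label, exec, mov, inc, h7, h8, h9, ha, hx, hmem, h0]
      split_ifs <;> simp_all
    have hm : (label.exec s).mem = Function.update s.mem a (t x) := by
      simp [label, exec, mov, inc, h7, h8, h9, ha, hx, hmem, h0]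
    have hc : (label.exec s).flowCalls = s.flowCalls ∧ (label.exec s).cutCalls = s.cutCalls := by
      simp [label, exec, mov, inc, h7, h8, h9, ha, hx, hmem, h0, St.setReg, St.setMem]
    refine ⟨hok, t, ⟨?_, ?_, ?_, ?_, hinj, ?_, ?_⟩, h0, fun _ _ => rfl, ?_, ?_, ?_,
      ?_, ?_, hc⟩
    · simp [hr, h7]
    · simp [hr, h8]
    · simp [hr, h9]
    · intro y
      rw [hm, Function.update_of_ne (by omega), hmem]
    · simpa [hr] using hle
    · simpa [hr] using hsurj
    · simp [hr]
    · simp [hr]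
    · simp [hm]
    · intro b h1 h2
      rw [hm, Function.update_of_ne h2]
    · intro r h1
      fin_cases h1 <;> simp [hr]

/-- The state after the first `i` edges of the list `es`, with weights `wt`, have been
relabelled. -/
structure RelabelInv {n : ℕ} (es : List (Fin n × Fin n)) (wt : ℕ → ℕ) (i : ℕ) (s : St) : Prop where
  labels : ∃ t : Fin n → ℕ, Labels (2 + 3 * es.length) t s ∧ ∀ j (h : j < es.length), j < i →
    s.mem (2 + 3 * j) = t es[j].1 ∧ s.mem (2 + 3 * j + 1) = t es[j].2 ∧
      t es[j].1 ≠ 0 ∧ t es[j].2 ≠ 0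
  todo : ∀ j (h : j < es.length), i ≤ j →
    s.mem (2 + 3 * j) = es[j].1 ∧ s.mem (2 + 3 * j + 1) = es[j].2
  weight : ∀ j < es.length, s.mem (2 + 3 * j + 2) = wt j
  sum_eq : s.reg 0 = ∑ j ∈ Finset.range i, wt j
  m_eq : s.reg 3 = es.length
  p_le : s.reg 4 ≤ 2 * i
  base_eq : s.reg 5 = 2 + 3 * es.length + n
  pointer : s.reg 11 = 2 + 3 * i
  flowCalls : s.flowCalls = []
  cutCalls : s.cutCalls = []

open Prog in
lemma RelabelInv.step {n w i : ℕ} {es : List (Fin n × Fin n)} {wt : ℕ → ℕ} {s : St}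
    (hB : 2 + 3 * es.length + n < 2 ^ w) (hwt : ∑ j ∈ Finset.range es.length, wt j < 2 ^ w)
    (h : RelabelInv es wt i s) (hi : i < es.length) (hc : s.reg 10 = es.length - i) :
    labelEdge.Ok (2 ^ w) s ∧ RelabelInv es wt (i + 1) (labelEdge.exec s) ∧
      (labelEdge.exec s).reg 10 = es.length - (i + 1) := by
  obtain ⟨⟨t, ht, hdone⟩, htodo, hweight, hsum, hm, hp, hbase, hptr, hfc, hcc⟩ := h
  obtain ⟨ok₁, t₁, ht₁, hne₁, hext₁, hp₁, hptr₁, hmem₁, hmem₁', hreg₁, hfc₁, hcc₁⟩ :=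
    label_spec (w := w) ht es[i].1 hptr (by omega) (htodo i hi le_rfl).1 (by omega) (by omega)
  generalize hs₁ : label.exec s = s₁ at *
  obtain ⟨ok₂, t₂, ht₂, hne₂, hext₂, hp₂, hptr₂, hmem₂, hmem₂', hreg₂, hfc₂, hcc₂⟩ :=
    label_spec (w := w) ht₁ es[i].2 hptr₁ (by omega)
      (by rw [hmem₁' _ (by omega) (by omega)]; exact (htodo i hi le_rfl).2) (by omega) (by omega)
  generalize hs₂ : label.exec s₁ = s₂ at *
  have hmem : ∀ b < 2 + 3 * es.length, b ≠ 2 + 3 * i → b ≠ 2 + 3 * i + 1 → s₂.mem b = s.mem b :=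
    fun b h1 h2 h3 => by rw [hmem₂' b h1 h3, hmem₁' b h1 h2]
  have hreg : ∀ r ∈ [0, 3, 5, 10], s₂.reg r = s.reg r := fun r hr => by
    rw [hreg₂ r hr, hreg₁ r hr]
  have hsum' : s.reg 0 + wt i = ∑ j ∈ Finset.range (i + 1), wt j := by
    rw [Finset.sum_range_succ, hsum]
  have hle : s.reg 0 + wt i < 2 ^ w := by
    rw [hsum']
    refine lt_of_le_of_lt (Finset.sum_le_sum_of_subset ?_) hwt
    exact Finset.range_subset_range.2 hi
  have hwi : s₂.mem (2 + 3 * i + 1 + 1) = wt i := by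
    rw [← hweight i hi]
    exact hmem _ (by omega) (by omega) (by omega)
  have hext : ∀ x, t x ≠ 0 → t₂ x = t x := fun x hx => by
    rw [hext₂ x (by rwa [hext₁ x hx]), hext₁ x hx]
  have h9 := ht₂.one_eq
  have hexec : labelEdge.exec s =
      (.load 15 11 ;; .op .add 0 0 15 ;; inc 11 ;; dec 10 : Prog).exec s₂ := by
    rw [← hs₂, ← hs₁]; rfl
  have hr : ∀ r, (labelEdge.exec s).reg r = if r = 10 then es.length - (i + 1) else
      if r = 11 then 2 + 3 * (i + 1) else if r = 0 then s.reg 0 + wt i else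
      if r = 15 then wt i else s₂.reg r := by
    intro r
    rw [hexec]
    simp [exec, inc, dec, h9, hwi, hptr₂, hreg 0, hreg 10, hc]
    split_ifs <;> omega
  have hmm : (labelEdge.exec s).mem = s₂.mem := by rw [hexec]; rfl
  refine ⟨⟨ok₁, ?_, ?_⟩, ⟨⟨t₂, ?_, ?_⟩, ?_, ?_, ?_, ?_, ?_, ?_, ?_, ?_, ?_⟩, ?_⟩
  · rw [hs₁]; exact ok₂
  · rw [hs₁, hs₂]
    simp [Ok, exec, inc, dec, h9, hwi, hptr₂, hreg 0]
    omega
  · obtain ⟨a1, a2, a3, a4, a5, a6, a7⟩ := ht₂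
    refine ⟨?_, ?_, ?_, ?_, a5, ?_, ?_⟩
    · simpa [hr] using a1
    · simpa [hr] using a2
    · simpa [hr] using a3
    · rwa [hmm]
    · simpa [hr] using a6
    · simpa [hr] using a7
  · intro j hj hji
    rw [hmm]
    rcases Nat.lt_succ_iff_lt_or_eq.1 hji with h1 | rfl
    · obtain ⟨b1, b2, b3, b4⟩ := hdone j hj h1
      rw [hmem _ (by omega) (by omega) (by omega), hmem _ (by omega) (by omega) (by omega),
        hext _ b3, hext _ b4]
      exact ⟨b1, b2, b3, b4⟩
    · refine ⟨?_, hmem₂, ?_, hne₂⟩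
      · rw [hmem₂' _ (by omega) (by omega), hmem₁, hext₂ _ hne₁]
      · rwa [hext₂ _ hne₁]
  · intro j hj hji
    rw [hmm, hmem _ (by omega) (by omega) (by omega), hmem _ (by omega) (by omega) (by omega)]
    exact htodo j hj (by omega)
  · intro j hj
    rw [hmm, hmem _ (by omega) (by omega) (by omega)]
    exact hweight j hj
  · simpa [hr] using hsum'
  · simpa [hr, hreg 3] using hm
  · simp [hr]; omega
  · simpa [hr, hreg 5] using hbase
  · simp [hr]
  · rw [hexec]; exact hfc₂.trans (hfc₁.trans hfc)
  · rw [hexec]; exact hcc₂.trans (hcc₁.trans hcc)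
  · simp [hr]

/-- Every block of `3 * m` words represents a list of `m` arcs. -/
lemma blk_arcWords (mem : ℕ → ℕ) (a m : ℕ) : Blk mem a (arcWords
    ((List.range m).map fun i =>
      ⟨mem (a + 3 * i), mem (a + (3 * i + 1)), mem (a + (3 * i + 2))⟩)) := by
  induction m with
  | zero => exact Blk.nil _ _
  | succ m ih =>
    rw [List.range_succ, List.map_append, arcWords_append]
    refine ih.append fun i hi => ?_
    simp only [List.map_cons, List.map_nil, length_arcWords, List.length_cons,
      List.length_nil] at hi
    rw [length_arcWords, List.length_map, List.length_range]
    interval_cases i <;> simp [Nat.add_assoc]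

open Prog in
/-- The relabelling produces a copy of the graph without isolated vertices, and the sum of the
weights in register `0`. -/
lemma relabel_spec {n w : ℕ} {es : List (Fin n × Fin n)} {c : Sym2 (Fin n) → ℕ} {s : St}
    (hs : ∀ P : Prog, s.cfg [P] = initConfig P es c) (hm : 1 ≤ es.length)
    (hB : 10 + 3 * es.length + n < 2 ^ w)
    (hwt : ∑ i : Fin es.length, c s(es[i].1, es[i].2) < 2 ^ w) (g : Prop) :
    Runs w relabel (100 * es.length) s g fun s g' =>
      (∃ (E : EdgeData) (t : Fin n → ℕ) (k : ℕ), E.Represents es c t ∧ E.p ≤ 2 * E.m ∧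
        Env E (2 + 3 * E.m + n) k s ∧ s.reg 0 = ∑ i ∈ Finset.range E.m, E.c i ∧
        s.flowCalls = [] ∧ s.cutCalls = []) ∧ g' = g := by
  have hreg : s.reg = fun _ => 0 := congrArg Config.reg (hs (.const 0 0))
  have hmem : s.mem = fun a => (inputWords es c).getD a 0 := congrArg Config.mem (hs (.const 0 0))
  have hfc : s.flowCalls = [] := congrArg Config.flowCalls (hs (.const 0 0))
  have hcc : s.cutCalls = [] := congrArg Config.cutCalls (hs (.const 0 0))
  have hw : inputWords es c = n :: es.length ::
      arcWords (es.map fun p => ⟨(p.1 : ℕ), (p.2 : ℕ), c s(p.1, p.2)⟩) := by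
    simp [inputWords, arcWords, List.flatMap_map]
  have h0 : s.mem 0 = n := by rw [hmem, hw]; rfl
  have h1 : s.mem 1 = es.length := by rw [hmem, hw]; rfl
  have hblk : Blk s.mem 2 (arcWords (es.map fun p => ⟨(p.1 : ℕ), (p.2 : ℕ), c s(p.1, p.2)⟩)) := by
    intro i hi
    rw [hmem, hw]
    dsimp only
    rw [show 2 + i = i + 1 + 1 by omega, List.getD_cons_succ, List.getD_cons_succ,
      List.getD_eq_getElem _ _ hi]
  have hz : ∀ a, 2 + 3 * es.length ≤ a → s.mem a = 0 := by
    intro a ha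
    rw [hmem, hw]
    refine List.getD_eq_default _ _ ?_
    simpa using by omega
  have harc : ∀ i (h : i < es.length), s.mem (2 + 3 * i) = es[i].1 ∧
      s.mem (2 + 3 * i + 1) = es[i].2 ∧ s.mem (2 + 3 * i + 2) = c s(es[i].1, es[i].2) := by
    intro i hi
    have h := hblk.arc (i := i) (by simpa using hi)
    rw [List.getElem_map] at h
    exact h
  have hsum : ∑ i ∈ Finset.range es.length, s.mem (2 + 3 * i + 2) < 2 ^ w := by
    rw [Finset.sum_range]
    exact lt_of_eq_of_lt (Finset.sum_congr rfl fun i _ => (harc i i.2).2.2) hwt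
  have hcost : labelEdge.cost = 43 := rfl
  have hw0 : w ≠ 0 := by rintro rfl; omega
  refine Runs.seq_le (44 * es.length + 1) (Runs.of_exec _ ?_)
    (by simp only [inc, mov, cost]; omega) ?_
  · simp [Ok, exec, inc, mov, hreg, h0, h1]
    omega
  rintro s₁ _ ⟨hs₁, rfl⟩
  refine (Runs.for_loop (N := es.length) (RelabelInv es fun i => s.mem (2 + 3 * i + 2))
    (fun i hi s' h hc => h.step (by omega) hsum hi hc) _ ?_ ?_).mono (by rw [hcost]; omega) ?_
  · subst hs₁
    refine ⟨⟨fun _ => 0, ⟨?_, ?_, ?_, ?_, ?_, ?_, ?_⟩, ?_⟩, ?_, ?_, ?_, ?_, ?_, ?_, ?_, ?_, ?_⟩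
    · simp [exec, inc, mov, hreg, h0, h1]; omega
    · simp [exec, inc, mov, hreg]
    · simp [exec, inc, mov, hreg]
    · intro x; simpa [exec, inc, mov] using hz _ (by omega)
    · simp
    · simp
    · simp [exec, inc, mov, hreg]; omega
    · simp
    · intro j hj _
      exact ⟨(harc j hj).1, (harc j hj).2.1⟩
    · intro j hj; rfl
    · simp [exec, inc, mov, hreg]
    · simp [exec, inc, mov, hreg, h1]
    · simp [exec, inc, mov, hreg]
    · simp [exec, inc, mov, hreg, h0, h1]; omega
    · simp [exec, inc, mov, hreg]
    · exact hfc
    · exact hcc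
  · subst hs₁
    simp [exec, inc, mov, hreg, h1]
  rintro s₂ _ ⟨⟨⟨t, ht, hdone⟩, -, hweight, hsum', hm', hp, hbase, -, hfc', hcc'⟩, rfl⟩
  refine ⟨⟨⟨es.length, s₂.reg 4, fun i => s₂.mem (2 + 3 * i), fun i => s₂.mem (2 + (3 * i + 1)),
    fun i => s₂.mem (2 + (3 * i + 2))⟩, t, s₂.reg 2,
      ⟨rfl, ?_, ?_, ?_, ?_, ?_, ht.inj, ht.le, ht.surj⟩,
    hp, ⟨rfl, hm', rfl, hbase, ht.zero_eq, ht.one_eq, blk_arcWords _ _ _⟩, ?_, hfc', hcc'⟩, rfl⟩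
  · exact fun i hi => (hdone i hi hi).1
  · exact fun i hi => (hdone i hi hi).2.1
  · exact fun i hi => (hweight i hi).trans (harc i hi).2.2
  · intro i hi
    change s₂.mem _ ≠ 0
    rw [(hdone i hi hi).1]
    exact (hdone i hi hi).2.2.1
  · intro i hi
    change s₂.mem (2 + 3 * i + 1) ≠ 0
    rw [(hdone i hi hi).2.1]
    exact (hdone i hi hi).2.2.2
  · rw [hsum']
    exact Finset.sum_congr rfl fun i hi => (hweight i (Finset.mem_range.1 hi)).symm

/-! ### The bounds -/

lemma FlowInstance.Admissible.mono {I : FlowInstance} {v e B B' : ℕ} (h : I.Admissible v e B)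
    (hB : B ≤ B') : I.Admissible v e B' :=
  ⟨h.1, h.2.1, h.2.2.1, h.2.2.2.1, h.2.2.2.2.1, h.2.2.2.2.2.1,
    fun a ha => (h.2.2.2.2.2.2 a ha).trans hB⟩

lemma Net.Admissible.mono {N : Net} {v e B B' : ℕ} (h : N.Admissible v e B)
    (hB : B ≤ B') : N.Admissible v e B' :=
  ⟨h.1, h.2.1, h.2.2.1, h.2.2.2.1, fun a ha => (h.2.2.2.2 a ha).trans hB⟩

lemma IsEdgeList.length_eq {V : Type*} {G : SimpleGraph V} {es : List (V × V)}
    (h : IsEdgeList G es) : es.length = G.edgeSet.ncard := by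
  classical
  have : G.edgeSet = ((es.map fun p => s(p.1, p.2)).toFinset : Set (Sym2 V)) := by
    ext e
    rw [← h.2, List.coe_toFinset]
    rfl
  rw [this, Set.ncard_coe_finset, List.toFinset_card_of_nodup h.1, List.length_map]

/-- Words of `⌊20 log N⌋` bits hold numbers up to a power of `N`, but not more. -/
lemma wordSize_bounds {N : ℕ} (hN : 2 ≤ N) :
    N ^ 12 ≤ 2 ^ ⌊20 * Real.log N⌋₊ ∧ 2 ^ ⌊20 * Real.log N⌋₊ ≤ N ^ 20 := by
  have hN0 : (0 : ℝ) < N := by positivity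
  have hl : 0 ≤ Real.log N := Real.log_natCast_nonneg N
  have hw : (⌊20 * Real.log N⌋₊ : ℝ) ≤ 20 * Real.log N := Nat.floor_le (by positivity)
  have hw' : 20 * Real.log N < ⌊20 * Real.log N⌋₊ + 1 := Nat.lt_floor_add_one _
  generalize ⌊20 * Real.log N⌋₊ = w at *
  have h2 := Real.log_two_gt_d9
  have h2' := Real.log_two_lt_d9
  constructor
  · have h : (N : ℝ) ^ 13 ≤ 2 ^ (w + 1) := by
      rw [← Real.log_le_log_iff (by positivity) (by positivity), Real.log_pow, Real.log_pow]
      push_cast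
      nlinarith
    have h' : N ^ 13 ≤ 2 ^ (w + 1) := by exact_mod_cast h
    have : N ^ 12 * 2 ≤ 2 ^ w * 2 := by
      calc N ^ 12 * 2 ≤ N ^ 12 * N := Nat.mul_le_mul_left _ hN
        _ = N ^ 13 := by ring
        _ ≤ 2 ^ w * 2 := by rw [← pow_succ]; exact h'
    omega
  · have h : (2 : ℝ) ^ w ≤ N ^ 20 := by
      rw [← Real.log_le_log_iff (by positivity) (by positivity), Real.log_pow, Real.log_pow]
      push_cast
      nlinarith
    exact_mod_cast h

/-- The number of rounds of a binary search in an interval of length `N ^ 2`. -/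
lemma exists_rounds {N : ℕ} (hN : 2 ≤ N) :
    ∃ J : ℕ, N ^ 2 ≤ 2 ^ J ∧ (J : ℝ) + 1 ≤ 8 * Real.log N := by
  have hN0 : (0 : ℝ) < N := by positivity
  have h2 := Real.log_two_gt_d9
  have hl : Real.log 2 ≤ Real.log N := Real.log_le_log (by norm_num) (by exact_mod_cast hN)
  refine ⟨⌊4 * Real.log N⌋₊ + 1, ?_, ?_⟩
  · have h : (N : ℝ) ^ 2 ≤ 2 ^ (⌊4 * Real.log N⌋₊ + 1) := by
      have hw' : 4 * Real.log N < ⌊4 * Real.log N⌋₊ + 1 := Nat.lt_floor_add_one _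
      rw [← Real.log_le_log_iff (by positivity) (by positivity), Real.log_pow, Real.log_pow]
      push_cast
      nlinarith
    exact_mod_cast h
  · have hw : (⌊4 * Real.log N⌋₊ : ℝ) ≤ 4 * Real.log N :=
      Nat.floor_le (mul_nonneg (by norm_num) (by linarith))
    push_cast
    linarith

/-- The number of vertices is at least two, and all sizes are polynomial in `n * C`. -/
lemma size_bounds {n C : ℕ} {G : SimpleGraph (Fin n)} {c : Sym2 (Fin n) → ℕ}
    {es : List (Fin n × Fin n)} (hes : IsEdgeList G es) (hm : 1 ≤ es.length)
    (hc : ∀ e ∈ G.edgeSet, 1 ≤ c e ∧ c e ≤ C) :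
    2 ≤ n * C ∧ C ≤ n * C ∧ n ≤ n * C ∧ es.length ≤ (n * C) ^ 2 ∧
      ∑ i : Fin es.length, c s(es[i].1, es[i].2) ≤ (n * C) ^ 2 := by
  have hci : ∀ i : Fin es.length, c s(es[i].1, es[i].2) ≤ C := fun i =>
    (hc _ ((hes.2 _).1 (List.mem_map.2 ⟨es[i], List.getElem_mem _, rfl⟩))).2
  have he : s(es[0].1, es[0].2) ∈ G.edgeSet :=
    (hes.2 _).1 (List.mem_map.2 ⟨es[0], List.getElem_mem _, rfl⟩)
  have hC : 1 ≤ C := (hc _ he).1.trans (hc _ he).2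
  have hn : 2 ≤ n := by
    have hne : es[0].1 ≠ es[0].2 := (G.mem_edgeSet.1 he).ne
    have h1 := es[0].1.2
    have h2 := es[0].2.2
    by_contra hlt
    exact hne (Fin.ext (by omega))
  have hlen : es.length ≤ n ^ 2 := by
    have := (List.Nodup.of_map _ hes.1).length_le_card
    simpa [sq] using this
  have h1 : n ≤ n * C := Nat.le_mul_of_pos_right _ hC
  refine ⟨hn.trans h1, Nat.le_mul_of_pos_left _ (by omega), h1,
    hlen.trans (Nat.pow_le_pow_left h1 2), ?_⟩
  calc ∑ i : Fin es.length, c s(es[i].1, es[i].2) ≤ ∑ _i : Fin es.length, C :=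
        Finset.sum_le_sum fun i _ => hci i
    _ = es.length * C := by simp
    _ ≤ n ^ 2 * C ^ 2 := Nat.mul_le_mul hlen (Nat.le_self_pow (by norm_num) C)
    _ = (n * C) ^ 2 := by ring

open Prog in
/-- The whole program in words of `w` bits: if all answers are correct, the output is the
arboricity. -/
lemma arboricity_spec {n C w J K : ℕ} {G : SimpleGraph (Fin n)} {c : Sym2 (Fin n) → ℕ}
    {es : List (Fin n × Fin n)} {s : St} (hs : ∀ P : Prog, s.cfg [P] = initConfig P es c)
    (hes : IsEdgeList G es) (hm : 1 ≤ es.length) (hc : ∀ e ∈ G.edgeSet, 1 ≤ c e ∧ c e ≤ C)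
    (hw : (n * C) ^ 12 ≤ 2 ^ w) (hJ : (n * C) ^ 2 ≤ 2 ^ J) (hK : 6 ≤ K) :
    Runs w (relabel ;; search) (1300 * es.length * (J + 1) + 1) s True fun s g =>
      s.flowCalls.length ≤ J ∧ s.cutCalls.length ≤ J ∧
      s.Admissible (K * es.length) (K * n) (K * es.length) (2 ^ w) ∧
      (g → IsArboricity G c (s.reg 0)) := by
  obtain ⟨hN, hCN, hnN, hmN, hcN⟩ := size_bounds hes hm hc
  have hci : ∀ i (h : i < es.length), 1 ≤ c s(es[i].1, es[i].2) ∧ c s(es[i].1, es[i].2) ≤ C :=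
    fun i h => hc _ ((hes.2 _).1 (List.mem_map.2 ⟨es[i], List.getElem_mem _, rfl⟩))
  generalize n * C = N at *
  have hw' : 1024 * N ^ 2 ≤ 2 ^ w := by
    refine le_trans ?_ hw
    calc 1024 * N ^ 2 = 2 ^ 10 * N ^ 2 := by norm_num
      _ ≤ N ^ 10 * N ^ 2 := Nat.mul_le_mul_right _ (Nat.pow_le_pow_left hN 10)
      _ = N ^ 12 := by ring
  have hN2 : 2 * N ≤ N ^ 2 := by rw [sq]; exact Nat.mul_le_mul_right _ hN
  generalize N ^ 2 = A at *
  refine Runs.seq_le (1200 * es.length * (J + 1)) (relabel_spec hs hm (by omega) (by omega) True)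
    (by nlinarith) ?_
  rintro s₁ g ⟨⟨E, t, k, hE, hp, henv, h0, hf, hcut⟩, rfl⟩
  have hlen := hE.length_eq
  have hm' : 1 ≤ E.m := hlen ▸ hm
  have hprop := hE.proper hes hm' hp
  have hEc : ∀ i < E.m, 1 ≤ E.c i ∧ E.c i ≤ C := fun i hi => by
    rw [hE.c_eq i (by omega)]; exact hci i (by omega)
  have hsum : ∑ i ∈ Finset.range E.m, E.c i ≤ A := by
    rw [← hlen, Finset.sum_range]
    refine le_of_eq_of_le (Finset.sum_congr rfl fun i _ => hE.c_eq i i.2) hcN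
  rw [hlen]
  refine (search_spec (w := w) (K := K) hprop hm' (by omega) (by omega) (by omega)
    (fun i hi => by have := hEc i hi; omega) hK hE.p_le henv h0 (hsum.trans hJ) hf hcut
    (hEc 0 (by omega)).1 rfl).mono le_rfl ?_
  rintro s₂ g ⟨h1, h2, h3, h4⟩
  refine ⟨h1, h2, h3, fun hg => ?_⟩
  obtain ⟨k, hk, ha, hb⟩ := h4 hg
  rw [hk]
  exact hE.isArboricity hes ha hb

theorem theorem2 :
    ∃ (P : Prog) (κ K : ℕ),
      ∀ (n C : ℕ) (G : SimpleGraph (Fin n)) (c : Sym2 (Fin n) → ℕ) (es : List (Fin n × Fin n))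
        (m : ℕ) (F : FlowSub) (M : CutSub) (δ : ℝ≥0∞),
        IsEdgeList G es →
        G.edgeSet.ncard = m →
        1 ≤ m →
        (∀ e ∈ G.edgeSet, 1 ≤ c e ∧ c e ≤ C) →
        F.ErrorAtMost (K * m) (K * m) ((n * C) ^ K) δ →
        M.ErrorAtMost (K * n) (K * m) ((n * C) ^ K) δ →
        let ℓ : ℝ := Real.log (n * C)
        -- the word size and the number of steps
        let w : ℕ := ⌊κ * ℓ⌋₊
        let T : ℕ := ⌊K * (m * ℓ)⌋₊
        let μ : PMF Config := Config.run w F M T (initConfig P es c)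
        (∀ σ ∈ μ.support,
          σ.Halted ∧
          (σ.flowCalls.length : ℝ) ≤ K * ℓ ∧
          (σ.cutCalls.length : ℝ) ≤ K * ℓ ∧
          (∀ I ∈ σ.flowCalls, I.Admissible (K * m) (K * m) ((n * C) ^ K)) ∧
          (∀ N ∈ σ.cutCalls, N.Admissible (K * n) (K * m) ((n * C) ^ K))) ∧
        μ.toOuterMeasure {σ | ¬ IsArboricity G c σ.output} ≤ ENNReal.ofReal (K * ℓ) * δ := by
  -- the value of `K` is hidden, so that no power with this exponent is evaluated
  obtain ⟨K, hK⟩ : ∃ K : ℕ, K = 20000 := ⟨_, rfl⟩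
  refine ⟨.seq Prog.relabel Prog.search, 20, K, ?_⟩
  intro n C G c es m F M δ hes hm hm1 hc hF hM ℓ w T μ
  rw [← hes.length_eq] at hm
  subst hm
  have hKR : (K : ℝ) = 20000 := by rw [hK]; norm_num
  obtain ⟨hN, -, -, -, -⟩ := size_bounds hes hm1 hc
  have hℓ : ℓ = Real.log (n * C : ℕ) := by simp only [ℓ, Nat.cast_mul]
  have hw : w = ⌊20 * Real.log (n * C : ℕ)⌋₊ := by simp only [w, hℓ, Nat.cast_ofNat]
  obtain ⟨hw1, hw2⟩ := wordSize_bounds hN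
  rw [← hw] at hw1 hw2
  obtain ⟨J, hJ, hJℓ⟩ := exists_rounds hN
  rw [← hℓ] at hJℓ
  have hB : 2 ^ w ≤ (n * C) ^ K := hw2.trans (Nat.pow_le_pow_right (by omega) (by omega))
  have hJ2 : ((2 * J : ℕ) : ℝ) ≤ K * ℓ := by
    push_cast
    rw [hKR]
    have : (0 : ℝ) ≤ J := Nat.cast_nonneg J
    linarith
  have hT : 1300 * es.length * (J + 1) + 1 ≤ T := by
    refine Nat.le_floor ?_
    have h1 : (1 : ℝ) ≤ es.length := by exact_mod_cast hm1
    have h2 : (0 : ℝ) ≤ J := Nat.cast_nonneg J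
    have h3 : (es.length : ℝ) * (J + 1) ≤ es.length * (8 * ℓ) :=
      mul_le_mul_of_nonneg_left hJℓ (by linarith)
    push_cast
    rw [hKR]
    nlinarith
  let s : St := ⟨fun _ => 0, fun a => (inputWords es c).getD a 0, [], []⟩
  have hrun := arboricity_spec (s := s) (w := w) (J := J) (K := K) (fun P => rfl) hes hm1 hc hw1 hJ
    (by omega)
  have hreach := (hrun.mono hT fun _ _ h => h) []
  constructor
  · intro σ hσ
    obtain ⟨g, s', rfl, h1, h2, h3, -⟩ := hreach.of_mem_support F M
      (by rintro σ g ⟨s', rfl, -⟩; rfl) hσ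
    refine ⟨rfl, le_trans ?_ hJ2, le_trans ?_ hJ2, fun I hI => (h3.1 I hI).mono hB,
      fun N hN => (h3.2 N hN).mono hB⟩
    · exact_mod_cast h1.trans (by omega)
    · exact_mod_cast h2.trans (by omega)
  · have := hreach.error_le (L := 2 * J) hF hM (E := fun σ => IsArboricity G c σ.output) ?_ trivial
    · refine this.trans (mul_le_mul_left ?_ _)
      rw [← ENNReal.ofReal_natCast]
      exact ENNReal.ofReal_le_ofReal hJ2
    · rintro σ g ⟨s', rfl, h1, h2, h3, h4⟩
      refine ⟨rfl, ⟨?_, fun I hI => (h3.1 I hI).mono hB, fun N hN => (h3.2 N hN).mono hB⟩, h4⟩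
      change s'.flowCalls.length + s'.cutCalls.length ≤ _
      omega
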